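/- Let $SU(2)\times SU(2)$ act on the complex manifold $SL(2,\mathbb C)$ by $(a,b)\cdot u=a\,u\,b^{-1}$, and let $|h|=\sqrt{2\operatorname{tr}(h^*h)}$ be the $\mathrm{Ad}\,SU(2)$-invariant norm on $\mathfrak{su}(2)$ for which $\tfrac{i}{2}\sigma_1,\tfrac{i}{2}\sigma_2,\tfrac{i}{2}\sigma_3$ ($\sigma_j$ the Pauli matrices) is an orthonormal basis. Every $u\in SL(2,\mathbb C)$ can be written as $u=g\exp(ih)$ with $g\in SU(2)$ and $h\in\mathfrak{su}(2)$, and $$K(u)=\int_0^{|h|}\sqrt[3]{\sinh(2t)-2t}\;dt$$ is a well-defined smooth function on $SL(2,\mathbb C)$. It is the Kähler potential of a Riemannian metric $g_0$ on $SL(2,\mathbb C)$ (that is, $(g_0)_{a\bar b}=\partial^2K/\partial z_a\partial\bar z_b$ in local holomorphic coordinates, so the Kähler form $g_0(i\,\cdot\,,\cdot)$ is $i\partial\bar\partial K$), and $g_0$ is a complete $SU(2)\times SU(2)$-invariant Ricci-flat Kähler metric. It is unique up to homothety: every complete $SU(2)\times SU(2)$-invariant Ricci-flat Kähler metric on $SL(2,\mathbb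 C)$ (with its standard complex structure) equals $c\,g_0$ for some constant $c>0$. -/

import Mathlib

open scoped ContDiff ENNReal Topology

noncomputable section

namespace SL2Kahler

/-- Complex `2 × 2` matrices. -/
abbrev M2 : Type := Matrix (Fin 2) (Fin 2) ℂ

/-- The group `SL(2, ℂ)`. -/
abbrev SL2 : Type := Matrix.SpecialLinearGroup (Fin 2) ℂ

/-- The model space `ℂ³` for holomorphic coordinates on `SL(2, ℂ)`. -/
abbrev C3 : Type := Fin 3 → ℂ

/-! ### `SL(2, ℂ)` as a complex submanifold of the space of matrices -/

/-- The inclusion of `SL(2, ℂ)` in the normed space `ℂ^{2 × 2}`, used for calculus. -/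
def entries (u : SL2) : Fin 2 → Fin 2 → ℂ := fun i j => (u : M2) i j

/-- The holomorphic tangent space `T_u SL(2, ℂ) = {X : tr (u⁻¹ X) = 0}`, the kernel of the
differential of `det` at `u`.  Its complex structure is multiplication by `i`. -/
def tangentSpace (u : SL2) : Submodule ℂ M2 where
  carrier := {X | (((u⁻¹ : SL2) : M2) * X).trace = 0}
  zero_mem' := by simp
  add_mem' := by
    intro X Y hX hY
    simp only [Set.mem_ofPred_eq] at *
    rw [mul_add, Matrix.trace_add, hX, hY, add_zero]
  smul_mem' := by
    intro c X hX
    simp only [Set.mem_ofPred_eq] at *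
    rw [Matrix.mul_smul, Matrix.trace_smul, hX, smul_zero]

theorem mem_tangentSpace_iff (u : SL2) (X : M2) :
    X ∈ tangentSpace u ↔
      u 1 1 * X 0 0 - u 0 1 * X 1 0 + (u 0 0 * X 1 1 - u 1 0 * X 0 1) = 0 := by
  change (((u⁻¹ : SL2) : M2) * X).trace = 0 ↔ _
  rw [Matrix.SpecialLinearGroup.coe_inv, Matrix.adjugate_fin_two, Matrix.trace_fin_two]
  simp [Matrix.mul_apply, Fin.sum_univ_two]
  constructor <;> intro h <;> linear_combination h

/-- Derivatives of `SL(2, ℂ)`-valued maps are tangent to `SL(2, ℂ)`. -/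
theorem fderiv_mem_tangentSpace {𝕜 : Type*} [NontriviallyNormedField 𝕜] [NormedAlgebra 𝕜 ℂ]
    {E : Type*} [NormedAddCommGroup E] [NormedSpace 𝕜 E] (φ : E → SL2) (z v : E) :
    Matrix.of (fderiv 𝕜 (fun x => entries (φ x)) z v) ∈ tangentSpace (φ z) := by
  by_cases h : DifferentiableAt 𝕜 (fun x => entries (φ x)) z
  · have hij : ∀ i j, HasFDerivAt (fun x => (φ x) i j)
        ((ContinuousLinearMap.proj (R := 𝕜) (φ := fun _ : Fin 2 => ℂ) j).comp
          ((ContinuousLinearMap.proj (R := 𝕜) (φ := fun _ : Fin 2 => Fin 2 → ℂ) i).comp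
            (fderiv 𝕜 (fun x => entries (φ x)) z))) z := fun i j =>
      (hasFDerivAt_pi'.1 (hasFDerivAt_pi'.1 h.hasFDerivAt i) j)
    have hdet : ∀ x, (φ x) 0 0 * (φ x) 1 1 - (φ x) 0 1 * (φ x) 1 0 = 1 := fun x => by
      have := (φ x).det_coe
      rwa [Matrix.det_fin_two] at this
    have h1 := (((hij 0 0).mul (hij 1 1)).sub ((hij 0 1).mul (hij 1 0)))
    have h2 : HasFDerivAt (fun x => (φ x) 0 0 * (φ x) 1 1 - (φ x) 0 1 * (φ x) 1 0)
        (0 : E →L[𝕜] ℂ) z := by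
      simp only [hdet]
      exact hasFDerivAt_const _ _
    have h3 := congrArg (fun L : E →L[𝕜] ℂ => L v) (h1.unique h2)
    simp at h3
    rw [mem_tangentSpace_iff]
    simp only [Matrix.of_apply]
    linear_combination h3
  · rw [fderiv_zero_of_not_differentiableAt h]
    exact (tangentSpace (φ z)).zero_mem

/-- A holomorphic local parametrization of `SL(2, ℂ)` (the inverse of a holomorphic chart):
an injective holomorphic immersion of an open set `U ⊆ ℂ³`.
Values of the map outside `U` are irrelevant. -/
structure Param where
  toFun : C3 → SL2
  U : Set C3
  isOpen : IsOpen U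
  holomorphic : DifferentiableOn ℂ (fun z => entries (toFun z)) U
  injective : Set.InjOn toFun U
  immersion : ∀ z ∈ U, Function.Injective (fderiv ℂ (fun x => entries (toFun x)) z)

/-- The tangent vector `dφ_z(v)`. -/
def Param.push (φ : Param) (z v : C3) : tangentSpace (φ.toFun z) :=
  ⟨Matrix.of (fderiv ℂ (fun x => entries (φ.toFun x)) z v),
    fderiv_mem_tangentSpace φ.toFun z v⟩

/-! ### Riemannian metrics, lengths, completeness -/

/-- A smooth Riemannian metric on the real manifold underlying `SL(2, ℂ)`. -/
structure RiemMetric where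
  inner : ∀ u : SL2, tangentSpace u →ₗ[ℝ] tangentSpace u →ₗ[ℝ] ℝ
  symm : ∀ u X Y, inner u X Y = inner u Y X
  pos : ∀ u X, X ≠ 0 → 0 < inner u X X
  smooth : ∀ (φ : Param) (v w : C3),
    ContDiffOn ℝ ∞ (fun z => inner (φ.toFun z) (φ.push z v) (φ.push z w)) φ.U

/-- The velocity `γ'(t)` of a curve in `SL(2, ℂ)`. -/
def velocity (γ : ℝ → SL2) (t : ℝ) : tangentSpace (γ t) :=
  ⟨Matrix.of (fderiv ℝ (fun s => entries (γ s)) t 1), fderiv_mem_tangentSpace γ t 1⟩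

/-- The length of `γ` restricted to `[0, 1]`. -/
def RiemMetric.length (g : RiemMetric) (γ : ℝ → SL2) : ℝ≥0∞ :=
  ∫⁻ t in Set.Icc (0 : ℝ) 1,
    ENNReal.ofReal (Real.sqrt (g.inner (γ t) (velocity γ t) (velocity γ t)))

/-- The Riemannian distance: the infimum of the lengths of `C¹` curves from `u` to `v`. -/
def RiemMetric.edist (g : RiemMetric) (u v : SL2) : ℝ≥0∞ :=
  ⨅ (γ : ℝ → SL2) (_ : ContDiff ℝ 1 (fun t => entries (γ t))) (_ : γ 0 = u) (_ : γ 1 = v),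
    g.length γ

/-- Completeness of the Riemannian distance: every Cauchy sequence converges. -/
def RiemMetric.IsComplete (g : RiemMetric) : Prop :=
  ∀ x : ℕ → SL2,
    (∀ ε : ℝ≥0∞, 0 < ε → ∃ N, ∀ m ≥ N, ∀ n ≥ N, g.edist (x m) (x n) < ε) →
    ∃ y : SL2, Filter.Tendsto (fun n => g.edist (x n) y) Filter.atTop (𝓝 0)

/-! ### Invariance -/

/-- `SU(2)` as a subset of `SL(2, ℂ)`. -/
def SU2 : Set SL2 := {a | (a : M2) ∈ Matrix.unitaryGroup (Fin 2) ℂ}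

/-- The differential `X ↦ a X b⁻¹` of the map `u ↦ a u b⁻¹`. -/
def translate (a b u : SL2) (X : tangentSpace u) : tangentSpace (a * u * b⁻¹) :=
  ⟨(a : M2) * X * ((b⁻¹ : SL2) : M2), by
    change (((a * u * b⁻¹)⁻¹ : SL2) * ((a : M2) * (X : M2) * ((b⁻¹ : SL2) : M2))).trace = 0
    have hX : (((u⁻¹ : SL2) : M2) * (X : M2)).trace = 0 := X.2
    have ha : ((a⁻¹ : SL2) : M2) * (a : M2) = 1 := by
      rw [← Matrix.SpecialLinearGroup.coe_mul, inv_mul_cancel, Matrix.SpecialLinearGroup.coe_one]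
    have hb : ((b⁻¹ : SL2) : M2) * (b : M2) = 1 := by
      rw [← Matrix.SpecialLinearGroup.coe_mul, inv_mul_cancel, Matrix.SpecialLinearGroup.coe_one]
    have h1 : (a * u * b⁻¹)⁻¹ = b * (u⁻¹ * a⁻¹) := by group
    rw [h1, Matrix.SpecialLinearGroup.coe_mul, Matrix.SpecialLinearGroup.coe_mul]
    have h2 : (b : M2) * (((u⁻¹ : SL2) : M2) * ((a⁻¹ : SL2) : M2)) *
        ((a : M2) * (X : M2) * ((b⁻¹ : SL2) : M2)) =
        (b : M2) * (((u⁻¹ : SL2) : M2) * (((a⁻¹ : SL2) : M2) * (a : M2)) * (X : M2)) *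
          ((b⁻¹ : SL2) : M2) := by
      simp only [Matrix.mul_assoc]
    rw [h2, ha, Matrix.mul_one, Matrix.trace_mul_comm, ← Matrix.mul_assoc, hb, Matrix.one_mul, hX]⟩

/-- Invariance under the action `(a, b) · u = a u b⁻¹` of `SU(2) × SU(2)`. -/
def RiemMetric.IsInvariant (g : RiemMetric) : Prop :=
  ∀ a ∈ SU2, ∀ b ∈ SU2, ∀ (u : SL2) (X Y : tangentSpace u),
    g.inner (a * u * b⁻¹) (translate a b u X) (translate a b u Y) = g.inner u X Y

/-! ### Kähler metrics -/

/-- The fundamental form `ω(X, Y) = g(iX, Y)`. -/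
def RiemMetric.omega (g : RiemMetric) (u : SL2) (X Y : tangentSpace u) : ℝ :=
  g.inner u (Complex.I • X) Y

/-- The coefficient `ω(v, w)` of the fundamental form in a holomorphic parametrization,
for constant vector fields `v`, `w` on the coordinate domain. -/
def RiemMetric.omegaCoord (g : RiemMetric) (φ : Param) (v w z : C3) : ℝ :=
  g.omega (φ.toFun z) (φ.push z v) (φ.push z w)

/-- A Kähler metric with respect to the standard complex structure: `g(iX, iY) = g(X, Y)` and
`dω = 0`, where `dω` is evaluated on constant vector fields in holomorphic coordinates. -/
structure RiemMetric.IsKahler (g : RiemMetric) : Prop where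
  hermitian : ∀ (u : SL2) (X Y : tangentSpace u),
    g.inner u (Complex.I • X) (Complex.I • Y) = g.inner u X Y
  closed : ∀ (φ : Param), ∀ z ∈ φ.U, ∀ v₁ v₂ v₃ : C3,
    fderiv ℝ (g.omegaCoord φ v₂ v₃) z v₁ + fderiv ℝ (g.omegaCoord φ v₃ v₁) z v₂ +
      fderiv ℝ (g.omegaCoord φ v₁ v₂) z v₃ = 0

/-- The Wirtinger derivative `∂f/∂z_a = (∂f/∂x_a - i ∂f/∂y_a) / 2`. -/
def dZ (a : Fin 3) (f : C3 → ℂ) (z : C3) : ℂ :=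
  (fderiv ℝ f z (Pi.single a 1) - Complex.I * fderiv ℝ f z (Pi.single a Complex.I)) / 2

/-- The Wirtinger derivative `∂f/∂z̄_a = (∂f/∂x_a + i ∂f/∂y_a) / 2`. -/
def dZbar (a : Fin 3) (f : C3 → ℂ) (z : C3) : ℂ :=
  (fderiv ℝ f z (Pi.single a 1) + Complex.I * fderiv ℝ f z (Pi.single a Complex.I)) / 2

/-- The complex Hessian `∂²F/∂z_a∂z̄_b` of a real function: the coefficients of `∂∂̄F`. -/
def complexHessian (F : C3 → ℝ) (z : C3) (a b : Fin 3) : ℂ :=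
  dZ a (dZbar b (fun x => (F x : ℂ))) z

/-- The Hermitian matrix `g_{ab̄} = g(∂/∂z_a, ∂/∂z̄_b)`, with `g` extended complex bilinearly to
the complexified tangent space.  Since `∂/∂z_a = (∂/∂x_a - i ∂/∂y_a) / 2`, for a Hermitian `g` this
equals `(g(∂/∂x_a, ∂/∂x_b) + i g(∂/∂x_a, ∂/∂y_b)) / 2`, and then
`ω = i ∑ g_{ab̄} dz_a ∧ dz̄_b`. -/
def RiemMetric.hermMatrix (g : RiemMetric) (φ : Param) (z : C3) : Matrix (Fin 3) (Fin 3) ℂ :=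
  Matrix.of fun a b =>
    ((g.inner (φ.toFun z) (φ.push z (Pi.single a 1)) (φ.push z (Pi.single b 1)) : ℝ) +
      Complex.I *
        (g.inner (φ.toFun z) (φ.push z (Pi.single a 1)) (φ.push z (Pi.single b Complex.I)) : ℝ)) / 2

/-- Ricci-flatness of a Kähler metric: the Ricci form, given in holomorphic coordinates by
`-i ∂∂̄ log det (g_{ab̄})`, vanishes. (For a Kähler metric `det (g_{ab̄})` is real and positive.) -/
def RiemMetric.IsRicciFlat (g : RiemMetric) : Prop :=
  ∀ (φ : Param), ∀ z ∈ φ.U, ∀ a b : Fin 3,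
    complexHessian (fun x => Real.log (g.hermMatrix φ x).det.re) z a b = 0

/-- `K` is a Kähler potential of `g`: `K` is smooth and `g_{ab̄} = ∂²K/∂z_a∂z̄_b` in all
holomorphic coordinates, that is, `ω = i ∂∂̄K`. -/
def RiemMetric.HasPotential (g : RiemMetric) (K : SL2 → ℝ) : Prop :=
  ∀ φ : Param, ContDiffOn ℝ ∞ (fun z => K (φ.toFun z)) φ.U ∧
    ∀ z ∈ φ.U, ∀ a b : Fin 3,
      g.hermMatrix φ z a b = complexHessian (fun x => K (φ.toFun x)) z a b

/-- A complete `SU(2) × SU(2)`-invariant Ricci-flat Kähler metric on `SL(2, ℂ)`. -/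
structure RiemMetric.IsCompleteInvariantRicciFlatKahler (g : RiemMetric) : Prop where
  isKahler : g.IsKahler
  isInvariant : g.IsInvariant
  isRicciFlat : g.IsRicciFlat
  isComplete : g.IsComplete

/-! ### The Lie algebra `su(2)` and the polar decomposition -/

/-- The Lie algebra `su(2)` of trace-free skew-Hermitian matrices. -/
def su2 : Set M2 := {h | h.conjTranspose = -h ∧ h.trace = 0}

/-- The `Ad SU(2)`-invariant norm `|h| = √(2 tr (h* h))` on `su(2)`, for which the basis
`iσ_j / 2` (`σ_j` the Pauli matrices) is orthonormal.  It is the normalization for which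
`(ad h)²` has the eigenvalue `-|h|²` on the orthogonal complement of `h`. -/
def su2Norm (h : M2) : ℝ := Real.sqrt (2 * (h.conjTranspose * h).trace.re)

/-- `u = a exp (i h)` with `a ∈ SU(2)` and `h ∈ su(2)`. -/
def IsPolar (u a : SL2) (h : M2) : Prop :=
  a ∈ SU2 ∧ h ∈ su2 ∧ (u : M2) = (a : M2) * NormedSpace.exp (Complex.I • h)

end SL2Kahler

end

open SL2Kahler

open scoped ContDiff ENNReal Topology

noncomputable section

namespace SL2Kahler

/-! The problem reduces to one real variable. By the Cartan decomposition `exists_kak`, every orbit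
of SU(2) × SU(2) meets the matrices `diagSL t` with t ≥ 0, and the orbit is determined by τ(u) = ½
tr(u*u) = cosh |h| (`tau`, `IsPolar.tau_eq`). An invariant Hermitian metric is therefore known from
its values at `diagSL t`. There the stabilizer contains a torus acting with distinct weights, so the
metric is diagonal with three positive coefficients P, Q, R (`RiemMetric.herm_diagSL`).

Uniqueness. Closedness of ω, tested on orbit directions and on the radial direction, gives Q = R and
P eᵗ = 2 (Q sinh t)'. In holomorphic coordinates det(g_{ab̄}) is the squared modulus of a
nonvanishing holomorphic function times the Gram determinant in the left-invariant frame. This Gram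
determinant depends only on τ and equals P eᵗ Q R / 8 at `diagSL t`. Ricci-flatness forces it to be
constant (`RiemMetric.density_eq`). Together these equations say that ((Q sinh t)³)' is a constant
multiple of sinh² t. As Q sinh t vanishes at t = 0, Q is determined up to a positive factor, then P
by the determinant, then the whole metric by invariance (`RiemMetric.eq_smul`).

Existence. Integrating the same equation gives (Q sinh t)³ = sinh 2t − 2t in one normalization, and
Q sinh t is the t-derivative of the potential; this is the K of the theorem. Smoothness where |h| =
0 is seen by writing K as a function of x = cosh t: its derivative `profile` is the cube root of a
positive function, smooth on x > −1, given by an explicit integral. The complex Hessian of K is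
`stenzelForm`; its Gram determinant is 1/3, so it is Ricci-flat. Positivity and completeness rest on
one inequality, d²K/dt² ≥ 1 (`one_le_profile_equation`), combined with a sharp Cauchy–Schwarz
inequality on tangent vectors. It makes log(τ + 1) Lipschitz, so a Cauchy sequence stays in a region
of bounded τ, where the metric dominates the Euclidean one. Hence the matrix entries converge, and
short explicit curves turn this into convergence for the Riemannian distance. -/

/-! ### Holomorphic functions of several variables are smooth -/

section Holomorphic

variable {E F : Type*} [NormedAddCommGroup E] [NormedSpace ℂ E]
  [NormedAddCommGroup F] [NormedSpace ℂ F]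

/-- The restriction of a function to a complex line. -/
theorem hasDerivAt_line {f : E → F} {x v : E} {ζ : ℂ} (hf : DifferentiableAt ℂ f (x + ζ • v)) :
    HasDerivAt (fun w : ℂ => f (x + w • v)) (fderiv ℂ f (x + ζ • v) v) ζ := by
  have h1 : HasDerivAt (fun w : ℂ => x + w • v) v ζ := by
    simpa using ((hasDerivAt_id ζ).smul_const v).const_add x
  exact hf.hasFDerivAt.comp_hasDerivAt ζ h1

/-- The Cauchy estimate for the differential. -/
theorem norm_fderiv_le_of_bounded {f : E → F} {x : E} {r C : ℝ} (hr : 0 < r) (hC : 0 ≤ C)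
    (hd : ∀ y ∈ Metric.closedBall x r, DifferentiableAt ℂ f y)
    (hb : ∀ y ∈ Metric.closedBall x r, ‖f y‖ ≤ C) : ‖fderiv ℂ f x‖ ≤ C / r := by
  refine ContinuousLinearMap.opNorm_le_bound _ (by positivity) fun v => ?_
  rcases eq_or_ne v 0 with rfl | hv
  · simp
  have hv' : 0 < ‖v‖ := norm_pos_iff.2 hv
  have hmem : ∀ ζ ∈ Metric.closedBall (0 : ℂ) (r / ‖v‖), x + ζ • v ∈ Metric.closedBall x r := by
    intro ζ hζ
    rw [mem_closedBall_zero_iff] at hζ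
    rw [mem_closedBall_iff_norm, add_sub_cancel_left, norm_smul]
    exact (le_div_iff₀ hv').1 hζ
  have h1 : DiffContOnCl ℂ (fun ζ : ℂ => f (x + ζ • v)) (Metric.ball 0 (r / ‖v‖)) := by
    apply DifferentiableOn.diffContOnCl
    intro ζ hζ
    exact (hasDerivAt_line (hd _ (hmem ζ (Metric.closure_ball_subset_closedBall hζ)))
      ).differentiableAt.differentiableWithinAt
  have h2 := Complex.norm_deriv_le_of_forall_mem_sphere_norm_le (div_pos hr hv') h1
    (fun ζ hζ => hb _ (hmem ζ (Metric.sphere_subset_closedBall hζ)))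
  have h0 : x + (0 : ℂ) • v = x := by simp
  have h3 := hasDerivAt_line (f := f) (x := x) (v := v) (ζ := 0)
    (by rw [h0]; exact hd x (Metric.mem_closedBall_self hr.le))
  rw [h3.deriv, h0] at h2
  calc _ ≤ _ := h2
    _ = C / r * ‖v‖ := by field_simp

variable [FiniteDimensional ℂ E] [FiniteDimensional ℂ F]

/-- Cauchy's formula on the complex line in direction v writes the directional derivative as a
circle integral of f itself. The integral depends differentiably on the base point, because the
Cauchy estimate bounds the differential of the integrand uniformly. -/
theorem differentiableOn_fderiv_apply {f : E → F} {U : Set E} (hU : IsOpen U)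
    (hf : DifferentiableOn ℂ f U) (v : E) :
    DifferentiableOn ℂ (fun z => fderiv ℂ f z v) U := by
  intro z₀ hz₀
  apply DifferentiableAt.differentiableWithinAt
  have : ProperSpace E := FiniteDimensional.proper ℂ E
  have : ProperSpace F := FiniteDimensional.proper ℂ F
  have : ProperSpace (E →L[ℂ] F) := FiniteDimensional.proper ℂ _
  borelize E
  obtain ⟨R, hR, hRU⟩ : ∃ R > 0, Metric.ball z₀ R ⊆
      {y | y ∈ U ∧ ‖f y‖ < ‖f z₀‖ + 1} := by
    have h1 : ∀ᶠ y in 𝓝 z₀, ‖f y‖ < ‖f z₀‖ + 1 :=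
      ((hf.differentiableAt (hU.mem_nhds hz₀)).continuousAt.norm).eventually_lt_const (by simp)
    exact Metric.mem_nhds_iff.1 (Filter.inter_mem (hU.mem_nhds hz₀) h1)
  -- Points within r of z₀, moved by ζ v with |ζ| ≤ ρ, stay within 2r, and balls of radius r about
  -- those stay within 3r < R, where f is bounded.
  set r := R / 4 with hr_def
  have hr : 0 < r := by positivity
  set ρ := r / (‖v‖ + 1) with hρ_def
  have hρ : 0 < ρ := by positivity
  have hρv : ρ * ‖v‖ ≤ r := by
    rw [hρ_def, div_mul_eq_mul_div, div_le_iff₀ (by positivity)]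
    nlinarith [norm_nonneg v]
  have hdiff : ∀ y ∈ Metric.ball z₀ R, DifferentiableAt ℂ f y := fun y hy =>
    hf.differentiableAt (hU.mem_nhds (hRU hy).1)
  have hmem : ∀ x ∈ Metric.ball z₀ r, ∀ ζ ∈ Metric.closedBall (0 : ℂ) ρ,
      x + ζ • v ∈ Metric.ball z₀ (2 * r) := by
    intro x hx ζ hζ
    rw [mem_closedBall_zero_iff] at hζ
    rw [mem_ball_iff_norm] at hx ⊢
    have h1 : ‖ζ • v‖ ≤ r := by
      rw [norm_smul]
      exact (mul_le_mul_of_nonneg_right hζ (norm_nonneg v)).trans hρv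
    calc ‖x + ζ • v - z₀‖ = ‖(x - z₀) + ζ • v‖ := by congr 1; abel
      _ ≤ ‖x - z₀‖ + ‖ζ • v‖ := norm_add_le _ _
      _ < 2 * r := by linarith
  have hsub : Metric.ball z₀ (2 * r) ⊆ Metric.ball z₀ R :=
    Metric.ball_subset_ball (by rw [hr_def]; linarith)
  have hbound : ∀ y ∈ Metric.ball z₀ (2 * r), ‖fderiv ℂ f y‖ ≤ (‖f z₀‖ + 1) / r := by
    intro y hy
    have hys : Metric.closedBall y r ⊆ Metric.ball z₀ R := by
      intro w hw
      rw [Metric.mem_ball] at hy ⊢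
      rw [Metric.mem_closedBall] at hw
      have := dist_triangle w y z₀
      have : 4 * r = R := by rw [hr_def]; ring
      linarith
    exact norm_fderiv_le_of_bounded hr (by positivity) (fun w hw => hdiff w (hys hw))
      (fun w hw => (hRU (hys hw)).2.le)
  -- The kernel dζ / ζ² of Cauchy's formula for the first derivative at the centre.
  set c : ℝ → ℂ := fun θ => deriv (circleMap 0 ρ) θ * ((circleMap 0 ρ θ - 0) ^ 2)⁻¹ with hc
  have hc_cont : Continuous c := by
    rw [hc]
    simp only [deriv_circleMap, sub_zero]
    refine ((continuous_circleMap 0 ρ).mul continuous_const).mul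
      (((continuous_circleMap 0 ρ).pow 2).inv₀ fun θ => ?_)
    exact pow_ne_zero _ (circleMap_ne_center hρ.ne')
  have hcirc : ∀ θ, circleMap 0 ρ θ ∈ Metric.closedBall (0 : ℂ) ρ :=
    circleMap_mem_closedBall 0 hρ.le
  have hFcont : ∀ x ∈ Metric.ball z₀ r,
      Continuous fun θ : ℝ => c θ • f (x + circleMap 0 ρ θ • v) := by
    intro x hx
    refine hc_cont.smul (continuous_iff_continuousAt.2 fun θ => ?_)
    refine ContinuousAt.comp (f := fun θ : ℝ => x + circleMap 0 ρ θ • v)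
      (hdiff _ (hsub (hmem x hx _ (hcirc θ)))).continuousAt ?_
    exact (continuous_const.add ((continuous_circleMap 0 ρ).smul continuous_const)).continuousAt
  have hball : Metric.ball z₀ r ∈ 𝓝 z₀ := Metric.ball_mem_nhds z₀ hr
  have key := intervalIntegral.hasFDerivAt_integral_of_dominated_of_fderiv_le (𝕜 := ℂ)
    (μ := MeasureTheory.volume) (a := 0) (b := 2 * Real.pi)
    (F := fun x θ => c θ • f (x + circleMap 0 ρ θ • v))
    (F' := fun x θ => c θ • fderiv ℂ f (x + circleMap 0 ρ θ • v))
    (bound := fun θ => ‖c θ‖ * ((‖f z₀‖ + 1) / r)) hball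
    (by filter_upwards [hball] with x hx using (hFcont x hx).aestronglyMeasurable)
    ((hFcont z₀ (Metric.mem_ball_self hr)).intervalIntegrable _ _)
    (by
      -- Continuity of the differential is not available at this point, but the differential of any
      -- map is measurable.
      refine hc_cont.aestronglyMeasurable.smul ?_
      refine Measurable.aestronglyMeasurable ((measurable_fderiv ℂ f).comp ?_)
      exact (continuous_const.add ((continuous_circleMap 0 ρ).smul continuous_const)).measurable)
    (by
      refine Filter.Eventually.of_forall fun θ _ x hx => ?_
      rw [norm_smul]
      exact mul_le_mul_of_nonneg_left (hbound _ (hmem x hx _ (hcirc θ))) (norm_nonneg _))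
    ((hc_cont.norm.mul continuous_const).intervalIntegrable _ _)
    (by
      refine Filter.Eventually.of_forall fun θ _ x hx => ?_
      refine HasFDerivAt.const_smul ?_ (c θ)
      have h1 := (hdiff _ (hsub (hmem x hx _ (hcirc θ)))).hasFDerivAt
      exact (hasFDerivAt_comp_add_right _).2 h1)
  have heq : (fun z => fderiv ℂ f z v) =ᶠ[𝓝 z₀] fun x =>
      (2 * Real.pi * Complex.I : ℂ)⁻¹ • ∫ θ in (0 : ℝ)..2 * Real.pi,
        c θ • f (x + circleMap 0 ρ θ • v) := by
    filter_upwards [hball] with x hx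
    have hline : ∀ ζ ∈ Metric.closedBall (0 : ℂ) ρ,
        HasDerivAt (fun w : ℂ => f (x + w • v)) (fderiv ℂ f (x + ζ • v) v) ζ := fun ζ hζ =>
      hasDerivAt_line (hdiff _ (hsub (hmem x hx ζ hζ)))
    have hO : IsOpen {ζ : ℂ | x + ζ • v ∈ Metric.ball z₀ R} :=
      Metric.isOpen_ball.preimage (by fun_prop)
    have h1 := Complex.two_pi_I_inv_smul_circleIntegral_sub_sq_inv_smul_of_differentiable
      (f := fun w : ℂ => f (x + w • v)) hO (c := 0) (w₀ := 0) (R := ρ)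
      (fun ζ hζ => hsub (hmem x hx ζ hζ))
      (fun ζ hζ => (hasDerivAt_line (hdiff _ hζ)).differentiableAt.differentiableWithinAt)
      (Metric.mem_ball_self hρ)
    rw [(hline 0 (Metric.mem_closedBall_self hρ.le)).deriv] at h1
    simp only [zero_smul, add_zero] at h1
    rw [← h1, circleIntegral]
    simp only [hc, smul_smul]
  exact ((key.const_smul _).congr_of_eventuallyEq heq).differentiableAt

/-- A holomorphic function on an open subset of a finite-dimensional space is smooth. -/
theorem contDiffOn_of_differentiableOn {f : E → F} {U : Set E} (hU : IsOpen U)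
    (hf : DifferentiableOn ℂ f U) : ContDiffOn ℂ ∞ f U := by
  rw [contDiffOn_infty]
  intro n
  induction n generalizing f with
  | zero => exact contDiffOn_zero.2 hf.continuousOn
  | succ n ih =>
    push_cast
    rw [contDiffOn_succ_iff_fderiv_of_isOpen hU]
    refine ⟨hf, by simp, ?_⟩
    rw [contDiffOn_clm_apply]
    exact fun v => ih (differentiableOn_fderiv_apply hU hf v)

end Holomorphic

/-! ### The radial profile of the potential -/

/-- The integrals `∫₀¹ sⁿ (2 + (x - 1) s²)^α ds`, smooth in `x > -1`. -/
def radialIntegral (n : ℕ) (α x : ℝ) : ℝ :=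
  ∫ s in (0 : ℝ)..1, s ^ n * (2 + (x - 1) * s ^ 2) ^ α

/-- The base is the convex combination (1 − s²) · 2 + s² · (x + 1) of positive numbers. -/
theorem radial_base_pos {x s : ℝ} (hx : -1 < x) (hs : s ∈ Set.Icc (0 : ℝ) 1) :
    0 < 2 + (x - 1) * s ^ 2 := by
  have h1 : s ^ 2 ≤ 1 := by nlinarith [hs.1, hs.2]
  rcases eq_or_ne s 0 with rfl | h0
  · norm_num
  · have h2 : 0 < (x + 1) * s ^ 2 := mul_pos (by linarith) (by positivity)
    linarith

theorem continuousOn_radial_integrand (n : ℕ) (α : ℝ) :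
    ContinuousOn (fun p : ℝ × ℝ => p.2 ^ n * (2 + (p.1 - 1) * p.2 ^ 2) ^ α)
      (Set.Ioi (-1) ×ˢ Set.Icc 0 1) := by
  refine ContinuousOn.mul (by fun_prop) (ContinuousOn.rpow_const (by fun_prop) ?_)
  rintro ⟨x, s⟩ ⟨hx, hs⟩
  exact Or.inl (radial_base_pos hx hs).ne'

theorem continuousOn_radial_integrand_right (n : ℕ) (α : ℝ) {x : ℝ} (hx : -1 < x) :
    ContinuousOn (fun s : ℝ => s ^ n * (2 + (x - 1) * s ^ 2) ^ α) (Set.uIcc 0 1) := by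
  rw [Set.uIcc_of_le zero_le_one]
  exact (continuousOn_radial_integrand n α).comp (f := fun s : ℝ => (x, s)) (by fun_prop)
    fun s hs => ⟨hx, hs⟩

theorem hasDerivAt_radialIntegral (n : ℕ) (α : ℝ) {x : ℝ} (hx : -1 < x) :
    HasDerivAt (radialIntegral n α) (α * radialIntegral (n + 2) (α - 1) x) x := by
  have hsub : Set.Icc ((x - 1) / 2) (x + 1) ×ˢ Set.Icc (0 : ℝ) 1 ⊆
      Set.Ioi (-1) ×ˢ Set.Icc 0 1 := by
    rintro ⟨y, s⟩ ⟨hy, hs⟩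
    exact ⟨show -1 < y by linarith [hy.1], hs⟩
  obtain ⟨C, hC⟩ := (isCompact_Icc.prod isCompact_Icc).exists_bound_of_continuousOn
    ((continuousOn_radial_integrand (n + 2) (α - 1)).mono hsub)
  have hnhds : Set.Ioo ((x - 1) / 2) (x + 1) ∈ 𝓝 x := Ioo_mem_nhds (by linarith) (by linarith)
  have hmeas : ∀ (k : ℕ) (β y : ℝ), -1 < y → MeasureTheory.AEStronglyMeasurable
      (fun s : ℝ => s ^ k * (2 + (y - 1) * s ^ 2) ^ β)
      (MeasureTheory.volume.restrict (Set.uIoc 0 1)) := by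
    intro k β y hy
    exact IntervalIntegrable.aestronglyMeasurable_restrict_uIoc
      (continuousOn_radial_integrand_right k β hy).intervalIntegrable
  have key := intervalIntegral.hasDerivAt_integral_of_dominated_loc_of_deriv_le (𝕜 := ℝ)
    (μ := MeasureTheory.volume) (a := 0) (b := 1) (x₀ := x)
    (F := fun y s => s ^ n * (2 + (y - 1) * s ^ 2) ^ α)
    (F' := fun y s => α * (s ^ (n + 2) * (2 + (y - 1) * s ^ 2) ^ (α - 1)))
    (bound := fun _ => |α| * C) hnhds
    (by filter_upwards [hnhds] with y hy using hmeas n α y (by linarith [hy.1]))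
    (continuousOn_radial_integrand_right n α hx).intervalIntegrable
    ((hmeas (n + 2) (α - 1) x hx).const_mul α)
    (by
      refine Filter.Eventually.of_forall fun s hs y hy => ?_
      rw [Set.uIoc_of_le zero_le_one] at hs
      rw [norm_mul, Real.norm_eq_abs]
      exact mul_le_mul_of_nonneg_left
        (hC (y, s) ⟨Set.Ioo_subset_Icc_self hy, Set.Ioc_subset_Icc_self hs⟩) (abs_nonneg α))
    (by simp)
    (by
      refine Filter.Eventually.of_forall fun s hs y hy => ?_
      rw [Set.uIoc_of_le zero_le_one] at hs
      have hpos := radial_base_pos (show -1 < y by linarith [hy.1]) (Set.Ioc_subset_Icc_self hs)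
      have h1 : HasDerivAt (fun y : ℝ => 2 + (y - 1) * s ^ 2) (s ^ 2) y := by
        simpa using (((hasDerivAt_id y).sub_const 1).mul_const (s ^ 2)).const_add 2
      convert! (h1.rpow_const (p := α) (Or.inl hpos.ne')).const_mul (s ^ n) using 1
      ring)
  convert! key.2 using 1
  rw [intervalIntegral.integral_const_mul, radialIntegral]

/-- The family is closed under differentiation, up to constants, with (n, α) replaced by (n + 2, α −
1); hence the induction on the order with n and α free. -/
theorem contDiffOn_radialIntegral (n : ℕ) (α : ℝ) :
    ContDiffOn ℝ ∞ (radialIntegral n α) (Set.Ioi (-1)) := by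
  rw [contDiffOn_infty]
  intro k
  induction k generalizing n α with
  | zero =>
    exact contDiffOn_zero.2 fun x hx =>
      (hasDerivAt_radialIntegral n α hx).continuousAt.continuousWithinAt
  | succ k ih =>
    push_cast
    rw [contDiffOn_succ_iff_deriv_of_isOpen isOpen_Ioi]
    refine ⟨fun x hx =>
      (hasDerivAt_radialIntegral n α hx).differentiableAt.differentiableWithinAt, by simp, ?_⟩
    refine ((ih (n + 2) (α - 1)).const_smul α).congr fun x hx => ?_
    rw [(hasDerivAt_radialIntegral n α hx).deriv, smul_eq_mul]

theorem radialIntegral_pos (n : ℕ) (α : ℝ) {x : ℝ} (hx : -1 < x) : 0 < radialIntegral n α x := by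
  refine intervalIntegral.intervalIntegral_pos_of_pos_on
    (continuousOn_radial_integrand_right n α hx).intervalIntegrable (fun s hs => ?_) zero_lt_one
  exact mul_pos (pow_pos hs.1 n)
    (Real.rpow_pos_of_pos (radial_base_pos hx (Set.Ioo_subset_Icc_self hs)) _)

/-- The smooth function with `radialCube (cosh t) * sinh t ^ 3 = sinh (2 * t) - 2 * t`. -/
def radialCube (x : ℝ) : ℝ := 8 * radialIntegral 2 (1 / 2) x * (x + 1) ^ (-3 / 2 : ℝ)

/-- The derivative of the potential with respect to `cosh |h|`. -/
def profile (x : ℝ) : ℝ := radialCube x ^ (1 / 3 : ℝ)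

theorem radialCube_pos {x : ℝ} (hx : -1 < x) : 0 < radialCube x :=
  mul_pos (mul_pos (by norm_num) (radialIntegral_pos 2 _ hx))
    (Real.rpow_pos_of_pos (by linarith) _)

theorem profile_pos {x : ℝ} (hx : -1 < x) : 0 < profile x :=
  Real.rpow_pos_of_pos (radialCube_pos hx) _

theorem profile_pow_three {x : ℝ} (hx : -1 < x) : profile x ^ 3 = radialCube x := by
  rw [profile, ← Real.rpow_natCast, ← Real.rpow_mul (radialCube_pos hx).le]
  norm_num

theorem contDiffOn_radialCube : ContDiffOn ℝ ∞ radialCube (Set.Ioi (-1)) := by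
  refine ContDiffOn.mul (contDiffOn_const.mul (contDiffOn_radialIntegral 2 _)) ?_
  refine ContDiffOn.rpow_const_of_ne (by fun_prop) fun x hx => ?_
  exact (show 0 < x + 1 by linarith [show -1 < x from hx]).ne'

theorem contDiffOn_profile : ContDiffOn ℝ ∞ profile (Set.Ioi (-1)) :=
  contDiffOn_radialCube.rpow_const_of_ne fun _ hx => (radialCube_pos hx).ne'

theorem contDiffOn_deriv_profile : ContDiffOn ℝ ∞ (deriv profile) (Set.Ioi (-1)) :=
  contDiffOn_profile.deriv_of_isOpen isOpen_Ioi (by simp)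

theorem hasDerivAt_profile {x : ℝ} (hx : -1 < x) : HasDerivAt profile (deriv profile x) x :=
  ((contDiffOn_profile.contDiffAt (isOpen_Ioi.mem_nhds hx)).differentiableAt
    (by simp)).hasDerivAt

/-- The first-order linear equation satisfied by the radial integral. -/
theorem radialIntegral_equation {x : ℝ} (hx : -1 < x) :
    (x - 1) * (1 / 2 * radialIntegral 4 (1 / 2 - 1) x) + 3 / 2 * radialIntegral 2 (1 / 2) x =
      (x + 1) ^ (1 / 2 : ℝ) / 2 := by
  -- The equation is the integral over [0, 1] of an exact derivative; the boundary term vanishes at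
  -- s = 0 and is (x + 1)^(1/2) / 2 at s = 1.
  have hderiv : ∀ s ∈ Set.uIcc (0 : ℝ) 1,
      HasDerivAt (fun s : ℝ => s ^ 3 * (2 + (x - 1) * s ^ 2) ^ (1 / 2 : ℝ) / 2)
        ((x - 1) / 2 * (s ^ 4 * (2 + (x - 1) * s ^ 2) ^ (1 / 2 - 1 : ℝ)) +
          3 / 2 * (s ^ 2 * (2 + (x - 1) * s ^ 2) ^ (1 / 2 : ℝ))) s := by
    intro s hs
    rw [Set.uIcc_of_le zero_le_one] at hs
    have hpos := radial_base_pos hx hs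
    have h1 : HasDerivAt (fun s : ℝ => 2 + (x - 1) * s ^ 2) ((x - 1) * (2 * s)) s := by
      simpa using ((hasDerivAt_pow 2 s).const_mul (x - 1)).const_add 2
    convert! ((hasDerivAt_pow 3 s).mul (h1.rpow_const (p := (1 / 2 : ℝ))
      (Or.inl hpos.ne'))).div_const 2 using 1
    push_cast
    ring
  have hi4 := (continuousOn_radial_integrand_right 4 (1 / 2 - 1) hx).intervalIntegrable
    (μ := MeasureTheory.volume)
  have hi2 := (continuousOn_radial_integrand_right 2 (1 / 2) hx).intervalIntegrable
    (μ := MeasureTheory.volume)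
  have h := intervalIntegral.integral_eq_sub_of_hasDerivAt hderiv
    ((hi4.const_mul _).add (hi2.const_mul _))
  rw [intervalIntegral.integral_add (hi4.const_mul _) (hi2.const_mul _),
    intervalIntegral.integral_const_mul, intervalIntegral.integral_const_mul] at h
  simp only [radialIntegral]
  norm_num at h ⊢
  rw [show (2 + (x - 1) : ℝ) = x + 1 by ring] at h
  linarith

/-- At x = cosh t, after multiplication by sinh² t, this reads (y sinh³ t)' = 4 sinh² t for y =
`radialCube (cosh t)`. In the variable x the equation persists at the degenerate point x = 1. -/
theorem deriv_radialCube {x : ℝ} (hx : -1 < x) :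
    (x ^ 2 - 1) * deriv radialCube x + 3 * x * radialCube x = 4 := by
  have hx1 : 0 < x + 1 := by linarith
  have h1 : HasDerivAt (fun x : ℝ => (x + 1) ^ (-3 / 2 : ℝ))
      (1 * (-3 / 2) * (x + 1) ^ (-3 / 2 - 1 : ℝ)) x :=
    ((hasDerivAt_id x).add_const 1).rpow_const (Or.inl hx1.ne')
  have h2 := ((hasDerivAt_radialIntegral 2 (1 / 2) hx).const_mul 8).mul h1
  have h3 : deriv radialCube x = _ := h2.deriv
  have h4 := radialIntegral_equation hx
  have e1 : (x + 1) ^ (-3 / 2 : ℝ) = (x + 1) * (x + 1) ^ (-5 / 2 : ℝ) := by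
    conv_rhs => enter [1]; rw [← Real.rpow_one (x + 1)]
    rw [← Real.rpow_add hx1]
    norm_num
  have e2 : (-3 / 2 - 1 : ℝ) = -5 / 2 := by norm_num
  have e3 : (x + 1) ^ 2 * (x + 1) ^ (-5 / 2 : ℝ) * (x + 1) ^ (1 / 2 : ℝ) = 1 := by
    rw [← Real.rpow_natCast, ← Real.rpow_add hx1, ← Real.rpow_add hx1]
    norm_num
  rw [h3, radialCube, e2, e1]
  norm_num at h4 e3 ⊢
  linear_combination (8 * (x + 1) ^ 2 * (x + 1) ^ (-(5 / 2) : ℝ)) * h4 + 4 * e3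

/-- The Ricci-flat equation for the profile. -/
theorem profile_equation {x : ℝ} (hx : -1 < x) :
    profile x ^ 2 * ((x ^ 2 - 1) * deriv profile x + x * profile x) = 4 / 3 := by
  have h1 : HasDerivAt (fun y => profile y ^ 3) (3 * profile x ^ 2 * deriv profile x) x := by
    simpa using (hasDerivAt_profile hx).fun_pow 3
  have h2 : (fun y => profile y ^ 3) =ᶠ[𝓝 x] radialCube := by
    filter_upwards [isOpen_Ioi.mem_nhds hx] with y hy using profile_pow_three hy
  have h3 := (h1.congr_of_eventuallyEq h2.symm).deriv
  have h4 := deriv_radialCube hx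
  rw [h3, ← profile_pow_three hx] at h4
  linear_combination h4 / 3

/-- For x ≥ 1 the base of the integrand is at most its value x + 1 at s = 1, which gives the bound 8
/ (3 (x + 1)). The constant 4/3 matches the right side of `profile_equation`. -/
theorem radialCube_le {x : ℝ} (hx : 1 ≤ x) : radialCube x ≤ 4 / 3 := by
  have hx1 : 0 < x + 1 := by linarith
  have hx' : -1 < x := by linarith
  have h1 : radialIntegral 2 (1 / 2) x ≤ ∫ s in (0 : ℝ)..1, s ^ 2 * (x + 1) ^ (1 / 2 : ℝ) := by
    refine intervalIntegral.integral_mono_on zero_le_one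
      (continuousOn_radial_integrand_right 2 (1 / 2) hx').intervalIntegrable
      (Continuous.intervalIntegrable (by fun_prop) _ _) fun s hs => ?_
    refine mul_le_mul_of_nonneg_left (Real.rpow_le_rpow (radial_base_pos hx' hs).le ?_
      (by norm_num)) (sq_nonneg s)
    have : s ^ 2 ≤ 1 := by nlinarith [hs.1, hs.2]
    nlinarith
  rw [intervalIntegral.integral_mul_const, integral_pow] at h1
  norm_num at h1
  have h2 : (x + 1) ^ (1 / 2 : ℝ) * (x + 1) ^ (-3 / 2 : ℝ) = (x + 1)⁻¹ := by
    rw [← Real.rpow_add hx1, ← Real.rpow_neg_one]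
    norm_num
  have h3 : 0 < (x + 1) ^ (-3 / 2 : ℝ) := Real.rpow_pos_of_pos hx1 _
  calc radialCube x = 8 * (radialIntegral 2 (1 / 2) x * (x + 1) ^ (-3 / 2 : ℝ)) := by
        rw [radialCube]; ring
    _ ≤ 8 * (1 / 3 * (x + 1) ^ (1 / 2 : ℝ) * (x + 1) ^ (-3 / 2 : ℝ)) := by
        norm_num
        exact mul_le_mul_of_nonneg_right h1 (by norm_num at h3; exact h3.le)
    _ = 8 / 3 * (x + 1)⁻¹ := by rw [mul_assoc (1 / 3 : ℝ), h2]; ring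
    _ ≤ 8 / 3 * 2⁻¹ := by
        gcongr
        linarith
    _ = 4 / 3 := by norm_num

/-- The radial second derivative of the potential is at least one. -/
theorem one_le_profile_equation {x : ℝ} (hx : 1 ≤ x) :
    1 ≤ (x ^ 2 - 1) * deriv profile x + x * profile x := by
  have hx' : -1 < x := by linarith
  have h0 := profile_pos hx'
  have h1 := profile_equation hx'
  -- From m³ ≤ 4/3: if m ≤ 1 the bound on m² is clear, and otherwise m² ≤ m³. The other factor in
  -- `profile_equation` is then at least 1.
  have h2 : profile x ^ 2 ≤ 4 / 3 := by
    have h3 := radialCube_le hx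
    rw [← profile_pow_three hx'] at h3
    by_cases h : profile x ≤ 1
    · nlinarith
    · push Not at h
      nlinarith [sq_nonneg (profile x)]
  by_contra hlt
  push Not at hlt
  nlinarith [pow_pos h0 2]

/-- Both sides vanish at t = 0 and have derivative 4 sinh² t. The integral defining `radialCube` is
what sinh 2t − 2t = 4 ∫₀ᵗ sinh² r dr becomes under the substitution sinh(r/2) = s sinh(t/2), after
division by sinh³ t. -/
theorem radialCube_cosh {t : ℝ} :
    radialCube (Real.cosh t) * Real.sinh t ^ 3 = Real.sinh (2 * t) - 2 * t := by
  have hc : ∀ s : ℝ, -1 < Real.cosh s := fun s => by linarith [Real.cosh_pos s]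
  have hd : ∀ s : ℝ, HasDerivAt
      (fun s => radialCube (Real.cosh s) * Real.sinh s ^ 3 - (Real.sinh (2 * s) - 2 * s)) 0 s := by
    intro s
    have h1 : HasDerivAt radialCube (deriv radialCube (Real.cosh s)) (Real.cosh s) :=
      ((contDiffOn_radialCube.contDiffAt (isOpen_Ioi.mem_nhds (hc s))).differentiableAt
        (by simp)).hasDerivAt
    have h2 := h1.comp s (Real.hasDerivAt_cosh s)
    have h3 : HasDerivAt (fun s => Real.sinh s ^ 3) (3 * Real.sinh s ^ 2 * Real.cosh s) s := by
      simpa using (Real.hasDerivAt_sinh s).fun_pow 3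
    have h4 : HasDerivAt (fun s => Real.sinh (2 * s) - 2 * s) (Real.cosh (2 * s) * 2 - 2) s := by
      have h5 : HasDerivAt (fun s : ℝ => 2 * s) 2 s := by
        simpa using (hasDerivAt_id s).const_mul (2 : ℝ)
      exact (h5.sinh).sub h5
    convert! (h2.mul h3).sub h4 using 1
    have h6 := deriv_radialCube (hc s)
    rw [Real.cosh_sq s] at h6
    rw [Real.cosh_two_mul, Real.cosh_sq s, Function.comp]
    linear_combination (-Real.sinh s ^ 2) * h6
  have h := is_const_of_deriv_eq_zero (fun s => (hd s).differentiableAt) (fun s => (hd s).deriv) t 0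
  simp at h
  linarith

/-- The potential as a function of `cosh |h|`. -/
def radialPotential (x : ℝ) : ℝ := ∫ y in (1 : ℝ)..x, profile y

theorem hasDerivAt_radialPotential {x : ℝ} (hx : -1 < x) :
    HasDerivAt radialPotential (profile x) x := by
  have hsub : Set.uIcc 1 x ⊆ Set.Ioi (-1) := by
    intro y hy
    have := hy.1
    exact lt_of_lt_of_le (lt_min (by norm_num) hx) this
  have hcont := contDiffOn_profile.continuousOn
  have hm : StronglyMeasurableAtFilter profile (𝓝 x) :=
    hcont.stronglyMeasurableAtFilter isOpen_Ioi x hx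
  exact intervalIntegral.integral_hasDerivAt_right (hcont.mono hsub).intervalIntegrable hm
    (hcont.continuousAt (isOpen_Ioi.mem_nhds hx))

theorem contDiffOn_radialPotential : ContDiffOn ℝ ∞ radialPotential (Set.Ioi (-1)) := by
  rw [contDiffOn_infty_iff_deriv_of_isOpen isOpen_Ioi]
  refine ⟨fun x hx => (hasDerivAt_radialPotential hx).differentiableAt.differentiableWithinAt, ?_⟩
  exact contDiffOn_profile.congr fun x hx => (hasDerivAt_radialPotential hx).deriv

/-- Substitute y = cosh s: the factor sinh s, nonnegative here, goes under the cube root and turns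
`radialCube (cosh s)` into sinh 2s − 2s. -/
theorem radialPotential_cosh {t : ℝ} (ht : 0 ≤ t) :
    radialPotential (Real.cosh t) =
      ∫ s in (0 : ℝ)..t, (Real.sinh (2 * s) - 2 * s) ^ (1 / 3 : ℝ) := by
  have hc : ∀ s : ℝ, -1 < Real.cosh s := fun s => by linarith [Real.cosh_pos s]
  have hd : ∀ s ∈ Set.uIcc 0 t, HasDerivAt (fun s => radialPotential (Real.cosh s))
      ((Real.sinh (2 * s) - 2 * s) ^ (1 / 3 : ℝ)) s := by
    intro s hs
    rw [Set.uIcc_of_le ht] at hs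
    convert! (hasDerivAt_radialPotential (hc s)).comp s (Real.hasDerivAt_cosh s) using 1
    have h0 : 0 ≤ Real.sinh s := Real.sinh_nonneg_iff.2 hs.1
    rw [← radialCube_cosh, Real.mul_rpow (radialCube_pos (hc s)).le (pow_nonneg h0 3), profile,
      ← Real.rpow_natCast, ← Real.rpow_mul h0]
    norm_num
  have h := intervalIntegral.integral_eq_sub_of_hasDerivAt hd
    (Continuous.intervalIntegrable (Continuous.rpow_const (by fun_prop)
      fun _ => Or.inr (by norm_num)) _ _)
  rw [h]
  simp [radialPotential]

/-! ### The complex Hessian -/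

/-- The real Hessian of a function on `ℂ³`. -/
def realHessian (F : C3 → ℝ) (z v w : C3) : ℝ := fderiv ℝ (fderiv ℝ F) z v w

theorem single_I (a : Fin 3) :
    (Pi.single a Complex.I : C3) = Complex.I • (Pi.single a 1 : C3) := by
  rw [← Pi.single_smul]
  simp

theorem differentiableAt_fderiv {E F : Type*} [NormedAddCommGroup E] [NormedSpace ℝ E]
    [NormedAddCommGroup F] [NormedSpace ℝ F] {f : E → F} {z : E} (hF : ContDiffAt ℝ ∞ f z) :
    DifferentiableAt ℝ (fderiv ℝ f) z :=
  (hF.fderiv_right (m := ∞) (by simp)).differentiableAt (by simp)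

theorem realHessian_symm {F : C3 → ℝ} {z : C3} (hF : ContDiffAt ℝ ∞ F z) (v w : C3) :
    realHessian F z v w = realHessian F z w v :=
  hF.isSymmSndFDerivAt (by rw [minSmoothness_of_isRCLikeNormedField]; exact WithTop.coe_le_coe.2 le_top)
    v w

theorem fderiv_fderiv_apply {F : C3 → ℝ} {z : C3} (hF : ContDiffAt ℝ ∞ F z) (v w : C3) :
    fderiv ℝ (fun x => fderiv ℝ F x v) z w = realHessian F z w v := by
  have h := (differentiableAt_fderiv hF).hasFDerivAt.clm_apply (hasFDerivAt_const v z)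
  rw [h.fderiv]
  simp [realHessian]

theorem complexHessian_eq {F : C3 → ℝ} {z : C3} (hF : ContDiffAt ℝ ∞ F z) (a b : Fin 3) :
    complexHessian F z a b =
      ((realHessian F z (Pi.single a 1) (Pi.single b 1) +
          realHessian F z (Pi.single a Complex.I) (Pi.single b Complex.I) : ℝ) +
        Complex.I * (realHessian F z (Pi.single a 1) (Pi.single b Complex.I) -
          realHessian F z (Pi.single a Complex.I) (Pi.single b 1) : ℝ)) / 4 := by
  have h1 : dZbar b (fun x => (F x : ℂ)) =ᶠ[𝓝 z] fun x =>
      ((fderiv ℝ F x (Pi.single b 1) : ℂ) +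
        Complex.I * (fderiv ℝ F x (Pi.single b Complex.I) : ℂ)) / 2 := by
    filter_upwards [(hF.of_le (m := 1) (by simp)).eventually (by simp)] with x hx
    have h2 : HasFDerivAt (fun x => (F x : ℂ)) (Complex.ofRealCLM.comp (fderiv ℝ F x)) x :=
      Complex.ofRealCLM.hasFDerivAt.comp x (hx.differentiableAt (by simp)).hasFDerivAt
    simp only [dZbar, h2.fderiv]
    simp
  have h3 : ∀ v : C3, HasFDerivAt (fun x => (fderiv ℝ F x v : ℂ))
      (Complex.ofRealCLM.comp (fderiv ℝ (fun x => fderiv ℝ F x v) z)) z := fun v =>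
    Complex.ofRealCLM.hasFDerivAt.comp z
      (((differentiableAt_fderiv hF).clm_apply (differentiableAt_const v)).hasFDerivAt)
  have h4 := (((h3 (Pi.single b 1)).add ((h3 (Pi.single b Complex.I)).const_mul
    Complex.I)).mul_const (2⁻¹ : ℂ)).congr_of_eventuallyEq
      (h1.trans (Filter.Eventually.of_forall fun x => by simp [div_eq_mul_inv]))
  simp only [complexHessian, dZ, h4.fderiv]
  simp [fderiv_fderiv_apply hF]
  linear_combination (-(realHessian F z (Pi.single a Complex.I) (Pi.single b Complex.I) : ℂ) / 4) *
    Complex.I_mul_I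

/-- The real form `½ (B(iv, w) - B(v, iw))`, where `B` is the real Hessian, is closed. -/
theorem realHessian_closed {F : C3 → ℝ} {U : Set C3} (hU : IsOpen U) (hFU : ContDiffOn ℝ ∞ F U)
    {z : C3} (hz : z ∈ U) (v₁ v₂ v₃ : C3) :
    let W : C3 → C3 → C3 → ℝ := fun v w x =>
      (realHessian F x (Complex.I • v) w - realHessian F x v (Complex.I • w)) / 2
    fderiv ℝ (W v₂ v₃) z v₁ + fderiv ℝ (W v₃ v₁) z v₂ + fderiv ℝ (W v₁ v₂) z v₃ = 0 := by
  intro W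
  have hF : ContDiffAt ℝ ∞ F z := hFU.contDiffAt (hU.mem_nhds hz)
  have hFev : ∀ᶠ x in 𝓝 z, ContDiffAt ℝ ∞ F x := by
    filter_upwards [hU.mem_nhds hz] with x hx using hFU.contDiffAt (hU.mem_nhds hx)
  have hdiff : ∀ v w, DifferentiableAt ℝ (fun x => realHessian F x v w) z := by
    intro v w
    have h1 : ContDiffAt ℝ ∞ (fderiv ℝ F) z := hF.fderiv_right (m := ∞) (by simp)
    exact ((differentiableAt_fderiv h1).clm_apply (differentiableAt_const v)).clm_apply
      (differentiableAt_const w)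
  set T : C3 → C3 → C3 → ℝ := fun a v w => fderiv ℝ (fun x => realHessian F x v w) z a with hT
  have hW : ∀ v w a, fderiv ℝ (W v w) z a =
      (T a (Complex.I • v) w - T a v (Complex.I • w)) / 2 := by
    intro v w a
    have h := ((hdiff (Complex.I • v) w).hasFDerivAt.sub
      (hdiff v (Complex.I • w)).hasFDerivAt).mul_const (2⁻¹ : ℝ)
    have h' : HasFDerivAt (W v w) _ z := h
    rw [h'.fderiv]
    simp [hT]
    ring
  have hsymm : ∀ a v w, T a v w = T a w v := by
    intro a v w
    have h : (fun x => realHessian F x v w) =ᶠ[𝓝 z] fun x => realHessian F x w v := by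
      filter_upwards [hFev] with x hx using realHessian_symm hx v w
    simp only [hT, h.fderiv_eq]
  have hsymm' : ∀ a v w, T a v w = T v a w := by
    intro a v w
    have hG : ContDiffAt ℝ ∞ (fun x => fderiv ℝ F x w) z :=
      (hF.fderiv_right (m := ∞) (by simp)).clm_apply contDiffAt_const
    have h : ∀ v, (fun x => realHessian F x v w) =ᶠ[𝓝 z]
        fun x => fderiv ℝ (fun x => fderiv ℝ F x w) x v := by
      intro v
      filter_upwards [hFev] with x hx using (fderiv_fderiv_apply hx w v).symm
    simp only [hT, (h _).fderiv_eq, fderiv_fderiv_apply hG]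
    exact realHessian_symm hG _ _
  -- The third derivative is totally symmetric; after cyclic reordering the six terms of dω cancel
  -- in pairs.
  have e : ∀ a v w, T a v w = T w a v := fun a v w => (hsymm a v w).trans (hsymm' a w v)
  rw [hW, hW, hW, e v₁, e v₂ (Complex.I • v₃), e v₃ (Complex.I • v₁)]
  ring

/-- The logarithm of the absolute value of a holomorphic function is pluriharmonic. -/
theorem complexHessian_log_normSq {h : C3 → ℂ} {U : Set C3} (hU : IsOpen U)
    (hh : DifferentiableOn ℂ h U) (h0 : ∀ z ∈ U, h z ≠ 0) {κ : ℝ} (hκ : κ ≠ 0) {z : C3}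
    (hz : z ∈ U) (a b : Fin 3) :
    complexHessian (fun x => Real.log (κ * Complex.normSq (h x))) z a b = 0 := by
  have hder : ∀ x ∈ U, ∀ v, fderiv ℝ (fun x => ((Real.log (κ * Complex.normSq (h x)) : ℝ) : ℂ)) x v
      = ((2 * (fderiv ℂ h x v * (starRingEnd ℂ) (h x)).re / Complex.normSq (h x) : ℝ) : ℂ) := by
    intro x hx v
    have hn : Complex.normSq (h x) ≠ 0 := by simpa using h0 x hx
    have hd : HasFDerivAt h ((fderiv ℂ h x).restrictScalars ℝ) x :=
      ((hh.differentiableAt (hU.mem_nhds hx)).hasFDerivAt).restrictScalars ℝ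
    have hre : HasFDerivAt (fun x => (h x).re) _ x := Complex.reCLM.hasFDerivAt.comp x hd
    have him : HasFDerivAt (fun x => (h x).im) _ x := Complex.imCLM.hasFDerivAt.comp x hd
    have h1 : HasFDerivAt (fun x => κ * Complex.normSq (h x)) _ x :=
      ((hre.mul hre).add (him.mul him)).const_mul κ
    have h2 := Complex.ofRealCLM.hasFDerivAt.comp x (h1.log (mul_ne_zero hκ hn))
    have h3 : HasFDerivAt (fun x => ((Real.log (κ * Complex.normSq (h x)) : ℝ) : ℂ)) _ x := h2
    rw [h3.fderiv]
    simp only [ContinuousLinearMap.comp_apply, Complex.ofRealCLM_apply]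
    congr 1
    simp
    field_simp
    ring
  -- ∂̄ log |h|² is the conjugate of ∂h / h, hence antiholomorphic, and the remaining ∂ kills it.
  have hbar : ∀ x ∈ U, dZbar b (fun x => ((Real.log (κ * Complex.normSq (h x)) : ℝ) : ℂ)) x =
      (starRingEnd ℂ) (fderiv ℂ h x (Pi.single b 1) / h x) := by
    intro x hx
    have hn : (Complex.normSq (h x) : ℂ) ≠ 0 := by
      simpa using h0 x hx
    rw [dZbar, hder x hx, hder x hx, single_I, map_smul, smul_eq_mul, map_div₀,
      div_eq_mul_inv _ ((starRingEnd ℂ) (h x)), Complex.inv_def, Complex.normSq_conj,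
      Complex.conj_conj]
    generalize fderiv ℂ h x (Pi.single b 1) = c
    apply Complex.ext <;> simp <;> ring
  have hw : DifferentiableOn ℂ (fun x => fderiv ℂ h x (Pi.single b 1) / h x) U :=
    fun x hx => by
      have h1 := (differentiableOn_fderiv_apply hU hh (Pi.single b 1)) x hx
      simpa only [div_eq_mul_inv] using h1.fun_mul ((hh x hx).fun_inv (h0 x hx))
  have hev : dZbar b (fun x => ((Real.log (κ * Complex.normSq (h x)) : ℝ) : ℂ)) =ᶠ[𝓝 z]
      fun x => (starRingEnd ℂ) (fderiv ℂ h x (Pi.single b 1) / h x) := by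
    filter_upwards [hU.mem_nhds hz] with x hx using hbar x hx
  obtain ⟨L, hL⟩ := hw.differentiableAt (hU.mem_nhds hz)
  have hc : HasFDerivAt (fun x => (starRingEnd ℂ) (fderiv ℂ h x (Pi.single b 1) / h x)) _ z :=
    (Complex.conjCLE : ℂ →L[ℝ] ℂ).hasFDerivAt.comp z (hL.restrictScalars ℝ)
  rw [complexHessian, dZ, hev.fderiv_eq, hc.fderiv, single_I]
  simp
  linear_combination ((starRingEnd ℂ) (L (Pi.single a 1))) * Complex.I_mul_I

/-! ### Extending a metric to all matrices -/

theorem SL2.inv_mul_self (u : SL2) : ((u⁻¹ : SL2) : M2) * (u : M2) = 1 := by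
  rw [← Matrix.SpecialLinearGroup.coe_mul, inv_mul_cancel, Matrix.SpecialLinearGroup.coe_one]

theorem SL2.mul_inv_self (u : SL2) : (u : M2) * ((u⁻¹ : SL2) : M2) = 1 := by
  rw [← Matrix.SpecialLinearGroup.coe_mul, mul_inv_cancel, Matrix.SpecialLinearGroup.coe_one]

theorem mem_tangentSpace {u : SL2} {X : M2} :
    X ∈ tangentSpace u ↔ (((u⁻¹ : SL2) : M2) * X).trace = 0 := Iff.rfl

/-- The projection of matrices to the tangent space along the line through `u`. -/
def tangentProj (u : SL2) : M2 →ₗ[ℂ] tangentSpace u where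
  toFun A := ⟨A - ((((u⁻¹ : SL2) : M2) * A).trace / 2) • (u : M2), by
    rw [mem_tangentSpace, mul_sub, Matrix.mul_smul, SL2.inv_mul_self, Matrix.trace_sub,
      Matrix.trace_smul]
    simp⟩
  map_add' A B := by
    ext1
    simp only [mul_add, Matrix.trace_add, add_div, add_smul, Submodule.coe_add]
    abel
  map_smul' c A := by
    ext1
    simp only [Matrix.mul_smul, Matrix.trace_smul, smul_eq_mul, Submodule.coe_smul,
      RingHom.id_apply, smul_sub, smul_smul, mul_div_assoc]

theorem tangentProj_coe (u : SL2) (X : tangentSpace u) : tangentProj u X = X := by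
  ext1
  simp only [tangentProj, LinearMap.coe_mk, AddHom.coe_mk, mem_tangentSpace.1 X.2, zero_div,
    zero_smul, sub_zero]

theorem coe_tangentProj_of_mem {u : SL2} {X : M2} (hX : X ∈ tangentSpace u) :
    (tangentProj u X : M2) = X :=
  congrArg Subtype.val (tangentProj_coe u ⟨X, hX⟩)

/-- The metric as a bilinear form on all matrices. -/
def RiemMetric.form (g : RiemMetric) (u : SL2) : M2 →ₗ[ℝ] M2 →ₗ[ℝ] ℝ :=
  (g.inner u).compl₁₂ ((tangentProj u).restrictScalars ℝ) ((tangentProj u).restrictScalars ℝ)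

variable {g : RiemMetric}

theorem RiemMetric.form_apply (u : SL2) (A B : M2) :
    g.form u A B = g.inner u (tangentProj u A) (tangentProj u B) := rfl

/-- Forms on the fixed space of matrices allow base points to be rewritten freely, without
transporting vectors between tangent spaces that are different types. -/
theorem RiemMetric.inner_eq_form (u : SL2) (X Y : tangentSpace u) :
    g.inner u X Y = g.form u X Y := by
  rw [RiemMetric.form_apply, tangentProj_coe, tangentProj_coe]

theorem RiemMetric.form_symm (u : SL2) (A B : M2) : g.form u A B = g.form u B A :=
  g.symm u _ _

theorem RiemMetric.form_pos {u : SL2} {A : M2} (hA : A ∈ tangentSpace u) (h0 : A ≠ 0) :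
    0 < g.form u A A := by
  refine g.pos u _ fun h => h0 ?_
  rw [← coe_tangentProj_of_mem hA]
  exact congrArg Subtype.val h

/-- The Hermitian condition `g(iX, iY) = g(X, Y)`. -/
def RiemMetric.IsHermitian (g : RiemMetric) : Prop :=
  ∀ (u : SL2) (X Y : tangentSpace u),
    g.inner u (Complex.I • X) (Complex.I • Y) = g.inner u X Y

theorem RiemMetric.IsHermitian.form_I (hg : g.IsHermitian) (u : SL2) (A B : M2) :
    g.form u (Complex.I • A) (Complex.I • B) = g.form u A B := by
  rw [RiemMetric.form_apply, (tangentProj u).map_smul, (tangentProj u).map_smul, hg,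
    RiemMetric.form_apply]

theorem RiemMetric.IsHermitian.form_I_left (hg : g.IsHermitian) (u : SL2) (A B : M2) :
    g.form u (Complex.I • A) B = -g.form u A (Complex.I • B) := by
  rw [← hg.form_I u (Complex.I • A) B, smul_smul, Complex.I_mul_I]
  simp

/-- The projection along u commutes with translation because tr(u⁻¹ A) is unchanged by it, so
invariance passes to the extended form. -/
theorem RiemMetric.IsInvariant.form_translate (hg : g.IsInvariant) {a b : SL2} (ha : a ∈ SU2)
    (hb : b ∈ SU2) (u : SL2) (A B : M2) :
    g.form (a * u * b⁻¹) ((a : M2) * A * ((b⁻¹ : SL2) : M2))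
      ((a : M2) * B * ((b⁻¹ : SL2) : M2)) = g.form u A B := by
  have key : ∀ A : M2, tangentProj (a * u * b⁻¹) ((a : M2) * A * ((b⁻¹ : SL2) : M2)) =
      translate a b u (tangentProj u A) := by
    intro A
    ext1
    have h1 : (a * u * b⁻¹)⁻¹ = b * (u⁻¹ * a⁻¹) := by group
    have h2 : (((a * u * b⁻¹)⁻¹ : SL2) : M2) * ((a : M2) * A * ((b⁻¹ : SL2) : M2)) =
        (b : M2) * (((u⁻¹ : SL2) : M2) * (((a⁻¹ : SL2) : M2) * (a : M2)) * A) *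
          ((b⁻¹ : SL2) : M2) := by
      rw [h1, Matrix.SpecialLinearGroup.coe_mul, Matrix.SpecialLinearGroup.coe_mul]
      simp only [Matrix.mul_assoc]
    have h3 : ((((a * u * b⁻¹)⁻¹ : SL2) : M2) * ((a : M2) * A * ((b⁻¹ : SL2) : M2))).trace =
        (((u⁻¹ : SL2) : M2) * A).trace := by
      rw [h2, SL2.inv_mul_self, Matrix.mul_one, Matrix.trace_mul_comm, ← Matrix.mul_assoc,
        SL2.inv_mul_self, Matrix.one_mul]
    simp only [tangentProj, translate, LinearMap.coe_mk, AddHom.coe_mk]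
    rw [h3, mul_sub, sub_mul, Matrix.mul_smul, Matrix.smul_mul,
      Matrix.SpecialLinearGroup.coe_mul, Matrix.SpecialLinearGroup.coe_mul]
  rw [RiemMetric.form_apply, key, key, hg a ha b hb, RiemMetric.form_apply]

/-! ### `SU(2)` and the Cartan decomposition -/

theorem mem_SU2_iff {a : SL2} : a ∈ SU2 ↔ (a : M2).conjTranspose * (a : M2) = 1 :=
  Matrix.mem_unitaryGroup_iff'

theorem SU2.one_mem : (1 : SL2) ∈ SU2 := by
  rw [mem_SU2_iff]
  simp

theorem SU2.mul_mem {a b : SL2} (ha : a ∈ SU2) (hb : b ∈ SU2) : a * b ∈ SU2 := by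
  change ((a * b : SL2) : M2) ∈ Matrix.unitaryGroup (Fin 2) ℂ
  rw [Matrix.SpecialLinearGroup.coe_mul]
  exact Submonoid.mul_mem _ ha hb

theorem SU2.coe_inv {a : SL2} (ha : a ∈ SU2) : ((a⁻¹ : SL2) : M2) = (a : M2).conjTranspose := by
  have h1 := mem_SU2_iff.1 ha
  calc ((a⁻¹ : SL2) : M2) = (a : M2).conjTranspose * (a : M2) * ((a⁻¹ : SL2) : M2) := by
        rw [h1, Matrix.one_mul]
    _ = _ := by rw [Matrix.mul_assoc, SL2.mul_inv_self, Matrix.mul_one]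

theorem SU2.inv_mem {a : SL2} (ha : a ∈ SU2) : a⁻¹ ∈ SU2 := by
  rw [mem_SU2_iff, SU2.coe_inv ha, Matrix.conjTranspose_conjTranspose, ← SU2.coe_inv ha,
    SL2.mul_inv_self]

/-- Half the squared Frobenius norm, equal to `cosh |h|` for `u = a exp (i h)`. -/
def tau (u : SL2) : ℝ :=
  (Complex.normSq (u 0 0) + Complex.normSq (u 0 1) + Complex.normSq (u 1 0) +
    Complex.normSq (u 1 1)) / 2

theorem tau_eq_trace (u : SL2) :
    ((u : M2).conjTranspose * (u : M2)).trace = ((2 * tau u : ℝ) : ℂ) := by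
  rw [Matrix.trace_fin_two, tau]
  simp only [Matrix.mul_apply, Fin.sum_univ_two, Matrix.conjTranspose_apply, RCLike.star_def,
    ← Complex.normSq_eq_conj_mul_self]
  push_cast
  ring

theorem tau_translate {a b : SL2} (ha : a ∈ SU2) (hb : b ∈ SU2) (u : SL2) :
    tau (a * u * b⁻¹) = tau u := by
  have h : (((a * u * b⁻¹ : SL2) : M2).conjTranspose * ((a * u * b⁻¹ : SL2) : M2)).trace =
      ((u : M2).conjTranspose * (u : M2)).trace := by
    rw [Matrix.SpecialLinearGroup.coe_mul, Matrix.SpecialLinearGroup.coe_mul,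
      Matrix.conjTranspose_mul, Matrix.conjTranspose_mul, SU2.coe_inv hb,
      Matrix.conjTranspose_conjTranspose]
    have e : (b : M2) * ((u : M2).conjTranspose * (a : M2).conjTranspose) *
        ((a : M2) * (u : M2) * (b : M2).conjTranspose) =
        (b : M2) * ((u : M2).conjTranspose * ((a : M2).conjTranspose * (a : M2)) * (u : M2)) *
          (b : M2).conjTranspose := by
      simp only [Matrix.mul_assoc]
    rw [e, mem_SU2_iff.1 ha, Matrix.mul_one, Matrix.trace_mul_comm, ← Matrix.mul_assoc,
      mem_SU2_iff.1 hb, Matrix.one_mul]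
  rw [tau_eq_trace, tau_eq_trace] at h
  have := Complex.ofReal_injective h
  linarith

theorem SL2.det_eq (u : SL2) : u 0 0 * u 1 1 - u 0 1 * u 1 0 = 1 := by
  have := u.det_coe
  rwa [Matrix.det_fin_two] at this

/-- For u with rows (a, b) and (c, d), 2τ − 2 Re(ad − bc) = |a − d̄|² + |b + c̄|². -/
theorem one_le_tau (u : SL2) : 1 ≤ tau u := by
  have h := congrArg Complex.re (SL2.det_eq u)
  simp at h
  simp only [tau, Complex.normSq_apply]
  nlinarith [sq_nonneg ((u 0 0).re - (u 1 1).re), sq_nonneg ((u 0 0).im + (u 1 1).im),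
    sq_nonneg ((u 0 1).re + (u 1 0).re), sq_nonneg ((u 0 1).im - (u 1 0).im)]

/-- The diagonal matrix `diag (e^{t/2}, e^{-t/2})`. -/
def diagSL (t : ℝ) : SL2 :=
  ⟨!![(Real.exp (t / 2) : ℂ), 0; 0, (Real.exp (-(t / 2)) : ℂ)], by
    rw [Matrix.det_fin_two]
    simp [← Complex.exp_add]⟩

/-- The Weyl element of `SU(2)`. -/
def weyl : SL2 := ⟨!![0, 1; -1, 0], by rw [Matrix.det_fin_two]; simp⟩

theorem weyl_mem : weyl ∈ SU2 := by
  rw [mem_SU2_iff]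
  ext i j
  fin_cases i <;> fin_cases j <;> simp [weyl, Matrix.mul_apply, Fin.sum_univ_two]

theorem diagSL_eq_weyl (t : ℝ) : diagSL t = weyl * diagSL (-t) * weyl⁻¹ := by
  rw [eq_mul_inv_iff_mul_eq]
  ext i j
  rw [Matrix.SpecialLinearGroup.coe_mul, Matrix.SpecialLinearGroup.coe_mul, Matrix.mul_apply,
    Matrix.mul_apply]
  fin_cases i <;> fin_cases j <;> simp [weyl, diagSL, neg_div]

theorem tau_diagSL (t : ℝ) : tau (diagSL t) = Real.cosh t := by
  simp only [tau, diagSL, Real.cosh_eq]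
  simp [-Complex.ofReal_exp, Complex.normSq_ofReal, ← Real.exp_add]
  ring_nf

open scoped ComplexOrder in
theorem exists_kak_real (u : SL2) : ∃ k ∈ SU2, ∃ l ∈ SU2, ∃ t : ℝ, u = k * diagSL t * l⁻¹ := by
  have hps := Matrix.posSemidef_conjTranspose_mul_self (u : M2)
  have hp := hps.1
  have hnn := hps.eigenvalues_nonneg
  have hdet := hp.det_eq_prod_eigenvalues
  have hconj := hp.conjStarAlgAut_star_eigenvectorUnitary
  rw [Matrix.det_mul, Matrix.det_conjTranspose, u.det_coe, Fin.prod_univ_two] at hdet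
  rw [Unitary.conjStarAlgAut_star_apply] at hconj
  obtain ⟨V, hVdef⟩ : ∃ V : M2, V = hp.eigenvectorUnitary := ⟨_, rfl⟩
  have hV : V ∈ Matrix.unitaryGroup (Fin 2) ℂ := hVdef ▸ hp.eigenvectorUnitary.2
  rw [← hVdef] at hconj
  set x := hp.eigenvalues 0 with hx
  set y := hp.eigenvalues 1 with hy
  have hxy : x * y = 1 := by
    have h : ((x * y : ℝ) : ℂ) = ((1 : ℝ) : ℂ) := by simpa using hdet.symm
    exact Complex.ofReal_injective h
  have hx0 : 0 < x := (hnn 0).lt_of_ne' (left_ne_zero_of_mul_eq_one hxy)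
  have hVV : V.conjTranspose * V = 1 := Matrix.mem_unitaryGroup_iff'.1 hV
  have hd : star V.det * V.det = 1 := by
    rw [← Matrix.det_conjTranspose, ← Matrix.det_mul, hVV, Matrix.det_one]
  -- The unitary V diagonalizing u*u need not have determinant one. Rescaling its second column by
  -- the conjugate of det V corrects this without disturbing the diagonal form.
  set S : M2 := Matrix.diagonal ![1, star V.det] with hS
  have hSS : S.conjTranspose * S = 1 := by
    rw [hS, Matrix.diagonal_conjTranspose, Matrix.diagonal_mul_diagonal, ← Matrix.diagonal_one]
    congr 1
    ext i
    fin_cases i <;> simp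
    simpa [mul_comm] using hd
  have hW : V * S ∈ Matrix.unitaryGroup (Fin 2) ℂ := by
    rw [Matrix.mem_unitaryGroup_iff', Matrix.star_eq_conjTranspose, Matrix.conjTranspose_mul,
      Matrix.mul_assoc, ← Matrix.mul_assoc _ V, hVV, Matrix.one_mul, hSS]
  have hWdet : (V * S).det = 1 := by
    rw [Matrix.det_mul, hS, Matrix.det_diagonal, Fin.prod_univ_two]
    simpa [mul_comm] using hd
  set l : SL2 := ⟨V * S, hWdet⟩ with hl
  have hlmem : l ∈ SU2 := hW
  -- The eigenvalues of u*u are x and 1/x, so the square of `diagSL t` is the diagonal form of u*u.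
  set t := Real.log x with ht
  have hex : Real.exp (t / 2) * Real.exp (t / 2) = x := by
    rw [← Real.exp_add, add_halves, Real.exp_log hx0]
  have hey : Real.exp (-(t / 2)) * Real.exp (-(t / 2)) = y := by
    rw [← Real.exp_add, ← neg_add, add_halves, Real.exp_neg, Real.exp_log hx0]
    exact inv_eq_of_mul_eq_one_right hxy
  have hdiag : (diagSL t : M2) = Matrix.diagonal ![(Real.exp (t / 2) : ℂ),
      (Real.exp (-(t / 2)) : ℂ)] := by
    ext i j
    fin_cases i <;> fin_cases j <;> simp [diagSL]
  have hDD : (diagSL t : M2).conjTranspose * (diagSL t : M2) =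
      Matrix.diagonal (RCLike.ofReal ∘ hp.eigenvalues) := by
    rw [hdiag, Matrix.diagonal_conjTranspose, Matrix.diagonal_mul_diagonal]
    congr 1
    ext i
    fin_cases i
    · simp only [← hx, Fin.zero_eta, Function.comp, ← hex]
      simp [-Complex.ofReal_exp, Complex.conj_ofReal]
    · simp only [← hy, Fin.mk_one, Function.comp, ← hey]
      simp [-Complex.ofReal_exp, Complex.conj_ofReal]
  have hlul : (l : M2).conjTranspose * ((u : M2).conjTranspose * (u : M2)) * (l : M2) =
      (diagSL t : M2).conjTranspose * (diagSL t : M2) := by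
    have e : (l : M2).conjTranspose * ((u : M2).conjTranspose * (u : M2)) * (l : M2) =
        S.conjTranspose * (V.conjTranspose * ((u : M2).conjTranspose * (u : M2)) * V) * S := by
      simp only [hl, Matrix.conjTranspose_mul, Matrix.mul_assoc]
    rw [e, hDD, ← Matrix.star_eq_conjTranspose V, hconj, hS, Matrix.diagonal_conjTranspose,
      Matrix.diagonal_mul_diagonal, Matrix.diagonal_mul_diagonal]
    congr 1
    ext i
    fin_cases i
    · simp
    · simp only [Fin.mk_one, Function.comp, Pi.star_apply, Matrix.cons_val_one,
        Matrix.cons_val_fin_one, star_star]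
      linear_combination ((RCLike.ofReal (hp.eigenvalues 1) : ℂ)) * hd
  -- The left factor is forced; it is unitary because l* u*u l is the square of `diagSL t`.
  refine ⟨u * l * (diagSL t)⁻¹, ?_, l, hlmem, t, by group⟩
  rw [mem_SU2_iff]
  simp only [Matrix.SpecialLinearGroup.coe_mul, Matrix.conjTranspose_mul]
  have e : ((diagSL t)⁻¹ : SL2).1.conjTranspose * ((l : M2).conjTranspose * (u : M2).conjTranspose) *
      ((u : M2) * (l : M2) * ((diagSL t)⁻¹ : SL2).1) =
      ((diagSL t)⁻¹ : SL2).1.conjTranspose * ((l : M2).conjTranspose *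
        ((u : M2).conjTranspose * (u : M2)) * (l : M2)) * ((diagSL t)⁻¹ : SL2).1 := by
    simp only [Matrix.mul_assoc]
  rw [e, hlul, Matrix.mul_assoc, Matrix.mul_assoc, SL2.mul_inv_self, Matrix.mul_one,
    ← Matrix.conjTranspose_mul, SL2.mul_inv_self, Matrix.conjTranspose_one]

/-- The Cartan decomposition of `SL(2, ℂ)`. -/
theorem exists_kak (u : SL2) :
    ∃ k ∈ SU2, ∃ l ∈ SU2, ∃ t : ℝ, 0 ≤ t ∧ u = k * diagSL t * l⁻¹ := by
  obtain ⟨k, hk, l, hl, t, h⟩ := exists_kak_real u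
  rcases le_total 0 t with ht | ht
  · exact ⟨k, hk, l, hl, t, ht, h⟩
  · refine ⟨k * weyl, SU2.mul_mem hk weyl_mem, l * weyl, SU2.mul_mem hl weyl_mem, -t,
      by linarith, ?_⟩
    rw [h, diagSL_eq_weyl t]
    group

/-! ### The Hermitian form of a metric and its Gram determinant -/

/-- The Hermitian form `½ (g(A, B) + i g(A, iB))`, complex linear in `A` for a Hermitian metric. -/
def RiemMetric.herm (g : RiemMetric) (u : SL2) (A B : M2) : ℂ :=
  ((g.form u A B : ℝ) + Complex.I * (g.form u A (Complex.I • B) : ℝ)) / 2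

theorem RiemMetric.form_eq_herm (u : SL2) (A B : M2) : g.form u A B = 2 * (g.herm u A B).re := by
  simp [RiemMetric.herm]
  ring

theorem RiemMetric.herm_add_left (u : SL2) (A A' B : M2) :
    g.herm u (A + A') B = g.herm u A B + g.herm u A' B := by
  simp only [RiemMetric.herm, map_add, LinearMap.add_apply]
  push_cast
  ring

theorem RiemMetric.IsHermitian.herm_conj (hg : g.IsHermitian) (u : SL2) (A B : M2) :
    (starRingEnd ℂ) (g.herm u A B) = g.herm u B A := by
  have h : g.form u B (Complex.I • A) = -g.form u A (Complex.I • B) := by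
    rw [g.form_symm, hg.form_I_left]
  simp only [RiemMetric.herm, h, g.form_symm u B A]
  simp [map_ofNat]

theorem RiemMetric.IsHermitian.herm_smul_left (hg : g.IsHermitian) (u : SL2) (c : ℂ) (A B : M2) :
    g.herm u (c • A) B = c * g.herm u A B := by
  have hc : ∀ A : M2, c • A = c.re • A + c.im • (Complex.I • A) := by
    intro A
    ext i j
    simp only [Matrix.smul_apply, Matrix.add_apply, smul_eq_mul, Complex.real_smul]
    conv_lhs => rw [← Complex.re_add_im c]
    ring
  simp only [RiemMetric.herm, hc, map_add, LinearMap.add_apply, map_smul, LinearMap.smul_apply,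
    hg.form_I, hg.form_I_left, smul_eq_mul]
  conv_rhs => enter [1]; rw [← Complex.re_add_im c]
  push_cast
  linear_combination ((c.im : ℂ) * (g.form u A (Complex.I • B) : ℂ) / 2) * (-Complex.I_mul_I)

theorem RiemMetric.IsHermitian.herm_smul_right (hg : g.IsHermitian) (u : SL2) (c : ℂ) (A B : M2) :
    g.herm u A (c • B) = (starRingEnd ℂ) c * g.herm u A B := by
  rw [← hg.herm_conj, hg.herm_smul_left, map_mul, hg.herm_conj]

theorem RiemMetric.IsHermitian.herm_add_right (hg : g.IsHermitian) (u : SL2) (A B B' : M2) :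
    g.herm u A (B + B') = g.herm u A B + g.herm u A B' := by
  rw [← hg.herm_conj, g.herm_add_left, map_add, hg.herm_conj, hg.herm_conj]

theorem RiemMetric.IsHermitian.herm_self (hg : g.IsHermitian) (u : SL2) (A : M2) :
    g.herm u A A = (g.form u A A : ℝ) / 2 := by
  have h : g.form u A (Complex.I • A) = 0 := by
    have := hg.form_I_left u A A
    rw [g.form_symm] at this
    linarith
  simp [RiemMetric.herm, h]

theorem RiemMetric.IsInvariant.herm_translate (hg : g.IsInvariant) {a b : SL2} (ha : a ∈ SU2)
    (hb : b ∈ SU2) (u : SL2) (A B : M2) :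
    g.herm (a * u * b⁻¹) ((a : M2) * A * ((b⁻¹ : SL2) : M2))
      ((a : M2) * B * ((b⁻¹ : SL2) : M2)) = g.herm u A B := by
  have h : Complex.I • ((a : M2) * B * ((b⁻¹ : SL2) : M2)) =
      (a : M2) * (Complex.I • B) * ((b⁻¹ : SL2) : M2) := by
    rw [Matrix.mul_smul, Matrix.smul_mul]
  simp only [RiemMetric.herm, h, hg.form_translate ha hb]

/-- The standard basis of `sl(2, ℂ)`. -/
def frame : Fin 3 → M2 := ![!![1, 0; 0, -1], !![0, 1; 0, 0], !![0, 0; 1, 0]]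

/-- The coordinates of a trace-free matrix in the standard basis. -/
def frameCoord (ξ : M2) : Fin 3 → ℂ := ![ξ 0 0, ξ 0 1, ξ 1 0]

theorem eq_sum_frame {ξ : M2} (h : ξ.trace = 0) : ξ = ∑ k, frameCoord ξ k • frame k := by
  rw [Matrix.trace_fin_two] at h
  rw [Fin.sum_univ_three]
  ext i j
  fin_cases i <;> fin_cases j <;> simp [frame, frameCoord]
  linear_combination h

/-- The Gram matrix of the metric in the left-invariant holomorphic frame. -/
def RiemMetric.gram (g : RiemMetric) (u : SL2) : Matrix (Fin 3) (Fin 3) ℂ :=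
  Matrix.of fun k l => g.herm u ((u : M2) * frame k) ((u : M2) * frame l)

theorem RiemMetric.IsHermitian.herm_gram (hg : g.IsHermitian) (u : SL2) (ξ : Fin 3 → M2)
    (hξ : ∀ a, (ξ a).trace = 0) :
    (Matrix.of fun a b => g.herm u ((u : M2) * ξ a) ((u : M2) * ξ b)) =
      (Matrix.of fun a k => frameCoord (ξ a) k) * g.gram u *
        (Matrix.of fun a k => frameCoord (ξ a) k).conjTranspose := by
  have h : ∀ a, (u : M2) * ξ a = ∑ k, frameCoord (ξ a) k • ((u : M2) * frame k) := by
    intro a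
    conv_lhs => rw [eq_sum_frame (hξ a)]
    simp only [Finset.mul_sum, Matrix.mul_smul]
  ext a b
  simp only [Matrix.of_apply, h, Fin.sum_univ_three, g.herm_add_left, hg.herm_add_right,
    hg.herm_smul_left, hg.herm_smul_right, Matrix.mul_apply, Matrix.conjTranspose_apply,
    RiemMetric.gram, RCLike.star_def]
  ring

/-- Changing the frame by a matrix C multiplies the Gram determinant by |det C|²; for a holomorphic
C this is invisible to the Ricci form. -/
theorem RiemMetric.IsHermitian.det_herm (hg : g.IsHermitian) (u : SL2) (ξ : Fin 3 → M2)
    (hξ : ∀ a, (ξ a).trace = 0) :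
    (Matrix.of fun a b => g.herm u ((u : M2) * ξ a) ((u : M2) * ξ b)).det =
      (Complex.normSq (Matrix.of fun a k => frameCoord (ξ a) k).det : ℂ) * (g.gram u).det := by
  rw [hg.herm_gram u ξ hξ, Matrix.det_mul, Matrix.det_mul, Matrix.det_conjTranspose,
    ← Complex.mul_conj, RCLike.star_def]
  ring

/-- As a polynomial in the entries of l this determinant is (det l)³. -/
theorem det_adjoint (l : SL2) :
    (Matrix.of fun a k => frameCoord (((l⁻¹ : SL2) : M2) * frame a * (l : M2)) k).det = 1 := by
  have h := SL2.det_eq l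
  rw [Matrix.det_fin_three, Matrix.SpecialLinearGroup.coe_inv, Matrix.adjugate_fin_two]
  simp [frameCoord, frame, Matrix.mul_apply, Fin.sum_univ_two]
  generalize l 0 0 = a at *
  generalize l 0 1 = b at *
  generalize l 1 0 = c at *
  generalize l 1 1 = d at *
  have e : a * d = 1 + b * c := by linear_combination h
  linear_combination ((a * d - b * c) ^ 2 + (a * d - b * c) + 1) * h

/-- The left-invariant frame is carried by (a, b) to itself twisted by the adjoint action of b,
which is unimodular. So the Gram determinant is a function on the orbit space. -/
theorem RiemMetric.gramDet_translate (hg : g.IsHermitian) (hi : g.IsInvariant) {a b : SL2}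
    (ha : a ∈ SU2) (hb : b ∈ SU2) (u : SL2) :
    (g.gram (a * u * b⁻¹)).det = (g.gram u).det := by
  have h : g.gram (a * u * b⁻¹) = Matrix.of fun k l =>
      g.herm u ((u : M2) * (((b⁻¹ : SL2) : M2) * frame k * (b : M2)))
        ((u : M2) * (((b⁻¹ : SL2) : M2) * frame l * (b : M2))) := by
    have e : ∀ k, ((a * u * b⁻¹ : SL2) : M2) * frame k =
        (a : M2) * ((u : M2) * (((b⁻¹ : SL2) : M2) * frame k * (b : M2))) *
          ((b⁻¹ : SL2) : M2) := by
      intro k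
      simp only [Matrix.SpecialLinearGroup.coe_mul, Matrix.mul_assoc]
      rw [SL2.mul_inv_self, Matrix.mul_one]
    ext k l
    simp only [RiemMetric.gram, Matrix.of_apply, e, hi.herm_translate ha hb]
  rw [h, hg.det_herm, det_adjoint]
  · simp
  · intro k
    rw [Matrix.mul_assoc, Matrix.trace_mul_comm, Matrix.mul_assoc, SL2.mul_inv_self, Matrix.mul_one,
      Matrix.trace_fin_two]
    fin_cases k <;> simp [frame]

/-! ### Invariant metrics along the diagonal subgroup -/

/-- The radial tangent vector at `diagSL t` with upper left entry `1`. -/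
def radialVec (t : ℝ) : M2 := !![1, 0; 0, -(Real.exp (-t) : ℂ)]

/-- The upper right matrix unit. -/
def upperVec : M2 := !![0, 1; 0, 0]

/-- The lower left matrix unit. -/
def lowerVec : M2 := !![0, 0; 1, 0]

/-- The radial coefficient of an invariant metric along the diagonal subgroup. -/
def RiemMetric.coeffP (g : RiemMetric) (t : ℝ) : ℝ := g.form (diagSL t) (radialVec t) (radialVec t)

/-- The upper off-diagonal coefficient of an invariant metric along the diagonal subgroup. -/
def RiemMetric.coeffQ (g : RiemMetric) (t : ℝ) : ℝ := g.form (diagSL t) upperVec upperVec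

/-- The lower off-diagonal coefficient of an invariant metric along the diagonal subgroup. -/
def RiemMetric.coeffR (g : RiemMetric) (t : ℝ) : ℝ := g.form (diagSL t) lowerVec lowerVec

theorem mem_tangentSpace_diagSL {t : ℝ} {A : M2} :
    A ∈ tangentSpace (diagSL t) ↔ A 1 1 = -(Real.exp (-t) : ℂ) * A 0 0 := by
  have e : (Real.exp (-(t / 2)) : ℂ) * (Real.exp (t / 2) : ℂ) = 1 := by
    rw [← Complex.ofReal_mul, ← Real.exp_add]
    simp
  have e' : (Real.exp (-t) : ℂ) = (Real.exp (-(t / 2)) : ℂ) * (Real.exp (-(t / 2)) : ℂ) := by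
    rw [← Complex.ofReal_mul, ← Real.exp_add]
    ring_nf
  have hne : (Real.exp (t / 2) : ℂ) ≠ 0 := by exact_mod_cast (Real.exp_pos _).ne'
  rw [mem_tangentSpace_iff, e']
  simp only [diagSL, Matrix.of_apply, Matrix.cons_val', Matrix.cons_val_zero, Matrix.cons_val_one,
    Matrix.cons_val_fin_one, zero_mul, sub_zero]
  constructor <;> intro h
  · linear_combination (Real.exp (-(t / 2)) : ℂ) * h - A 1 1 * e
  · linear_combination (Real.exp (t / 2) : ℂ) * h - (Real.exp (-(t / 2)) : ℂ) * A 0 0 * e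

theorem eq_sum_of_mem_tangentSpace_diagSL {t : ℝ} {A : M2} (hA : A ∈ tangentSpace (diagSL t)) :
    A = A 0 0 • radialVec t + A 0 1 • upperVec + A 1 0 • lowerVec := by
  rw [mem_tangentSpace_diagSL] at hA
  ext i j
  fin_cases i <;> fin_cases j <;> simp [radialVec, upperVec, lowerVec]
  rw [hA]
  simp
  ring

theorem radialVec_mem (t : ℝ) : radialVec t ∈ tangentSpace (diagSL t) := by
  rw [mem_tangentSpace_diagSL]
  simp [radialVec]

theorem upperVec_mem (t : ℝ) : upperVec ∈ tangentSpace (diagSL t) := by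
  rw [mem_tangentSpace_diagSL]
  simp [upperVec]

theorem lowerVec_mem (t : ℝ) : lowerVec ∈ tangentSpace (diagSL t) := by
  rw [mem_tangentSpace_diagSL]
  simp [lowerVec]

theorem RiemMetric.coeffP_pos (t : ℝ) : 0 < g.coeffP t :=
  g.form_pos (radialVec_mem t) fun h => by simpa [radialVec] using congrFun (congrFun h 0) 0

theorem RiemMetric.coeffQ_pos (t : ℝ) : 0 < g.coeffQ t :=
  g.form_pos (upperVec_mem t) fun h => by simpa [upperVec] using congrFun (congrFun h 0) 1

theorem RiemMetric.coeffR_pos (t : ℝ) : 0 < g.coeffR t :=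
  g.form_pos (lowerVec_mem t) fun h => by simpa [lowerVec] using congrFun (congrFun h 1) 0

/-- The diagonal element `diag (ζ, ζ̄)` of `SU(2)` with `ζ = (1 + i) / √2`. -/
def eighthTurn : SL2 :=
  ⟨!![(1 + Complex.I) / (Real.sqrt 2 : ℂ), 0; 0, (1 - Complex.I) / (Real.sqrt 2 : ℂ)], by
    have h : (Real.sqrt 2 : ℂ) * (Real.sqrt 2 : ℂ) = 2 := by
      rw [← Complex.ofReal_mul, Real.mul_self_sqrt (by norm_num)]
      norm_num
    have h0 : (Real.sqrt 2 : ℂ) ≠ 0 := by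
      intro h0
      simp [h0] at h
    rw [Matrix.det_fin_two]
    simp
    field_simp
    linear_combination -Complex.I_mul_I - h⟩

theorem sqrt_two_mul_self : (Real.sqrt 2 : ℂ) * (Real.sqrt 2 : ℂ) = 2 := by
  rw [← Complex.ofReal_mul, Real.mul_self_sqrt (by norm_num)]
  norm_num

theorem eighthTurn_mem : eighthTurn ∈ SU2 := by
  have h := sqrt_two_mul_self
  have h0 : (Real.sqrt 2 : ℂ) ≠ 0 := by
    intro h0
    simp [h0] at h
  rw [mem_SU2_iff]
  ext i j
  fin_cases i <;> fin_cases j <;>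
    simp [eighthTurn, Matrix.mul_apply, Fin.sum_univ_two, Complex.conj_ofReal]
  · field_simp
    linear_combination -Complex.I_mul_I - h
  · field_simp
    linear_combination -Complex.I_mul_I - h

theorem eighthTurn_conj (A : M2) :
    (eighthTurn : M2) * A * ((eighthTurn⁻¹ : SL2) : M2) =
      !![A 0 0, Complex.I * A 0 1; -Complex.I * A 1 0, A 1 1] := by
  have h := sqrt_two_mul_self
  have h0 : (Real.sqrt 2 : ℂ) ≠ 0 := by
    intro h0
    simp [h0] at h
  rw [Matrix.SpecialLinearGroup.coe_inv, Matrix.adjugate_fin_two]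
  ext i j
  fin_cases i <;> fin_cases j <;>
    simp [eighthTurn, Matrix.mul_apply, Matrix.vecMul, dotProduct, Fin.sum_univ_two]
  all_goals field_simp
  · linear_combination -A 0 0 * Complex.I_mul_I - A 0 0 * h
  · linear_combination A 0 1 * Complex.I_mul_I - A 0 1 * Complex.I * h
  · linear_combination A 1 0 * Complex.I_mul_I + A 1 0 * Complex.I * h
  · linear_combination -A 1 1 * Complex.I_mul_I - A 1 1 * h

theorem eighthTurn_diagSL (t : ℝ) : eighthTurn * diagSL t * eighthTurn⁻¹ = diagSL t := by
  apply Subtype.ext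
  rw [Matrix.SpecialLinearGroup.coe_mul, Matrix.SpecialLinearGroup.coe_mul, eighthTurn_conj]
  ext i j
  fin_cases i <;> fin_cases j <;> simp [diagSL]

/-- An invariant Hermitian metric is diagonal along the diagonal subgroup. -/
theorem RiemMetric.herm_diagSL (hg : g.IsHermitian) (hi : g.IsInvariant) (t : ℝ) {A B : M2}
    (hA : A ∈ tangentSpace (diagSL t)) (hB : B ∈ tangentSpace (diagSL t)) :
    g.herm (diagSL t) A B = ((g.coeffP t : ℂ) * (A 0 0 * (starRingEnd ℂ) (B 0 0)) +
      (g.coeffQ t : ℂ) * (A 0 1 * (starRingEnd ℂ) (B 0 1)) +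
      (g.coeffR t : ℂ) * (A 1 0 * (starRingEnd ℂ) (B 1 0))) / 2 := by
  have hinv : ∀ A B : M2, g.herm (diagSL t) ((eighthTurn : M2) * A * ((eighthTurn⁻¹ : SL2) : M2))
      ((eighthTurn : M2) * B * ((eighthTurn⁻¹ : SL2) : M2)) = g.herm (diagSL t) A B := by
    intro A B
    have := hi.herm_translate eighthTurn_mem eighthTurn_mem (diagSL t) A B
    rwa [eighthTurn_diagSL] at this
  have eP : (eighthTurn : M2) * radialVec t * ((eighthTurn⁻¹ : SL2) : M2) = radialVec t := by
    rw [eighthTurn_conj]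
    ext i j
    fin_cases i <;> fin_cases j <;> simp [radialVec]
  have eQ : (eighthTurn : M2) * upperVec * ((eighthTurn⁻¹ : SL2) : M2) = Complex.I • upperVec := by
    rw [eighthTurn_conj]
    ext i j
    fin_cases i <;> fin_cases j <;> simp [upperVec]
  have eR : (eighthTurn : M2) * lowerVec * ((eighthTurn⁻¹ : SL2) : M2) =
      (-Complex.I) • lowerVec := by
    rw [eighthTurn_conj]
    ext i j
    fin_cases i <;> fin_cases j <;> simp [lowerVec]
  have one_add_I : (1 + Complex.I) ≠ 0 := fun h => by simpa using congrArg Complex.re h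
  have one_sub_I : (1 - Complex.I) ≠ 0 := fun h => by simpa using congrArg Complex.re h
  -- `eighthTurn` fixes `diagSL t` and acts isometrically on the three basis vectors with
  -- eigenvalues 1, i and −i; eigenvectors of an isometry for distinct eigenvalues are orthogonal.
  have hPQ : g.herm (diagSL t) (radialVec t) upperVec = 0 := by
    have h := hinv (radialVec t) upperVec
    rw [eP, eQ, hg.herm_smul_right, Complex.conj_I] at h
    exact (mul_eq_zero.1 (show (1 + Complex.I) * _ = 0 by linear_combination -h)).resolve_left
      one_add_I
  have hPR : g.herm (diagSL t) (radialVec t) lowerVec = 0 := by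
    have h := hinv (radialVec t) lowerVec
    rw [eP, eR, hg.herm_smul_right, map_neg, Complex.conj_I] at h
    exact (mul_eq_zero.1 (show (1 - Complex.I) * _ = 0 by linear_combination -h)).resolve_left
      one_sub_I
  have hQR : g.herm (diagSL t) upperVec lowerVec = 0 := by
    have h := hinv upperVec lowerVec
    rw [eQ, eR, hg.herm_smul_right, hg.herm_smul_left, map_neg, Complex.conj_I] at h
    linear_combination (-1 / 2) * h + (g.herm (diagSL t) upperVec lowerVec / 2) * Complex.I_mul_I
  have hQP : g.herm (diagSL t) upperVec (radialVec t) = 0 := by rw [← hg.herm_conj, hPQ, map_zero]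
  have hRP : g.herm (diagSL t) lowerVec (radialVec t) = 0 := by rw [← hg.herm_conj, hPR, map_zero]
  have hRQ : g.herm (diagSL t) lowerVec upperVec = 0 := by rw [← hg.herm_conj, hQR, map_zero]
  conv_lhs =>
    rw [eq_sum_of_mem_tangentSpace_diagSL hA, eq_sum_of_mem_tangentSpace_diagSL hB]
  simp only [g.herm_add_left, hg.herm_add_right, hg.herm_smul_left, hg.herm_smul_right, hPQ, hPR,
    hQR, hQP, hRP, hRQ, hg.herm_self, RiemMetric.coeffP, RiemMetric.coeffQ, RiemMetric.coeffR]
  ring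

theorem RiemMetric.form_diagSL (hg : g.IsHermitian) (hi : g.IsInvariant) (t : ℝ) {A B : M2}
    (hA : A ∈ tangentSpace (diagSL t)) (hB : B ∈ tangentSpace (diagSL t)) :
    g.form (diagSL t) A B = g.coeffP t * (A 0 0 * (starRingEnd ℂ) (B 0 0)).re +
      g.coeffQ t * (A 0 1 * (starRingEnd ℂ) (B 0 1)).re +
      g.coeffR t * (A 1 0 * (starRingEnd ℂ) (B 1 0)).re := by
  rw [g.form_eq_herm, g.herm_diagSL hg hi t hA hB]
  simp only [Complex.div_ofNat_re, Complex.add_re, Complex.re_ofReal_mul]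
  ring

/-- At `diagSL t` the frame vectors are `radialVec t`, `upperVec` and `lowerVec` scaled by e^{t/2},
e^{t/2} and e^{−t/2}. The squared scalings multiply to eᵗ, and each diagonal entry carries a factor
½. -/
theorem RiemMetric.gramDet_diagSL (hg : g.IsHermitian) (hi : g.IsInvariant) (t : ℝ) :
    (g.gram (diagSL t)).det =
      ((g.coeffP t * Real.exp t * g.coeffQ t * g.coeffR t / 8 : ℝ) : ℂ) := by
  have hmem : ∀ k, (diagSL t : M2) * frame k ∈ tangentSpace (diagSL t) := by
    intro k
    rw [mem_tangentSpace, ← Matrix.mul_assoc, SL2.inv_mul_self, Matrix.one_mul,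
      Matrix.trace_fin_two]
    fin_cases k <;> simp [frame]
  have e : (Real.exp (-(t / 2)) : ℂ) * (Real.exp (t / 2) : ℂ) = 1 := by
    rw [← Complex.ofReal_mul, ← Real.exp_add]
    simp
  have e' : (Real.exp t : ℂ) = (Real.exp (t / 2) : ℂ) * (Real.exp (t / 2) : ℂ) := by
    rw [← Complex.ofReal_mul, ← Real.exp_add]
    ring_nf
  rw [Matrix.det_fin_three]
  simp only [RiemMetric.gram, Matrix.of_apply, g.herm_diagSL hg hi t (hmem _) (hmem _)]
  push_cast
  rw [← Complex.ofReal_exp, e']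
  simp [-Complex.ofReal_exp, frame, diagSL, Matrix.mul_apply, Fin.sum_univ_two,
    Complex.conj_ofReal]
  generalize (Real.exp (t / 2) : ℂ) = x at *
  generalize (Real.exp (-(t / 2)) : ℂ) = y at *
  linear_combination (g.coeffP t * g.coeffQ t * g.coeffR t * x ^ 2 / 8 * (x * y + 1) : ℂ) * e

/-! ### The Frobenius pairing -/

/-- The Frobenius pairing `tr (A B*)`. -/
def pair (A B : M2) : ℂ :=
  A 0 0 * (starRingEnd ℂ) (B 0 0) + A 0 1 * (starRingEnd ℂ) (B 0 1) +
    A 1 0 * (starRingEnd ℂ) (B 1 0) + A 1 1 * (starRingEnd ℂ) (B 1 1)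

/-- The squared Frobenius norm. -/
def frobSq (A : M2) : ℝ :=
  Complex.normSq (A 0 0) + Complex.normSq (A 0 1) + Complex.normSq (A 1 0) +
    Complex.normSq (A 1 1)

theorem pair_self (A : M2) : pair A A = (frobSq A : ℂ) := by
  simp only [pair, frobSq, Complex.mul_conj]
  push_cast
  ring

theorem tau_eq_frobSq (u : SL2) : tau u = frobSq u / 2 := rfl

theorem frobSq_nonneg (A : M2) : 0 ≤ frobSq A := by
  simp only [frobSq]
  have := fun z : ℂ => Complex.normSq_nonneg z
  linarith [this (A 0 0), this (A 0 1), this (A 1 0), this (A 1 1)]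

theorem frobSq_pos {A : M2} (h : A ≠ 0) : 0 < frobSq A := by
  refine (frobSq_nonneg A).lt_of_ne' fun h0 => h ?_
  simp only [frobSq] at h0
  have := fun z : ℂ => Complex.normSq_nonneg z
  ext i j
  have h4 : Complex.normSq (A 0 0) = 0 ∧ Complex.normSq (A 0 1) = 0 ∧
      Complex.normSq (A 1 0) = 0 ∧ Complex.normSq (A 1 1) = 0 := by
    refine ⟨?_, ?_, ?_, ?_⟩ <;> linarith [this (A 0 0), this (A 0 1), this (A 1 0), this (A 1 1)]
  simp only [Complex.normSq_eq_zero] at h4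
  fin_cases i <;> fin_cases j <;> simp [h4]

theorem pair_eq_trace (A B : M2) : pair A B = (B.conjTranspose * A).trace := by
  rw [Matrix.trace_fin_two, pair]
  simp only [Matrix.mul_apply, Fin.sum_univ_two, Matrix.conjTranspose_apply, RCLike.star_def]
  ring

theorem pair_translate {a b : SL2} (ha : a ∈ SU2) (hb : b ∈ SU2) (A B : M2) :
    pair ((a : M2) * A * ((b⁻¹ : SL2) : M2)) ((a : M2) * B * ((b⁻¹ : SL2) : M2)) = pair A B := by
  rw [pair_eq_trace, pair_eq_trace, Matrix.conjTranspose_mul, Matrix.conjTranspose_mul,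
    SU2.coe_inv hb, Matrix.conjTranspose_conjTranspose]
  have e : (b : M2) * (B.conjTranspose * (a : M2).conjTranspose) *
      ((a : M2) * A * (b : M2).conjTranspose) =
      (b : M2) * (B.conjTranspose * ((a : M2).conjTranspose * (a : M2)) * A) *
        (b : M2).conjTranspose := by
    simp only [Matrix.mul_assoc]
  rw [e, mem_SU2_iff.1 ha, Matrix.mul_one, Matrix.trace_mul_comm, ← Matrix.mul_assoc,
    mem_SU2_iff.1 hb, Matrix.one_mul]

theorem pair_add_left (A A' B : M2) : pair (A + A') B = pair A B + pair A' B := by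
  simp only [pair, Matrix.add_apply]
  ring

theorem pair_smul_left (c : ℂ) (A B : M2) : pair (c • A) B = c * pair A B := by
  simp only [pair, Matrix.smul_apply, smul_eq_mul]
  ring

theorem pair_conj (A B : M2) : (starRingEnd ℂ) (pair A B) = pair B A := by
  simp only [pair, map_add, map_mul, Complex.conj_conj]
  ring

theorem pair_smul_right (c : ℂ) (A B : M2) : pair A (c • B) = (starRingEnd ℂ) c * pair A B := by
  rw [← pair_conj, pair_smul_left, map_mul, pair_conj]

theorem pair_add_right (A B B' : M2) : pair A (B + B') = pair A B + pair A B' := by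
  rw [← pair_conj, pair_add_left, map_add, pair_conj, pair_conj]

theorem normSq_pair_le (A B : M2) : Complex.normSq (pair A B) ≤ frobSq A * frobSq B := by
  have h1 := norm_add_le (A 0 0 * (starRingEnd ℂ) (B 0 0) + A 0 1 * (starRingEnd ℂ) (B 0 1) +
    A 1 0 * (starRingEnd ℂ) (B 1 0)) (A 1 1 * (starRingEnd ℂ) (B 1 1))
  have h2 := norm_add_le (A 0 0 * (starRingEnd ℂ) (B 0 0) + A 0 1 * (starRingEnd ℂ) (B 0 1))
    (A 1 0 * (starRingEnd ℂ) (B 1 0))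
  have h3 := norm_add_le (A 0 0 * (starRingEnd ℂ) (B 0 0)) (A 0 1 * (starRingEnd ℂ) (B 0 1))
  simp only [norm_mul, RCLike.norm_conj] at h1 h2 h3
  have h4 : ‖pair A B‖ ≤ ‖A 0 0‖ * ‖B 0 0‖ + ‖A 0 1‖ * ‖B 0 1‖ + ‖A 1 0‖ * ‖B 1 0‖ +
      ‖A 1 1‖ * ‖B 1 1‖ := by
    rw [pair]
    linarith
  simp only [frobSq, Complex.normSq_eq_norm_sq]
  refine (pow_le_pow_left₀ (norm_nonneg _) h4 2).trans ?_
  nlinarith [sq_nonneg (‖A 0 0‖ * ‖B 0 1‖ - ‖A 0 1‖ * ‖B 0 0‖),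
    sq_nonneg (‖A 0 0‖ * ‖B 1 0‖ - ‖A 1 0‖ * ‖B 0 0‖),
    sq_nonneg (‖A 0 0‖ * ‖B 1 1‖ - ‖A 1 1‖ * ‖B 0 0‖),
    sq_nonneg (‖A 0 1‖ * ‖B 1 0‖ - ‖A 1 0‖ * ‖B 0 1‖),
    sq_nonneg (‖A 0 1‖ * ‖B 1 1‖ - ‖A 1 1‖ * ‖B 0 1‖),
    sq_nonneg (‖A 1 0‖ * ‖B 1 1‖ - ‖A 1 1‖ * ‖B 1 0‖)]

/-- The sharp Cauchy–Schwarz inequality between `u` and a tangent vector at `u`. -/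
theorem tau_mul_normSq_pair_le {u : SL2} {X : M2} (hX : X ∈ tangentSpace u) :
    tau u * Complex.normSq (pair X u) ≤ 2 * (tau u ^ 2 - 1) * frobSq X := by
  -- The conjugate transpose of u⁻¹: tangency at u means orthogonality to n, so only the part of u
  -- orthogonal to n pairs with X.
  set n : M2 := !![(starRingEnd ℂ) (u 1 1), -(starRingEnd ℂ) (u 1 0);
    -(starRingEnd ℂ) (u 0 1), (starRingEnd ℂ) (u 0 0)] with hn
  have hdet := SL2.det_eq u
  have hXn : pair X n = 0 := by
    have h := (mem_tangentSpace_iff u X).1 hX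
    simp [pair, hn]
    linear_combination h
  -- Since ⟨u, n⟩ = 2 and ‖n‖² = 2τ, this is τ times the component of u orthogonal to n.
  -- Cauchy–Schwarz against W is sharper than against u.
  set W : M2 := (tau u : ℂ) • (u : M2) + (-1 : ℂ) • n with hW
  have h1 : pair X W = tau u * pair X u := by
    rw [hW, pair_add_right, pair_smul_right, pair_smul_right, hXn, Complex.conj_ofReal]
    ring
  have hun : pair u n = 2 := by
    simp [pair, hn]
    linear_combination 2 * hdet
  have hnu : pair n u = 2 := by
    rw [← pair_conj, hun, map_ofNat]
  have hnn : pair n n = pair u u := by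
    simp [pair, hn]
    ring
  have huu : pair u u = ((2 * tau u : ℝ) : ℂ) := by
    rw [pair_self, tau_eq_frobSq]
    congr 1
    ring
  have h2 : frobSq W = 2 * tau u * (tau u ^ 2 - 1) := by
    have h : (frobSq W : ℂ) = ((2 * tau u * (tau u ^ 2 - 1) : ℝ) : ℂ) := by
      rw [← pair_self, hW]
      simp only [pair_add_left, pair_add_right, pair_smul_left, pair_smul_right, hun, hnu, hnn,
        huu, Complex.conj_ofReal, map_neg, map_one]
      push_cast
      ring
    exact Complex.ofReal_injective h
  have h3 := normSq_pair_le X W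
  rw [h1, h2, Complex.normSq_mul, Complex.normSq_ofReal] at h3
  have ht : 0 < tau u := by linarith [one_le_tau u]
  refine le_of_mul_le_mul_left ?_ ht
  linarith

/-! ### The metric with potential `K` -/

/-- The underlying form of the metric with Kähler potential `radialPotential ∘ tau`. -/
def stenzelForm (u : SL2) (A B : M2) : ℝ :=
  profile (tau u) * (pair A B).re +
    deriv profile (tau u) / 2 * (pair A u * (starRingEnd ℂ) (pair B u)).re

theorem neg_one_lt_tau (u : SL2) : -1 < tau u := by linarith [one_le_tau u]

theorem stenzelForm_self (u : SL2) (A : M2) :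
    stenzelForm u A A =
      profile (tau u) * frobSq A + deriv profile (tau u) / 2 * Complex.normSq (pair A u) := by
  rw [stenzelForm, pair_self, Complex.mul_conj, Complex.ofReal_re, Complex.ofReal_re]

theorem stenzelForm_symm (u : SL2) (A B : M2) : stenzelForm u A B = stenzelForm u B A := by
  rw [stenzelForm, stenzelForm, ← pair_conj A B, Complex.conj_re,
    ← Complex.conj_re (pair A u * _), map_mul, Complex.conj_conj, mul_comm (pair B u)]

/-- The lower bound of the metric by the Frobenius norm. -/
theorem stenzelForm_self_ge {u : SL2} {X : M2} (hX : X ∈ tangentSpace u) :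
    min (profile (tau u)) (tau u)⁻¹ * frobSq X ≤ stenzelForm u X X := by
  have h1 := one_le_tau u
  have hP := one_le_profile_equation h1
  have hcs := tau_mul_normSq_pair_le hX
  have hN := frobSq_nonneg X
  have hQ := Complex.normSq_nonneg (pair X u)
  rw [stenzelForm_self]
  have ht : 0 < tau u := by linarith
  -- If the derivative m' of the profile m is nonnegative, its term can be dropped. Otherwise the
  -- sharp Cauchy–Schwarz inequality bounds that term below by m' (τ² − 1)/τ · ‖X‖², and (τ² − 1) m'
  -- + τ m ≥ 1 finishes.
  rcases le_total 0 (deriv profile (tau u)) with hd | hd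
  · have := mul_le_mul_of_nonneg_right (min_le_left (profile (tau u)) (tau u)⁻¹) hN
    have h3 : 0 ≤ deriv profile (tau u) / 2 * Complex.normSq (pair X u) := by positivity
    linarith
  · refine (mul_le_mul_of_nonneg_right (min_le_right _ _) hN).trans ?_
    rw [inv_mul_le_iff₀ ht]
    have h2 := mul_le_mul_of_nonpos_left hcs hd
    nlinarith

/-- The lower bound of the metric in the radial direction. -/
theorem normSq_pair_le_stenzelForm {u : SL2} {X : M2} (hX : X ∈ tangentSpace u) :
    Complex.normSq (pair X u) ≤ 2 * (tau u + 1) ^ 2 * stenzelForm u X X := by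
  have h1 := one_le_tau u
  have hP := one_le_profile_equation h1
  have hcs := tau_mul_normSq_pair_le hX
  have hQ := Complex.normSq_nonneg (pair X u)
  have hm := profile_pos (neg_one_lt_tau u)
  have hnn : 0 ≤ stenzelForm u X X := by
    refine le_trans (mul_nonneg (le_min hm.le ?_) (frobSq_nonneg X)) (stenzelForm_self_ge hX)
    exact inv_nonneg.2 (by linarith)
  -- Cauchy–Schwarz is applied to the first term of the form, so that 2 (τ² − 1) times the form is
  -- at least ((τ² − 1) m' + τ m) |⟨X, u⟩|². The weaker factor (τ + 1)² suits the logarithm of τ +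
  -- 1.
  have h2 : Complex.normSq (pair X u) ≤ 2 * (tau u ^ 2 - 1) * stenzelForm u X X := by
    rw [stenzelForm_self]
    have h3 := mul_le_mul_of_nonneg_left hcs hm.le
    nlinarith
  nlinarith

/-- The Ricci-flat metric with Kähler potential `radialPotential ∘ tau`, at a point. -/
def stenzelInner (u : SL2) : tangentSpace u →ₗ[ℝ] tangentSpace u →ₗ[ℝ] ℝ :=
  LinearMap.mk₂ ℝ (fun X Y => stenzelForm u X Y)
    (fun X X' Y => by
      simp only [stenzelForm, Submodule.coe_add, pair_add_left, add_mul, Complex.add_re]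
      ring)
    (fun c X Y => by
      have h : ((c • X : tangentSpace u) : M2) = (c : ℂ) • (X : M2) := rfl
      simp only [stenzelForm, h, pair_smul_left, mul_assoc, Complex.re_ofReal_mul, smul_eq_mul]
      ring)
    (fun X Y Y' => by
      simp only [stenzelForm, Submodule.coe_add, pair_add_right, pair_add_left, map_add, mul_add,
        Complex.add_re]
      ring)
    (fun c X Y => by
      have h : ((c • Y : tangentSpace u) : M2) = (c : ℂ) • (Y : M2) := rfl
      simp only [stenzelForm, h, pair_smul_left, pair_smul_right, map_mul, Complex.conj_ofReal,
        mul_left_comm (pair (X : M2) u), Complex.re_ofReal_mul, smul_eq_mul]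
      ring)

/-! ### Calculus in a holomorphic parametrization -/

/-- The differential of a parametrization, as a matrix. -/
def Param.jac (φ : Param) (z v : C3) : M2 :=
  Matrix.of (fderiv ℂ (fun x => entries (φ.toFun x)) z v)

theorem Param.coe_push (φ : Param) (z v : C3) : (φ.push z v : M2) = φ.jac z v := rfl

theorem Param.jac_smul (φ : Param) (z : C3) (c : ℂ) (v : C3) :
    φ.jac z (c • v) = c • φ.jac z v := by
  simp [Param.jac]

theorem Param.push_smul (φ : Param) (z : C3) (c : ℂ) (v : C3) :
    φ.push z (c • v) = c • φ.push z v :=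
  Subtype.ext (φ.jac_smul z c v)

/-- The second differential of a parametrization, as a matrix. -/
def Param.jac₂ (φ : Param) (z v w : C3) : M2 :=
  Matrix.of (fderiv ℂ (fun x => fderiv ℂ (fun x => entries (φ.toFun x)) x v) z w)

theorem Param.jac₂_smul (φ : Param) {z : C3} (hz : z ∈ φ.U) (c : ℂ) (v w : C3) :
    φ.jac₂ z (c • v) (c • w) = (c * c) • φ.jac₂ z v w := by
  have h : (fun x => fderiv ℂ (fun x => entries (φ.toFun x)) x (c • v)) =
      fun x => c • fderiv ℂ (fun x => entries (φ.toFun x)) x v := by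
    ext1 x
    simp
  obtain ⟨L, hL⟩ := (differentiableOn_fderiv_apply φ.isOpen φ.holomorphic v).differentiableAt
    (φ.isOpen.mem_nhds hz)
  have h3 : HasFDerivAt (fun x => fderiv ℂ (fun x => entries (φ.toFun x)) x (c • v))
      (c • L) z := by
    rw [h]
    exact hL.const_smul c
  simp only [Param.jac₂, h3.fderiv, hL.fderiv]
  ext i j
  simp [mul_assoc]

theorem Param.contDiffOn_entry (φ : Param) (i j : Fin 2) :
    ContDiffOn ℝ ∞ (fun z => (φ.toFun z : M2) i j) φ.U := by
  have h := (contDiffOn_of_differentiableOn φ.isOpen φ.holomorphic).restrict_scalars ℝ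
  exact contDiffOn_pi.1 (contDiffOn_pi.1 h i) j

theorem Param.contDiffOn_jac (φ : Param) (v : C3) (i j : Fin 2) :
    ContDiffOn ℝ ∞ (fun z => φ.jac z v i j) φ.U := by
  have h := (contDiffOn_of_differentiableOn φ.isOpen
    (differentiableOn_fderiv_apply φ.isOpen φ.holomorphic v)).restrict_scalars ℝ
  exact contDiffOn_pi.1 (contDiffOn_pi.1 h i) j

theorem contDiffOn_conj {f : C3 → ℂ} {U : Set C3} (hf : ContDiffOn ℝ ∞ f U) :
    ContDiffOn ℝ ∞ (fun z => (starRingEnd ℂ) (f z)) U :=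
  (Complex.conjCLE : ℂ →L[ℝ] ℂ).contDiff.comp_contDiffOn hf

theorem contDiffOn_re {f : C3 → ℂ} {U : Set C3} (hf : ContDiffOn ℝ ∞ f U) :
    ContDiffOn ℝ ∞ (fun z => (f z).re) U :=
  Complex.reCLM.contDiff.comp_contDiffOn hf

theorem contDiffOn_pair {A B : C3 → M2} {U : Set C3}
    (hA : ∀ i j, ContDiffOn ℝ ∞ (fun z => A z i j) U)
    (hB : ∀ i j, ContDiffOn ℝ ∞ (fun z => B z i j) U) :
    ContDiffOn ℝ ∞ (fun z => pair (A z) (B z)) U :=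
  ((((hA 0 0).mul (contDiffOn_conj (hB 0 0))).add ((hA 0 1).mul (contDiffOn_conj (hB 0 1)))).add
    ((hA 1 0).mul (contDiffOn_conj (hB 1 0)))).add ((hA 1 1).mul (contDiffOn_conj (hB 1 1)))

theorem tau_eq_pair (u : SL2) : tau u = (pair u u).re / 2 := by
  rw [pair_self, Complex.ofReal_re, tau_eq_frobSq]

theorem Param.contDiffOn_tau (φ : Param) : ContDiffOn ℝ ∞ (fun z => tau (φ.toFun z)) φ.U := by
  simp only [tau_eq_pair]
  exact (contDiffOn_re (contDiffOn_pair φ.contDiffOn_entry φ.contDiffOn_entry)).div_const 2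

/-- The Ricci-flat Kähler metric with potential `radialPotential ∘ tau`. -/
def stenzel : RiemMetric where
  inner := stenzelInner
  symm u X Y := stenzelForm_symm u X Y
  pos u X hX := by
    have h1 : (X : M2) ≠ 0 := fun h => hX (Subtype.ext h)
    refine lt_of_lt_of_le (mul_pos (lt_min (profile_pos (neg_one_lt_tau u)) ?_) (frobSq_pos h1))
      (stenzelForm_self_ge X.2)
    exact inv_pos.2 (by linarith [one_le_tau u])
  smooth φ v w := by
    have hm : ContDiffOn ℝ ∞ (fun z => profile (tau (φ.toFun z))) φ.U :=
      contDiffOn_profile.comp φ.contDiffOn_tau fun z _ => neg_one_lt_tau _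
    have hm' : ContDiffOn ℝ ∞ (fun z => deriv profile (tau (φ.toFun z))) φ.U :=
      contDiffOn_deriv_profile.comp φ.contDiffOn_tau fun z _ => neg_one_lt_tau _
    have h1 := contDiffOn_re (contDiffOn_pair (φ.contDiffOn_jac v) (φ.contDiffOn_jac w))
    have h2 := contDiffOn_re ((contDiffOn_pair (φ.contDiffOn_jac v) φ.contDiffOn_entry).mul
      (contDiffOn_conj (contDiffOn_pair (φ.contDiffOn_jac w) φ.contDiffOn_entry)))
    exact (hm.mul h1).add ((hm'.div_const 2).mul h2)

theorem stenzel_inner (u : SL2) (X Y : tangentSpace u) :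
    stenzel.inner u X Y = stenzelForm u X Y := rfl

/-! ### Derivatives of `tau` and of the potential along real lines -/

theorem hasDerivAt_conj {f : ℝ → ℂ} {f' : ℂ} {s : ℝ} (h : HasDerivAt f f' s) :
    HasDerivAt (fun s => (starRingEnd ℂ) (f s)) ((starRingEnd ℂ) f') s :=
  (Complex.conjCLE : ℂ →L[ℝ] ℂ).hasFDerivAt.comp_hasDerivAt s h

theorem hasDerivAt_re {f : ℝ → ℂ} {f' : ℂ} {s : ℝ} (h : HasDerivAt f f' s) :
    HasDerivAt (fun s => (f s).re) f'.re s :=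
  Complex.reCLM.hasFDerivAt.comp_hasDerivAt s h

theorem hasDerivAt_pair {A B : ℝ → M2} {A' B' : M2} {s : ℝ}
    (hA : ∀ i j, HasDerivAt (fun s => A s i j) (A' i j) s)
    (hB : ∀ i j, HasDerivAt (fun s => B s i j) (B' i j) s) :
    HasDerivAt (fun s => pair (A s) (B s)) (pair A' (B s) + pair (A s) B') s := by
  convert! (((((hA 0 0).mul (hasDerivAt_conj (hB 0 0))).add
    ((hA 0 1).mul (hasDerivAt_conj (hB 0 1)))).add
    ((hA 1 0).mul (hasDerivAt_conj (hB 1 0)))).add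
    ((hA 1 1).mul (hasDerivAt_conj (hB 1 1)))) using 1
  simp only [pair]
  ring

theorem hasDerivAt_tau {γ : ℝ → SL2} {A : M2} {s : ℝ}
    (h : ∀ i j, HasDerivAt (fun s => (γ s : M2) i j) (A i j) s) :
    HasDerivAt (fun s => tau (γ s)) (pair A (γ s)).re s := by
  simp only [tau_eq_pair]
  convert! (hasDerivAt_re (hasDerivAt_pair h h)).div_const 2 using 1
  rw [Complex.add_re, ← pair_conj A, Complex.conj_re]
  ring

theorem Param.hasDerivAt_line (φ : Param) {z : C3} (hz : z ∈ φ.U) (w : C3) (i j : Fin 2) :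
    HasDerivAt (fun s : ℝ => (φ.toFun (z + s • w) : M2) i j) (φ.jac z w i j) 0 := by
  have h1 : HasDerivAt (fun s : ℝ => z + s • w) w 0 := by
    simpa using ((hasDerivAt_id (0 : ℝ)).smul_const w).const_add z
  have h2 : HasFDerivAt (fun x => entries (φ.toFun x))
      ((fderiv ℂ (fun x => entries (φ.toFun x)) z).restrictScalars ℝ) (z + (0 : ℝ) • w) := by
    rw [zero_smul, add_zero]
    exact ((φ.holomorphic.differentiableAt (φ.isOpen.mem_nhds hz)).hasFDerivAt).restrictScalars ℝ
  exact hasDerivAt_pi.1 (hasDerivAt_pi.1 (h2.comp_hasDerivAt 0 h1) i) j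

theorem Param.hasDerivAt_jac_line (φ : Param) {z : C3} (hz : z ∈ φ.U) (v w : C3) (i j : Fin 2) :
    HasDerivAt (fun s : ℝ => φ.jac (z + s • w) v i j) (φ.jac₂ z v w i j) 0 := by
  have h1 : HasDerivAt (fun s : ℝ => z + s • w) w 0 := by
    simpa using ((hasDerivAt_id (0 : ℝ)).smul_const w).const_add z
  have h2 : HasFDerivAt (fun x => fderiv ℂ (fun x => entries (φ.toFun x)) x v)
      ((fderiv ℂ (fun x => fderiv ℂ (fun x => entries (φ.toFun x)) x v) z).restrictScalars ℝ)
      (z + (0 : ℝ) • w) := by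
    rw [zero_smul, add_zero]
    exact (((differentiableOn_fderiv_apply φ.isOpen φ.holomorphic v).differentiableAt
      (φ.isOpen.mem_nhds hz)).hasFDerivAt).restrictScalars ℝ
  exact hasDerivAt_pi.1 (hasDerivAt_pi.1 (h2.comp_hasDerivAt 0 h1) i) j

/-- The potential of the Ricci-flat metric. -/
def potential (u : SL2) : ℝ := radialPotential (tau u)

theorem Param.contDiffOn_potential (φ : Param) :
    ContDiffOn ℝ ∞ (fun z => potential (φ.toFun z)) φ.U :=
  contDiffOn_radialPotential.comp φ.contDiffOn_tau fun _ _ => neg_one_lt_tau _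

theorem fderiv_eq_of_hasDerivAt_line {F : C3 → ℝ} {z w : C3} {c : ℝ}
    (hF : DifferentiableAt ℝ F z) (h : HasDerivAt (fun s : ℝ => F (z + s • w)) c 0) :
    fderiv ℝ F z w = c := by
  have h1 : HasDerivAt (fun s : ℝ => z + s • w) w 0 := by
    simpa using ((hasDerivAt_id (0 : ℝ)).smul_const w).const_add z
  have h2 : HasFDerivAt F (fderiv ℝ F z) (z + (0 : ℝ) • w) := by
    rw [zero_smul, add_zero]
    exact hF.hasFDerivAt
  exact (h2.comp_hasDerivAt 0 h1).unique h

theorem Param.fderiv_potential (φ : Param) {z : C3} (hz : z ∈ φ.U) (v : C3) :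
    fderiv ℝ (fun x => potential (φ.toFun x)) z v =
      profile (tau (φ.toFun z)) * (pair (φ.jac z v) (φ.toFun z)).re := by
  refine fderiv_eq_of_hasDerivAt_line
    ((φ.contDiffOn_potential.contDiffAt (φ.isOpen.mem_nhds hz)).differentiableAt (by simp)) ?_
  have h1 := hasDerivAt_tau (φ.hasDerivAt_line hz v)
  convert! (hasDerivAt_radialPotential (neg_one_lt_tau (φ.toFun (z + (0 : ℝ) • v)))).comp 0 h1
    using 1
  simp

theorem Param.realHessian_potential (φ : Param) {z : C3} (hz : z ∈ φ.U) (w v : C3) :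
    realHessian (fun x => potential (φ.toFun x)) z w v =
      deriv profile (tau (φ.toFun z)) * (pair (φ.jac z w) (φ.toFun z)).re *
          (pair (φ.jac z v) (φ.toFun z)).re +
        profile (tau (φ.toFun z)) *
          (pair (φ.jac₂ z v w) (φ.toFun z) + pair (φ.jac z v) (φ.jac z w)).re := by
  have hF := φ.contDiffOn_potential.contDiffAt (φ.isOpen.mem_nhds hz)
  rw [← fderiv_fderiv_apply hF]
  have hd : DifferentiableAt ℝ (fun x => fderiv ℝ (fun x => potential (φ.toFun x)) x v) z :=
    (differentiableAt_fderiv hF).clm_apply (differentiableAt_const v)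
  refine fderiv_eq_of_hasDerivAt_line hd ?_
  have hev : (fun s : ℝ => fderiv ℝ (fun x => potential (φ.toFun x)) (z + s • w) v) =ᶠ[𝓝 0]
      fun s => profile (tau (φ.toFun (z + s • w))) *
        (pair (φ.jac (z + s • w) v) (φ.toFun (z + s • w))).re := by
    have hcont : ContinuousAt (fun s : ℝ => z + s • w) 0 := by fun_prop
    have : ∀ᶠ s : ℝ in 𝓝 0, z + s • w ∈ φ.U :=
      hcont.eventually (by simpa using φ.isOpen.mem_nhds hz)
    filter_upwards [this] with s hs using φ.fderiv_potential hs v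
  refine HasDerivAt.congr_of_eventuallyEq ?_ hev
  have h1 := hasDerivAt_tau (φ.hasDerivAt_line hz w)
  have h2 := (hasDerivAt_profile (neg_one_lt_tau (φ.toFun (z + (0 : ℝ) • w)))).comp 0 h1
  have h3 := hasDerivAt_re (hasDerivAt_pair (φ.hasDerivAt_jac_line hz v w)
    (φ.hasDerivAt_line hz w))
  convert! h2.mul h3 using 1
  simp

/-- Averaging the real Hessian over (v, w) and (iv, iw) removes the second differential of the
parametrization: it is complex bilinear, so it changes sign. What remains is the Levi form of the
potential. -/
theorem Param.stenzelForm_jac (φ : Param) {z : C3} (hz : z ∈ φ.U) (v w : C3) :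
    stenzelForm (φ.toFun z) (φ.jac z v) (φ.jac z w) =
      (realHessian (fun x => potential (φ.toFun x)) z v w +
        realHessian (fun x => potential (φ.toFun x)) z (Complex.I • v) (Complex.I • w)) / 2 := by
  rw [φ.realHessian_potential hz, φ.realHessian_potential hz, φ.jac₂_smul hz, φ.jac_smul,
    φ.jac_smul]
  simp only [pair_smul_left, pair_smul_right, stenzelForm, ← pair_conj (φ.jac z v) (φ.jac z w)]
  simp
  ring

/-! ### The potential, closedness and invariance of the metric -/

theorem stenzel_isHermitian : stenzel.IsHermitian := by
  intro u X Y
  simp only [stenzel_inner, Submodule.coe_smul, stenzelForm, pair_smul_left, pair_smul_right]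
  simp

theorem stenzel_hasPotential : stenzel.HasPotential potential := by
  intro φ
  refine ⟨φ.contDiffOn_potential, fun z hz a b => ?_⟩
  have hF := φ.contDiffOn_potential.contDiffAt (φ.isOpen.mem_nhds hz)
  rw [complexHessian_eq hF, RiemMetric.hermMatrix, Matrix.of_apply, stenzel_inner, stenzel_inner]
  simp only [Param.coe_push]
  rw [φ.stenzelForm_jac hz, φ.stenzelForm_jac hz, single_I, single_I, smul_smul, Complex.I_mul_I]
  simp only [realHessian, neg_smul, one_smul, map_neg]
  push_cast
  ring

theorem stenzel_isKahler : stenzel.IsKahler where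
  hermitian := stenzel_isHermitian
  closed φ z hz v₁ v₂ v₃ := by
    have h := realHessian_closed φ.isOpen φ.contDiffOn_potential hz v₁ v₂ v₃
    have hev : ∀ v w, stenzel.omegaCoord φ v w =ᶠ[𝓝 z] fun x =>
        (realHessian (fun x => potential (φ.toFun x)) x (Complex.I • v) w -
          realHessian (fun x => potential (φ.toFun x)) x v (Complex.I • w)) / 2 := by
      intro v w
      filter_upwards [φ.isOpen.mem_nhds hz] with x hx
      rw [RiemMetric.omegaCoord, RiemMetric.omega, ← φ.push_smul, stenzel_inner, Param.coe_push,
        Param.coe_push, φ.stenzelForm_jac hx, smul_smul, Complex.I_mul_I]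
      simp only [realHessian, neg_smul, one_smul, map_neg, neg_apply]
      ring
    simp only [(hev _ _).fderiv_eq]
    exact h

theorem stenzel_isInvariant : stenzel.IsInvariant := by
  intro a ha b hb u X Y
  have h : ∀ X : tangentSpace u, (translate a b u X : M2) =
    (a : M2) * (X : M2) * ((b⁻¹ : SL2) : M2) := fun _ => rfl
  have hu : ((a * u * b⁻¹ : SL2) : M2) = (a : M2) * (u : M2) * ((b⁻¹ : SL2) : M2) := by
    rw [Matrix.SpecialLinearGroup.coe_mul, Matrix.SpecialLinearGroup.coe_mul]
  simp only [stenzel_inner, stenzelForm, h, tau_translate ha hb, hu, pair_translate ha hb]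

/-! ### Ricci-flatness from a constant Gram determinant -/

/-- The differential of a parametrization in the left-invariant frame. -/
def Param.frameJac (φ : Param) (z : C3) : Matrix (Fin 3) (Fin 3) ℂ :=
  Matrix.of fun a k =>
    frameCoord ((((φ.toFun z)⁻¹ : SL2) : M2) * φ.jac z (Pi.single a 1)) k

theorem Param.jac_mem (φ : Param) (z v : C3) : φ.jac z v ∈ tangentSpace (φ.toFun z) :=
  (φ.push z v).2

theorem RiemMetric.hermMatrix_eq (φ : Param) (z : C3) :
    g.hermMatrix φ z = Matrix.of fun a b =>
      g.herm (φ.toFun z) (φ.jac z (Pi.single a 1)) (φ.jac z (Pi.single b 1)) := by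
  ext a b
  simp only [RiemMetric.hermMatrix, Matrix.of_apply, RiemMetric.herm, g.inner_eq_form,
    Param.coe_push, single_I, φ.jac_smul]

/-- The first factor is the squared modulus of a nonvanishing holomorphic function on the coordinate
domain, so the Ricci form sees only the Gram determinant. -/
theorem RiemMetric.IsHermitian.det_hermMatrix (hg : g.IsHermitian) (φ : Param) (z : C3) :
    (g.hermMatrix φ z).det =
      (Complex.normSq (φ.frameJac z).det : ℂ) * (g.gram (φ.toFun z)).det := by
  have h := hg.det_herm (φ.toFun z)
    (fun a => (((φ.toFun z)⁻¹ : SL2) : M2) * φ.jac z (Pi.single a 1))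
    (fun a => mem_tangentSpace.1 (φ.jac_mem z _))
  simp only [← Matrix.mul_assoc, SL2.mul_inv_self, Matrix.one_mul] at h
  rw [g.hermMatrix_eq]
  exact h

/-- A row vector annihilated by this matrix is a coordinate direction with zero differential, which
an immersion excludes. -/
theorem Param.frameJac_det_ne_zero (φ : Param) {z : C3} (hz : z ∈ φ.U) :
    (φ.frameJac z).det ≠ 0 := by
  intro h0
  obtain ⟨c, hc, h⟩ := Matrix.exists_vecMul_eq_zero_iff.2 h0
  set X := φ.jac z c with hX
  have hXsum : X = ∑ a, c a • φ.jac z (Pi.single a 1) := by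
    have : c = ∑ a, c a • (Pi.single a 1 : C3) := by
      ext i
      simp [Finset.sum_apply, Pi.single_apply]
    conv_lhs => rw [hX, this]
    simp only [Param.jac, map_sum, map_smul]
    ext i j
    simp [Finset.sum_apply, Matrix.sum_apply]
  have hzero : frameCoord ((((φ.toFun z)⁻¹ : SL2) : M2) * X) = 0 := by
    rw [← h]
    ext k
    rw [hXsum, Finset.mul_sum, Matrix.vecMul, dotProduct]
    simp only [Param.frameJac, Matrix.of_apply, Fin.sum_univ_three, Matrix.mul_smul]
    fin_cases k <;> simp [frameCoord]
  have h1 : (((φ.toFun z)⁻¹ : SL2) : M2) * X = 0 := by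
    rw [eq_sum_frame (mem_tangentSpace.1 (φ.jac_mem z c)), hzero]
    simp
  have h2 : X = 0 := by
    calc X = (φ.toFun z : M2) * ((((φ.toFun z)⁻¹ : SL2) : M2) * X) := by
          rw [← Matrix.mul_assoc, SL2.mul_inv_self, Matrix.one_mul]
      _ = 0 := by rw [h1, Matrix.mul_zero]
  apply hc
  apply φ.immersion z hz
  rw [map_zero]
  exact Matrix.of.injective h2

theorem Param.differentiableOn_entry (φ : Param) (i j : Fin 2) :
    DifferentiableOn ℂ (fun z => (φ.toFun z : M2) i j) φ.U :=
  differentiableOn_pi.1 (differentiableOn_pi.1 φ.holomorphic i) j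

theorem Param.differentiableOn_jac (φ : Param) (v : C3) (i j : Fin 2) :
    DifferentiableOn ℂ (fun z => φ.jac z v i j) φ.U :=
  differentiableOn_pi.1 (differentiableOn_pi.1
    (differentiableOn_fderiv_apply φ.isOpen φ.holomorphic v) i) j

theorem Param.differentiableOn_frameJac_det (φ : Param) :
    DifferentiableOn ℂ (fun z => (φ.frameJac z).det) φ.U := by
  have hu := φ.differentiableOn_entry
  have hinv : ∀ i j, DifferentiableOn ℂ (fun z => (((φ.toFun z)⁻¹ : SL2) : M2) i j) φ.U := by
    intro i j
    simp only [Matrix.SpecialLinearGroup.coe_inv, Matrix.adjugate_fin_two]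
    fin_cases i <;> fin_cases j <;> simp
    · exact hu 1 1
    · exact hu 0 1
    · exact hu 1 0
    · exact hu 0 0
  have hmul : ∀ a i j, DifferentiableOn ℂ
      (fun z => ((((φ.toFun z)⁻¹ : SL2) : M2) * φ.jac z (Pi.single a 1)) i j) φ.U := by
    intro a i j
    simp only [Matrix.mul_apply, Fin.sum_univ_two]
    exact ((hinv i 0).mul (φ.differentiableOn_jac _ 0 j)).add
      ((hinv i 1).mul (φ.differentiableOn_jac _ 1 j))
  have hC : ∀ a k, DifferentiableOn ℂ (fun z => φ.frameJac z a k) φ.U := by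
    intro a k
    simp only [Param.frameJac, Matrix.of_apply]
    fin_cases k
    · exact hmul a 0 0
    · exact hmul a 0 1
    · exact hmul a 1 0
  simp only [Matrix.det_fin_three]
  have := hC
  fun_prop

theorem RiemMetric.isRicciFlat_of_gramDet (hg : g.IsHermitian) {κ : ℝ} (hκ : κ ≠ 0)
    (h : ∀ u, (g.gram u).det = (κ : ℂ)) : g.IsRicciFlat := by
  intro φ z hz a b
  have h1 : (fun x => Real.log (g.hermMatrix φ x).det.re) =
      fun x => Real.log (κ * Complex.normSq (φ.frameJac x).det) := by
    ext1 x
    rw [hg.det_hermMatrix, h, ← Complex.ofReal_mul, Complex.ofReal_re, mul_comm]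
  rw [h1]
  exact complexHessian_log_normSq φ.isOpen φ.differentiableOn_frameJac_det
    (fun x hx => φ.frameJac_det_ne_zero hx) hκ hz a b

/-! ### The Gram determinant of the metric with potential `K` -/

theorem stenzel_form {u : SL2} {A B : M2} (hA : A ∈ tangentSpace u) (hB : B ∈ tangentSpace u) :
    stenzel.form u A B = stenzelForm u A B := by
  rw [RiemMetric.form_apply, stenzel_inner, coe_tangentProj_of_mem hA, coe_tangentProj_of_mem hB]

theorem stenzel_coeffQ (t : ℝ) : stenzel.coeffQ t = profile (Real.cosh t) := by
  rw [RiemMetric.coeffQ, stenzel_form (upperVec_mem t) (upperVec_mem t), stenzelForm_self,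
    tau_diagSL]
  simp [frobSq, pair, upperVec, diagSL]

theorem stenzel_coeffR (t : ℝ) : stenzel.coeffR t = profile (Real.cosh t) := by
  rw [RiemMetric.coeffR, stenzel_form (lowerVec_mem t) (lowerVec_mem t), stenzelForm_self,
    tau_diagSL]
  simp [frobSq, pair, lowerVec, diagSL]

/-- The right side is twice the second t-derivative of `radialPotential (cosh t)`, whose first
derivative is `profile (cosh t) * sinh t`. -/
theorem stenzel_coeffP (t : ℝ) : stenzel.coeffP t * Real.exp t =
    2 * (profile (Real.cosh t) * Real.cosh t +
      deriv profile (Real.cosh t) * (Real.cosh t ^ 2 - 1)) := by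
  rw [RiemMetric.coeffP, stenzel_form (radialVec_mem t) (radialVec_mem t), stenzelForm_self,
    tau_diagSL]
  have h1 : frobSq (radialVec t) = 1 + Real.exp (-t) * Real.exp (-t) := by
    simp [frobSq, radialVec, -Complex.ofReal_exp, Complex.normSq_ofReal]
  have h2 : pair (radialVec t) (diagSL t) =
      ((Real.exp (t / 2) - Real.exp (-t) * Real.exp (-(t / 2)) : ℝ) : ℂ) := by
    simp [pair, radialVec, diagSL, -Complex.ofReal_exp, Complex.conj_ofReal]
    ring
  rw [h1, h2, Complex.normSq_ofReal, Real.cosh_eq]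
  have e1 : Real.exp (-t) = Real.exp (-(t / 2)) ^ 2 := by
    rw [← Real.exp_nat_mul]
    push_cast
    ring_nf
  have e2 : Real.exp t = Real.exp (t / 2) ^ 2 := by
    rw [← Real.exp_nat_mul]
    push_cast
    ring_nf
  have e3 : Real.exp (t / 2) * Real.exp (-(t / 2)) = 1 := by rw [← Real.exp_add]; simp
  rw [e1, e2]
  generalize Real.exp (t / 2) = x at *
  generalize Real.exp (-(t / 2)) = y at *
  generalize deriv profile _ = d
  generalize profile _ = m
  linear_combination (m * y ^ 2 * (x * y + 1) + d * (y ^ 4 * (x * y + 1) / 2 -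
    (x ^ 2 * y ^ 2 + x * y + 1) - (x * y + 1))) * e3

/-- Along the diagonal the Gram determinant is a quarter of the left side of `profile_equation`;
invariance carries the value to every orbit. -/
theorem stenzel_gramDet (u : SL2) : (stenzel.gram u).det = ((1 / 3 : ℝ) : ℂ) := by
  obtain ⟨k, hk, l, hl, t, -, rfl⟩ := exists_kak u
  rw [stenzel.gramDet_translate stenzel_isHermitian stenzel_isInvariant hk hl,
    stenzel.gramDet_diagSL stenzel_isHermitian stenzel_isInvariant, stenzel_coeffP, stenzel_coeffQ,
    stenzel_coeffR]
  congr 1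
  have h := profile_equation (show -1 < Real.cosh t by linarith [Real.cosh_pos t])
  linear_combination h / 4

theorem stenzel_isRicciFlat : stenzel.IsRicciFlat :=
  stenzel.isRicciFlat_of_gramDet stenzel_isHermitian (by norm_num) stenzel_gramDet

/-! ### Completeness -/

theorem hasDerivAt_velocity {γ : ℝ → SL2} (hγ : ContDiff ℝ 1 (fun t => entries (γ t))) (t : ℝ)
    (i j : Fin 2) : HasDerivAt (fun s => (γ s : M2) i j) ((velocity γ t : M2) i j) t := by
  have h := (hγ.differentiable (by simp) t).hasDerivAt
  exact hasDerivAt_pi.1 (hasDerivAt_pi.1 h i) j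

theorem norm_sq_le_frobSq (A : M2) (i j : Fin 2) : ‖A i j‖ ^ 2 ≤ frobSq A := by
  have := fun z : ℂ => sq_nonneg ‖z‖
  simp only [frobSq, Complex.normSq_eq_norm_sq]
  fin_cases i <;> fin_cases j <;> simp <;>
    linarith [this (A 0 0), this (A 0 1), this (A 1 0), this (A 1 1)]

theorem norm_le_sqrt_frobSq (A : Fin 2 → Fin 2 → ℂ) : ‖A‖ ≤ Real.sqrt (frobSq (Matrix.of A)) := by
  rw [pi_norm_le_iff_of_nonneg (Real.sqrt_nonneg _)]
  intro i
  rw [pi_norm_le_iff_of_nonneg (Real.sqrt_nonneg _)]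
  intro j
  exact Real.le_sqrt_of_sq_le (norm_sq_le_frobSq (Matrix.of A) i j)

/-- The speed of a curve for the Ricci-flat metric. -/
def speed (γ : ℝ → SL2) (t : ℝ) : ℝ :=
  Real.sqrt (stenzelForm (γ t) (velocity γ t) (velocity γ t))

theorem stenzel_length (γ : ℝ → SL2) :
    stenzel.length γ = ∫⁻ t in Set.Icc (0 : ℝ) 1, ENNReal.ofReal (speed γ t) := rfl

/-- A map with differential bounded by `C` is `C`-Lipschitz with respect to length. -/
theorem enorm_sub_le_length {E : Type*} [NormedAddCommGroup E] [NormedSpace ℝ E] {γ : ℝ → SL2}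
    {f : ℝ → E} (hf : ContDiff ℝ 1 f) {C : ℝ} (hC : 0 ≤ C)
    (h : ∀ t ∈ Set.Icc (0 : ℝ) 1, ‖deriv f t‖ ≤ C * speed γ t) {s : ℝ}
    (hs : s ∈ Set.Icc (0 : ℝ) 1) :
    ‖f s - f 0‖ₑ ≤ ENNReal.ofReal C * stenzel.length γ := by
  have hsub : Set.Icc 0 s ⊆ Set.Icc (0 : ℝ) 1 := Set.Icc_subset_Icc_right hs.2
  calc ‖f s - f 0‖ₑ ≤ ∫⁻ t in Set.Icc 0 s, ‖deriv f t‖ₑ :=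
        enorm_sub_le_lintegral_deriv_of_contDiffOn_Icc hf.contDiffOn hs.1
    _ ≤ ∫⁻ t in Set.Icc 0 s, ENNReal.ofReal C * ENNReal.ofReal (speed γ t) := by
        refine MeasureTheory.setLIntegral_mono_ae' measurableSet_Icc
          (Filter.Eventually.of_forall fun t ht => ?_)
        rw [← ENNReal.ofReal_mul hC, ← ofReal_norm]
        exact ENNReal.ofReal_le_ofReal (h t (hsub ht))
    _ ≤ ∫⁻ t in Set.Icc 0 1, ENNReal.ofReal C * ENNReal.ofReal (speed γ t) :=
        MeasureTheory.lintegral_mono_set hsub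
    _ = ENNReal.ofReal C * stenzel.length γ := by
        rw [stenzel_length, MeasureTheory.lintegral_const_mul' _ _ ENNReal.ofReal_ne_top]

theorem contDiff_tau {γ : ℝ → SL2} (hγ : ContDiff ℝ 1 (fun t => entries (γ t))) :
    ContDiff ℝ 1 (fun t => tau (γ t)) := by
  have h : ∀ i j, ContDiff ℝ 1 (fun t => Complex.normSq ((γ t : M2) i j)) := by
    intro i j
    have h1 : ContDiff ℝ 1 (fun t => (γ t : M2) i j) := contDiff_pi.1 (contDiff_pi.1 hγ i) j
    simp only [Complex.normSq_eq_norm_sq]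
    exact h1.norm_sq ℝ
  exact ((((h 0 0).add (h 0 1)).add (h 1 0)).add (h 1 1)).div_const 2

/-- The differential of τ on X is Re ⟨X, u⟩, so `normSq_pair_le_stenzelForm` makes log(τ + 1)
Lipschitz with constant 2 for arc length. Curves of length less than 1 therefore stay in a region of
bounded τ. -/
theorem abs_log_tau_sub_le {γ : ℝ → SL2} (hγ : ContDiff ℝ 1 (fun t => entries (γ t)))
    (hl : stenzel.length γ < 1) {s : ℝ} (hs : s ∈ Set.Icc (0 : ℝ) 1) :
    |Real.log (tau (γ s) + 1) - Real.log (tau (γ 0) + 1)| ≤ 2 := by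
  have hpos : ∀ t, 0 < tau (γ t) + 1 := fun t => by linarith [one_le_tau (γ t)]
  have hf : ContDiff ℝ 1 (fun t => Real.log (tau (γ t) + 1)) :=
    ((contDiff_tau hγ).add contDiff_const).log fun t => (hpos t).ne'
  have h := enorm_sub_le_length (γ := γ) hf (C := 2) (by norm_num) (fun t _ => ?_) hs
  · have h1 : ENNReal.ofReal |Real.log (tau (γ s) + 1) - Real.log (tau (γ 0) + 1)| ≤
        ENNReal.ofReal 2 := by
      rw [← Real.norm_eq_abs, ofReal_norm]
      refine h.trans ?_
      calc ENNReal.ofReal 2 * stenzel.length γ ≤ ENNReal.ofReal 2 * 1 := by gcongr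
        _ = ENNReal.ofReal 2 := mul_one _
    exact (ENNReal.ofReal_le_ofReal_iff (by norm_num)).1 h1
  · have hd := ((hasDerivAt_tau (hasDerivAt_velocity hγ t)).add_const 1).log (hpos t).ne'
    rw [hd.deriv, Real.norm_eq_abs, abs_div, abs_of_pos (hpos t), div_le_iff₀ (hpos t)]
    have h1 := normSq_pair_le_stenzelForm (velocity γ t).2
    set S := stenzelForm (γ t) (velocity γ t) (velocity γ t) with hS
    have hS0 : 0 ≤ S := by
      by_contra hneg
      push Not at hneg
      have := Complex.normSq_nonneg (pair (velocity γ t) (γ t))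
      nlinarith [pow_pos (hpos t) 2]
    have h2 : speed γ t ^ 2 = S := Real.sq_sqrt hS0
    have h3 : 0 ≤ speed γ t := Real.sqrt_nonneg _
    refine abs_le_of_sq_le_sq ?_ (by have := hpos t; positivity)
    have h4 : (pair (velocity γ t) (γ t)).re ^ 2 ≤ Complex.normSq (pair (velocity γ t) (γ t)) := by
      rw [Complex.normSq_apply]
      nlinarith [sq_nonneg (pair (velocity γ t) (γ t)).im]
    have h5 : 0 ≤ (tau (γ t) + 1) ^ 2 * S := by positivity
    calc _ ≤ _ := h4.trans h1
      _ ≤ 4 * ((tau (γ t) + 1) ^ 2 * S) := by linarith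
      _ = _ := by rw [← h2]; ring

/-- The pointwise lower bound is a continuous positive function of τ, hence bounded away from zero
for τ in the compact interval [1, R]. -/
theorem exists_stenzel_lower_bound (R : ℝ) :
    ∃ c > 0, ∀ (u : SL2) (X : M2), X ∈ tangentSpace u → tau u ≤ R →
      c ^ 2 * frobSq X ≤ stenzelForm u X X := by
  rcases lt_or_ge R 1 with hR | hR
  · exact ⟨1, one_pos, fun u X _ hu => absurd (one_le_tau u) (by linarith)⟩
  have hcont : ContinuousOn (fun x => min (profile x) x⁻¹) (Set.Icc 1 R) := by
    refine ContinuousOn.inf (contDiffOn_profile.continuousOn.mono ?_)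
      (continuousOn_id.inv₀ fun x hx => ?_)
    · intro x hx
      exact show -1 < x by linarith [hx.1]
    · exact (show (0 : ℝ) < x by linarith [hx.1]).ne'
  obtain ⟨x₀, hx₀, hmin⟩ := isCompact_Icc.exists_isMinOn ⟨1, le_rfl, hR⟩ hcont
  have hpos : 0 < min (profile x₀) x₀⁻¹ :=
    lt_min (profile_pos (by linarith [hx₀.1])) (inv_pos.2 (by linarith [hx₀.1]))
  refine ⟨Real.sqrt (min (profile x₀) x₀⁻¹), Real.sqrt_pos.2 hpos, fun u X hX hu => ?_⟩
  rw [Real.sq_sqrt hpos.le]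
  exact (mul_le_mul_of_nonneg_right (hmin ⟨one_le_tau u, hu⟩) (frobSq_nonneg X)).trans
    (stenzelForm_self_ge hX)

theorem exists_stenzel_upper_bound (R : ℝ) :
    ∃ C > 0, ∀ (u : SL2) (X : M2), tau u ≤ R → stenzelForm u X X ≤ C * frobSq X := by
  have hsub : Set.Icc 1 R ⊆ Set.Ioi (-1) := fun x hx => show -1 < x by linarith [hx.1]
  have hcont : ContinuousOn (fun x => |profile x| + |deriv profile x| * x) (Set.Icc 1 R) :=
    (contDiffOn_profile.continuousOn.mono hsub).abs.add
      ((contDiffOn_deriv_profile.continuousOn.mono hsub).abs.mul continuousOn_id)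
  obtain ⟨C, hC⟩ := isCompact_Icc.exists_bound_of_continuousOn hcont
  refine ⟨max C 1, by positivity, fun u X hu => ?_⟩
  have h1 := (Real.le_norm_self _).trans (hC (tau u) ⟨one_le_tau u, hu⟩)
  have h2 := normSq_pair_le X u
  rw [show frobSq (u : M2) = 2 * tau u by rw [tau_eq_frobSq]; ring] at h2
  have hN := frobSq_nonneg X
  have h3 : deriv profile (tau u) / 2 * Complex.normSq (pair X u) ≤
      |deriv profile (tau u)| / 2 * (frobSq X * (2 * tau u)) := by
    have h4 := le_abs_self (deriv profile (tau u))
    have h5 := Complex.normSq_nonneg (pair X u)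
    have h6 := abs_nonneg (deriv profile (tau u))
    calc _ ≤ |deriv profile (tau u)| / 2 * Complex.normSq (pair X u) := by gcongr
      _ ≤ _ := by gcongr
  rw [stenzelForm_self]
  calc _ ≤ |profile (tau u)| * frobSq X + |deriv profile (tau u)| / 2 * (frobSq X * (2 * tau u)) :=
        add_le_add (mul_le_mul_of_nonneg_right (le_abs_self _) hN) h3
    _ = (|profile (tau u)| + |deriv profile (tau u)| * tau u) * frobSq X := by ring
    _ ≤ max C 1 * frobSq X := mul_le_mul_of_nonneg_right (h1.trans (le_max_left _ _)) hN

theorem enorm_entries_sub_le {γ : ℝ → SL2} (hγ : ContDiff ℝ 1 (fun t => entries (γ t))) {R c : ℝ}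
    (hc : 0 < c) (hcR : ∀ (u : SL2) (X : M2), X ∈ tangentSpace u → tau u ≤ R →
      c ^ 2 * frobSq X ≤ stenzelForm u X X)
    (hR : ∀ s ∈ Set.Icc (0 : ℝ) 1, tau (γ s) ≤ R) :
    ‖entries (γ 1) - entries (γ 0)‖ₑ ≤ ENNReal.ofReal c⁻¹ * stenzel.length γ := by
  refine enorm_sub_le_length hγ (inv_nonneg.2 hc.le) (fun t ht => ?_) ⟨zero_le_one, le_rfl⟩
  have h1 := hcR (γ t) _ (velocity γ t).2 (hR t ht)
  refine (norm_le_sqrt_frobSq _).trans ?_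
  rw [le_inv_mul_iff₀ hc, speed]
  refine Real.le_sqrt_of_sq_le ?_
  rw [mul_pow, Real.sq_sqrt (frobSq_nonneg _)]
  exact h1

theorem exists_curve_of_edist_lt {g : RiemMetric} {u v : SL2} {ε : ℝ≥0∞} (h : g.edist u v < ε) :
    ∃ γ : ℝ → SL2, ContDiff ℝ 1 (fun t => entries (γ t)) ∧ γ 0 = u ∧ γ 1 = v ∧
      g.length γ < ε := by
  simp only [RiemMetric.edist, iInf_lt_iff] at h
  obtain ⟨γ, h1, h2, h3, h4⟩ := h
  exact ⟨γ, h1, h2, h3, h4⟩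

/-! ### Short curves between nearby points -/

/-- Determinant of the segment `y + σ D`. -/
def segDet (y D : Fin 2 → Fin 2 → ℂ) (σ : ℂ) : ℂ :=
  (y 0 0 + σ * D 0 0) * (y 1 1 + σ * D 1 1) - (y 0 1 + σ * D 0 1) * (y 1 0 + σ * D 1 0)

/-- Derivative of `segDet` when `σ` has derivative `ρ`. -/
def segDet' (y D : Fin 2 → Fin 2 → ℂ) (σ ρ : ℂ) : ℂ :=
  (ρ * D 0 0) * (y 1 1 + σ * D 1 1) + (y 0 0 + σ * D 0 0) * (ρ * D 1 1) -
    ((ρ * D 0 1) * (y 1 0 + σ * D 1 0) + (y 0 1 + σ * D 0 1) * (ρ * D 1 0))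

/-- The segment `y + σ D` with its first row normalized to have determinant one. -/
def segMat (y D : Fin 2 → Fin 2 → ℂ) (σ : ℂ) : M2 :=
  !![(y 0 0 + σ * D 0 0) / segDet y D σ, (y 0 1 + σ * D 0 1) / segDet y D σ;
    y 1 0 + σ * D 1 0, y 1 1 + σ * D 1 1]

/-- Derivative of `segMat` when `σ` has derivative `ρ`. -/
def segMat' (y D : Fin 2 → Fin 2 → ℂ) (σ ρ : ℂ) : M2 :=
  !![(ρ * D 0 0 * segDet y D σ - (y 0 0 + σ * D 0 0) * segDet' y D σ ρ) / segDet y D σ ^ 2,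
      (ρ * D 0 1 * segDet y D σ - (y 0 1 + σ * D 0 1) * segDet' y D σ ρ) / segDet y D σ ^ 2;
    ρ * D 1 0, ρ * D 1 1]

theorem segMat_det {y D : Fin 2 → Fin 2 → ℂ} {σ : ℂ} (h : segDet y D σ ≠ 0) :
    (segMat y D σ).det = 1 := by
  rw [Matrix.det_fin_two]
  simp only [segMat, Matrix.of_apply, Matrix.cons_val', Matrix.cons_val_zero, Matrix.cons_val_one,
    Matrix.cons_val_fin_one]
  field_simp
  rw [segDet]

theorem hasDerivAt_segDet (y D : Fin 2 → Fin 2 → ℂ) {σ : ℝ → ℂ} {ρ : ℂ} {s : ℝ}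
    (h : HasDerivAt σ ρ s) :
    HasDerivAt (fun s => segDet y D (σ s)) (segDet' y D (σ s) ρ) s := by
  have hB : ∀ i j, HasDerivAt (fun s => y i j + σ s * D i j) (ρ * D i j) s := fun i j =>
    (h.mul_const _).const_add _
  exact ((hB 0 0).mul (hB 1 1)).sub ((hB 0 1).mul (hB 1 0))

theorem hasDerivAt_segMat (y D : Fin 2 → Fin 2 → ℂ) {σ : ℝ → ℂ} {ρ : ℂ} {s : ℝ}
    (h : HasDerivAt σ ρ s) (h0 : segDet y D (σ s) ≠ 0) (i j : Fin 2) :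
    HasDerivAt (fun s => segMat y D (σ s) i j) (segMat' y D (σ s) ρ i j) s := by
  have hB : ∀ i j, HasDerivAt (fun s => y i j + σ s * D i j) (ρ * D i j) s := fun i j =>
    (h.mul_const _).const_add _
  have hd := hasDerivAt_segDet y D h
  fin_cases i <;> fin_cases j
  · exact (hB 0 0).div hd h0
  · exact (hB 0 1).div hd h0
  · exact hB 1 0
  · exact hB 1 1

theorem contDiff_segMat (y D : Fin 2 → Fin 2 → ℂ) {σ : ℝ → ℂ} (h : ContDiff ℝ 1 σ)
    (h0 : ∀ s, segDet y D (σ s) ≠ 0) (i j : Fin 2) :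
    ContDiff ℝ 1 (fun s => segMat y D (σ s) i j) := by
  have hB : ∀ i j, ContDiff ℝ 1 (fun s => y i j + σ s * D i j) := fun i j =>
    contDiff_const.add (h.mul contDiff_const)
  have hd : ContDiff ℝ 1 (fun s => segDet y D (σ s)) :=
    ((hB 0 0).mul (hB 1 1)).sub ((hB 0 1).mul (hB 1 0))
  have hdiv : ∀ j, ContDiff ℝ 1 (fun s => (y 0 j + σ s * D 0 j) / segDet y D (σ s)) := by
    intro j
    simp only [div_eq_mul_inv]
    exact (hB 0 j).mul (hd.inv h0)
  fin_cases i <;> fin_cases j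
  · exact hdiv 0
  · exact hdiv 1
  · exact hB 1 0
  · exact hB 1 1

theorem continuous_segDet (y : Fin 2 → Fin 2 → ℂ) :
    Continuous fun p : (Fin 2 → Fin 2 → ℂ) × ℝ × ℝ => segDet y p.1 p.2.1 := by
  unfold segDet
  fun_prop

theorem continuousAt_frobSq {α : Type*} [TopologicalSpace α] {A : α → M2} {x : α}
    (h : ∀ i j, ContinuousAt (fun x => A x i j) x) : ContinuousAt (fun x => frobSq (A x)) x := by
  have hn : ∀ i j, ContinuousAt (fun x => Complex.normSq (A x i j)) x := fun i j =>
    Complex.continuous_normSq.continuousAt.comp (h i j)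
  exact (((hn 0 0).add (hn 0 1)).add (hn 1 0)).add (hn 1 1)

theorem continuousAt_segMat (y : Fin 2 → Fin 2 → ℂ) (p : (Fin 2 → Fin 2 → ℂ) × ℝ × ℝ)
    (h0 : segDet y p.1 p.2.1 ≠ 0) (i j : Fin 2) :
    ContinuousAt (fun p : (Fin 2 → Fin 2 → ℂ) × ℝ × ℝ => segMat y p.1 p.2.1 i j) p := by
  have hB : ∀ i j, Continuous
      (fun p : (Fin 2 → Fin 2 → ℂ) × ℝ × ℝ => y i j + (p.2.1 : ℂ) * p.1 i j) := by
    intro i j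
    fun_prop
  have hd := (continuous_segDet y).continuousAt (x := p)
  fin_cases i <;> fin_cases j
  · exact (hB 0 0).continuousAt.div hd h0
  · exact (hB 0 1).continuousAt.div hd h0
  · exact (hB 1 0).continuousAt
  · exact (hB 1 1).continuousAt

theorem continuousAt_segMat' (y : Fin 2 → Fin 2 → ℂ) (p : (Fin 2 → Fin 2 → ℂ) × ℝ × ℝ)
    (h0 : segDet y p.1 p.2.1 ≠ 0) (i j : Fin 2) :
    ContinuousAt (fun p : (Fin 2 → Fin 2 → ℂ) × ℝ × ℝ => segMat' y p.1 p.2.1 p.2.2 i j) p := by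
  have hd := continuous_segDet y
  have hd' : Continuous
      (fun p : (Fin 2 → Fin 2 → ℂ) × ℝ × ℝ => segDet' y p.1 p.2.1 p.2.2) := by
    unfold segDet'
    fun_prop
  have hnum : ∀ j, Continuous (fun p : (Fin 2 → Fin 2 → ℂ) × ℝ × ℝ =>
      (p.2.2 : ℂ) * p.1 0 j * segDet y p.1 p.2.1 -
        (y 0 j + (p.2.1 : ℂ) * p.1 0 j) * segDet' y p.1 p.2.1 p.2.2) := by
    intro j
    fun_prop
  have hB : ∀ i j, Continuous
      (fun p : (Fin 2 → Fin 2 → ℂ) × ℝ × ℝ => (p.2.2 : ℂ) * p.1 i j) := by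
    intro i j
    fun_prop
  fin_cases i <;> fin_cases j
  · exact (hnum 0).continuousAt.div (hd.pow 2).continuousAt (pow_ne_zero 2 h0)
  · exact (hnum 1).continuousAt.div (hd.pow 2).continuousAt (pow_ne_zero 2 h0)
  · exact (hB 1 0).continuousAt
  · exact (hB 1 1).continuousAt

/-- For D = 0 the segment is constant, equal to y, with zero derivative. Compactness of the
parameter rectangle makes the open conditions hold uniformly for small D. -/
theorem eventually_segMat_small (y : SL2) {ε : ℝ} (hε : 0 < ε) :
    ∀ᶠ D : Fin 2 → Fin 2 → ℂ in 𝓝 0, ∀ q ∈ Set.Icc (0 : ℝ) 1 ×ˢ Set.Icc (-2 : ℝ) 2,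
      segDet (entries y) D q.1 ≠ 0 ∧ frobSq (segMat (entries y) D q.1) < 2 * (tau y + 1) ∧
        frobSq (segMat' (entries y) D q.1 q.2) < ε := by
  refine IsCompact.eventually_forall_of_forall_eventually (isCompact_Icc.prod isCompact_Icc) ?_
  intro q _
  have hdet : segDet (entries y) 0 q.1 = 1 := by
    simpa [segDet, entries] using SL2.det_eq y
  have hdet' : segDet' (entries y) 0 q.1 q.2 = 0 := by simp [segDet']
  have h0 : segDet (entries y) ((0 : Fin 2 → Fin 2 → ℂ), q).1 ((0 : Fin 2 → Fin 2 → ℂ), q).2.1 ≠ 0 := by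
    simp [hdet]
  refine Filter.Eventually.and ?_ (Filter.Eventually.and ?_ ?_)
  · exact (continuous_segDet (entries y)).continuousAt.eventually_ne h0
  · refine (continuousAt_frobSq (continuousAt_segMat (entries y) _ h0)).eventually_lt_const ?_
    have : segMat (entries y) 0 q.1 = (y : M2) := by
      ext i j
      fin_cases i <;> fin_cases j <;> simp [segMat, hdet, entries]
    simp only [this, tau_eq_frobSq]
    linarith
  · refine (continuousAt_frobSq (continuousAt_segMat' (entries y) _ h0)).eventually_lt_const ?_
    have : segMat' (entries y) 0 q.1 q.2 = 0 := by
      ext i j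
      fin_cases i <;> fin_cases j <;> simp [segMat', hdet']
    simp only [this]
    simpa [frobSq] using hε

/-- Convergence of matrices implies convergence in the Riemannian distance. -/
theorem tendsto_edist_of_tendsto_entries {x : ℕ → SL2} {y : SL2}
    (h : Filter.Tendsto (fun n => entries (x n)) Filter.atTop (𝓝 (entries y))) :
    Filter.Tendsto (fun n => stenzel.edist (x n) y) Filter.atTop (𝓝 0) := by
  rw [ENNReal.tendsto_nhds_zero]
  intro ε hε
  rcases eq_or_ne ε ⊤ with rfl | hεtop
  · simp
  obtain ⟨C, hC, hCR⟩ := exists_stenzel_upper_bound (tau y + 1)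
  have hε' : 0 < ε.toReal := ENNReal.toReal_pos hε.ne' hεtop
  -- With squared Frobenius speed below ε²/C, the upper bound C on the metric gives speed at most ε,
  -- hence length at most ε.
  have hsmall := eventually_segMat_small y (ε := ε.toReal ^ 2 / C) (by positivity)
  have hD : Filter.Tendsto (fun n => entries (x n) - entries y) Filter.atTop (𝓝 0) := by
    simpa using h.sub_const (entries y)
  filter_upwards [hD.eventually hsmall] with n hn
  set D := entries (x n) - entries y with hDdef
  -- Goes from 1 (the point `x n`) at s = 0 to 0 (the point `y`) at s = 1, and stays in [0, 1] for
  -- every real s. The normalized segment is thus defined and C¹ on the whole line, as a curve must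
  -- be. Its derivative is at most π/2 ≤ 2 in absolute value.
  set σ : ℝ → ℝ := fun s => (1 + Real.cos (Real.pi * s)) / 2 with hσ
  set ρ : ℝ → ℝ := fun s => -Real.sin (Real.pi * s) * Real.pi / 2 with hρ
  have hmem : ∀ s, (σ s, ρ s) ∈ Set.Icc (0 : ℝ) 1 ×ˢ Set.Icc (-2 : ℝ) 2 := by
    intro s
    have h1 := Real.neg_one_le_cos (Real.pi * s)
    have h2 := Real.cos_le_one (Real.pi * s)
    have h3 := Real.neg_one_le_sin (Real.pi * s)
    have h4 := Real.sin_le_one (Real.pi * s)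
    have h5 := Real.pi_pos
    have h6 := Real.pi_le_four
    refine ⟨⟨?_, ?_⟩, ?_, ?_⟩ <;> simp only [hσ, hρ] <;> nlinarith
  have hσd : ∀ s, HasDerivAt (fun s => (σ s : ℂ)) (ρ s : ℂ) s := by
    intro s
    have h1 : HasDerivAt (fun s : ℝ => Real.pi * s) Real.pi s := by
      simpa using (hasDerivAt_id s).const_mul Real.pi
    have h2 : HasDerivAt σ (ρ s) s := ((h1.cos).const_add 1).div_const 2
    exact h2.ofReal_comp
  have hσc : ContDiff ℝ 1 (fun s => (σ s : ℂ)) := by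
    have : ContDiff ℝ 1 σ := by
      rw [hσ]
      fun_prop
    exact Complex.ofRealCLM.contDiff.comp this
  have hdet : ∀ s, segDet (entries y) D (σ s) ≠ 0 := fun s => (hn _ (hmem s)).1
  set γ : ℝ → SL2 := fun s => ⟨segMat (entries y) D (σ s), segMat_det (hdet s)⟩ with hγ
  have hγc : ContDiff ℝ 1 (fun t => entries (γ t)) :=
    contDiff_pi.2 fun i => contDiff_pi.2 fun j => contDiff_segMat (entries y) D hσc hdet i j
  have hvel : ∀ s, (velocity γ s : M2) = segMat' (entries y) D (σ s) (ρ s) := by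
    intro s
    ext i j
    exact (hasDerivAt_velocity hγc s i j).unique
      (hasDerivAt_segMat (entries y) D (hσd s) (hdet s) i j)
  have hγ0 : γ 0 = x n := by
    have hσ0 : σ 0 = 1 := by simp [hσ]
    have hd1 : segDet (entries y) D 1 = 1 := by
      simpa [segDet, hDdef, entries] using SL2.det_eq (x n)
    apply Subtype.ext
    simp only [hγ, hσ0, Complex.ofReal_one]
    ext i j
    fin_cases i <;> fin_cases j <;> simp [segMat, hd1] <;> simp [hDdef, entries]
  have hγ1 : γ 1 = y := by
    have hσ1 : σ 1 = 0 := by simp [hσ]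
    have hd1 : segDet (entries y) D 0 = 1 := by
      simpa [segDet, entries] using SL2.det_eq y
    apply Subtype.ext
    simp only [hγ, hσ1, Complex.ofReal_zero]
    ext i j
    fin_cases i <;> fin_cases j <;> simp [segMat, hd1] <;> simp [entries]
  have hspeed : ∀ s, speed γ s ≤ ε.toReal := by
    intro s
    refine Real.sqrt_le_iff.2 ⟨hε'.le, ?_⟩
    have h1 : tau (γ s) ≤ tau y + 1 := by
      have := (hn _ (hmem s)).2.1
      rw [tau_eq_frobSq (γ s)]
      have h2 : frobSq (γ s : M2) < 2 * (tau y + 1) := this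
      linarith
    refine (hCR (γ s) (velocity γ s) h1).trans ?_
    rw [hvel]
    have h2 := (hn _ (hmem s)).2.2
    calc _ ≤ C * (ε.toReal ^ 2 / C) := by gcongr
      _ = ε.toReal ^ 2 := by field_simp
  calc stenzel.edist (x n) y ≤ stenzel.length γ := by
        rw [RiemMetric.edist]
        exact iInf_le_of_le γ (iInf_le_of_le hγc (iInf_le_of_le hγ0 (iInf_le _ hγ1)))
    _ ≤ ∫⁻ _ in Set.Icc (0 : ℝ) 1, ε := by
        rw [stenzel_length]
        refine MeasureTheory.lintegral_mono fun s => ?_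
        exact ENNReal.ofReal_le_of_le_toReal (hspeed s)
    _ = ε := by simp

theorem stenzel_isComplete : stenzel.IsComplete := by
  intro x hx
  obtain ⟨N, hN⟩ := hx 1 one_pos
  -- An increase of at most 2 from `x N` to any later term, and of at most 2 more along a short
  -- curve starting there.
  set L := Real.log (tau (x N) + 1) + 4 with hL
  have hpos : ∀ u : SL2, 0 < tau u + 1 := fun u => by linarith [one_le_tau u]
  have hbound : ∀ m ≥ N, Real.log (tau (x m) + 1) ≤ Real.log (tau (x N) + 1) + 2 := by
    intro m hm
    obtain ⟨γ, hγ, h0, h1, hl⟩ := exists_curve_of_edist_lt (hN N le_rfl m hm)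
    have := abs_log_tau_sub_le hγ hl (s := 1) ⟨zero_le_one, le_rfl⟩
    rw [h0, h1] at this
    linarith [(abs_le.1 this).2]
  obtain ⟨c, hc, hcR⟩ := exists_stenzel_lower_bound (Real.exp L)
  have hcauchy : CauchySeq fun n => entries (x n) := by
    rw [EMetric.cauchySeq_iff]
    intro ε hε
    -- Length below 1 confines the curve to τ ≤ exp L; length below ε c then makes the entries
    -- ε-close.
    have hδ : 0 < min 1 (ε * ENNReal.ofReal c) := by
      refine lt_min one_pos (ENNReal.mul_pos hε.ne' ?_)
      simpa using hc
    obtain ⟨N', hN'⟩ := hx _ hδ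
    refine ⟨max N N', fun m hm n hn => ?_⟩
    obtain ⟨γ, hγ, h0, h1, hl⟩ := exists_curve_of_edist_lt
      (hN' n (le_trans (le_max_right _ _) hn) m (le_trans (le_max_right _ _) hm))
    have hR : ∀ s ∈ Set.Icc (0 : ℝ) 1, tau (γ s) ≤ Real.exp L := by
      intro s hs
      have h2 := (abs_le.1 (abs_log_tau_sub_le hγ (hl.trans_le (min_le_left _ _)) hs)).2
      rw [h0] at h2
      have h3 := hbound n (le_trans (le_max_left _ _) hn)
      have h4 : Real.log (tau (γ s) + 1) ≤ L := by linarith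
      have h5 := (Real.log_le_iff_le_exp (hpos _)).1 h4
      linarith
    have h2 := enorm_entries_sub_le hγ hc hcR hR
    rw [h0, h1] at h2
    rw [edist_eq_enorm_sub]
    refine h2.trans_lt ?_
    have h3 := hl.trans_le (min_le_right _ _)
    have hc0 : ENNReal.ofReal c ≠ 0 := by simpa using hc
    rw [ENNReal.ofReal_inv_of_pos hc, mul_comm, ← div_eq_mul_inv]
    exact ENNReal.div_lt_of_lt_mul h3
  obtain ⟨Y, hY⟩ := cauchySeq_tendsto_of_complete hcauchy
  have hdet : (Matrix.of Y).det = 1 := by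
    have hcont : Continuous fun A : Fin 2 → Fin 2 → ℂ => A 0 0 * A 1 1 - A 0 1 * A 1 0 := by
      fun_prop
    have h1 := (hcont.tendsto Y).comp hY
    have h2 : ((fun A : Fin 2 → Fin 2 → ℂ => A 0 0 * A 1 1 - A 0 1 * A 1 0) ∘
        fun n => entries (x n)) = fun _ => 1 := by
      ext1 n
      exact SL2.det_eq (x n)
    rw [h2] at h1
    rw [Matrix.det_fin_two]
    exact (tendsto_nhds_unique tendsto_const_nhds h1).symm
  exact ⟨⟨Matrix.of Y, hdet⟩, tendsto_edist_of_tendsto_entries hY⟩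

/-! ### The chart of matrices with nonzero upper left entry -/

/-- The matrix of determinant one with three given entries. -/
def chartMat (z : C3) : M2 := !![z 0, z 1; z 2, (1 + z 1 * z 2) / z 0]

/-- The differential of `chartMat`. -/
def chartJac (z v : C3) : M2 :=
  !![v 0, v 1; v 2, ((v 1 * z 2 + z 1 * v 2) * z 0 - (1 + z 1 * z 2) * v 0) / z 0 ^ 2]

theorem chartMat_det {z : C3} (h : z 0 ≠ 0) : (chartMat z).det = 1 := by
  rw [Matrix.det_fin_two]
  simp [chartMat]
  field_simp
  ring

open Classical in
/-- The parametrization underlying `chart`. -/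
def chartFun (z : C3) : SL2 := if h : z 0 ≠ 0 then ⟨chartMat z, chartMat_det h⟩ else 1

theorem coe_chartFun {z : C3} (h : z 0 ≠ 0) : (chartFun z : M2) = chartMat z := by
  simp [chartFun, h]

theorem isOpen_chart : IsOpen {z : C3 | z 0 ≠ 0} :=
  isOpen_ne.preimage (continuous_apply 0)

theorem differentiableAt_chartFun {z : C3} (h : z 0 ≠ 0) :
    DifferentiableAt ℂ (fun z => entries (chartFun z)) z := by
  have hev : (fun z => entries (chartFun z)) =ᶠ[𝓝 z] fun z i j => chartMat z i j := by
    filter_upwards [isOpen_chart.mem_nhds h] with x hx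
    ext i j
    exact congrFun (congrFun (coe_chartFun hx) i) j
  refine DifferentiableAt.congr_of_eventuallyEq ?_ hev
  rw [differentiableAt_pi]
  intro i
  rw [differentiableAt_pi]
  intro j
  fin_cases i <;> fin_cases j <;> simp [chartMat]
  · fun_prop
  · fun_prop
  · fun_prop
  · have h1 : DifferentiableAt ℂ (fun x : C3 => 1 + x 1 * x 2) z := by fun_prop
    have h2 : DifferentiableAt ℂ (fun x : C3 => x 0) z := by fun_prop
    simp only [div_eq_mul_inv]
    exact h1.fun_mul (h2.fun_inv h)

theorem fderiv_chartFun {z : C3} (h : z 0 ≠ 0) (v : C3) :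
    Matrix.of (fderiv ℂ (fun z => entries (chartFun z)) z v) = chartJac z v := by
  have h0 : z + (0 : ℂ) • v = z := by simp
  have h1 := hasDerivAt_line (f := fun z => entries (chartFun z)) (x := z) (v := v) (ζ := 0)
    (by rw [h0]; exact differentiableAt_chartFun h)
  rw [h0] at h1
  have hl : ∀ i, HasDerivAt (fun w : ℂ => (z + w • v) i) (v i) 0 := by
    intro i
    simpa using ((hasDerivAt_id (0 : ℂ)).mul_const (v i)).const_add (z i)
  have hev : ∀ᶠ w : ℂ in 𝓝 0, (z + w • v) 0 ≠ 0 :=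
    (hl 0).continuousAt.eventually_ne (by simpa using h)
  ext i j
  have h2 := hasDerivAt_pi.1 (hasDerivAt_pi.1 h1 i) j
  have h3 : (fun w : ℂ => chartMat (z + w • v) i j) =ᶠ[𝓝 0]
      fun w => entries (chartFun (z + w • v)) i j := by
    filter_upwards [hev] with w hw
    rw [← coe_chartFun hw, entries]
  refine (h2.congr_of_eventuallyEq h3).unique ?_
  fin_cases i <;> fin_cases j
  · exact hl 0
  · exact hl 1
  · exact hl 2
  · convert! (((hl 1).mul (hl 2)).const_add 1).div (hl 0) (by simpa using h) using 1
    simp [chartJac]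

/-- The chart of matrices with nonzero upper left entry. -/
def chart : Param where
  toFun := chartFun
  U := {z | z 0 ≠ 0}
  isOpen := isOpen_chart
  holomorphic := fun _ hz => (differentiableAt_chartFun hz).differentiableWithinAt
  injective := by
    intro z hz w hw h
    have h1 : chartMat z = chartMat w := by
      rw [← coe_chartFun hz, ← coe_chartFun hw, h]
    ext i
    fin_cases i
    · exact congrFun (congrFun h1 0) 0
    · exact congrFun (congrFun h1 0) 1
    · exact congrFun (congrFun h1 1) 0
  immersion := by
    intro z hz
    rw [injective_iff_map_eq_zero]
    intro v hv
    have h1 := fderiv_chartFun hz v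
    rw [hv] at h1
    ext i
    fin_cases i
    · exact (congrFun (congrFun h1 0) 0).symm
    · exact (congrFun (congrFun h1 0) 1).symm
    · exact (congrFun (congrFun h1 1) 0).symm

theorem mem_chart {z : C3} : z ∈ chart.U ↔ z 0 ≠ 0 := Iff.rfl

theorem chart_toFun {z : C3} (h : z 0 ≠ 0) : (chart.toFun z : M2) = chartMat z := coe_chartFun h

theorem chart_jac {z : C3} (h : z 0 ≠ 0) (v : C3) : chart.jac z v = chartJac z v :=
  fderiv_chartFun h v

/-- The coordinates of a matrix in `chart`. -/
def chartCoord (A : M2) : C3 := ![A 0 0, A 0 1, A 1 0]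

theorem chart_chartCoord {u : SL2} (h : u 0 0 ≠ 0) : chart.toFun (chartCoord u) = u := by
  apply Subtype.ext
  rw [chart_toFun (by simpa [chartCoord] using h)]
  have := SL2.det_eq u
  ext i j
  fin_cases i <;> fin_cases j <;> simp [chartMat, chartCoord]
  field_simp
  linear_combination -this

/-- The coordinates of `diagSL t`. -/
def diagCoord (t : ℝ) : C3 := ![(Real.exp (t / 2) : ℂ), 0, 0]

theorem diagCoord_mem (t : ℝ) : diagCoord t ∈ chart.U := by
  rw [mem_chart]
  simp [diagCoord]

theorem chart_diagCoord (t : ℝ) : chart.toFun (diagCoord t) = diagSL t := by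
  have h : diagCoord t = chartCoord (diagSL t) := by
    ext i
    fin_cases i <;> simp [diagCoord, chartCoord, diagSL]
  rw [h, chart_chartCoord]
  simp [diagSL]

theorem chart_jac_diagCoord (t : ℝ) (v : C3) :
    chart.jac (diagCoord t) v = !![v 0, v 1; v 2, -(Real.exp (-t) : ℂ) * v 0] := by
  rw [chart_jac (diagCoord_mem t)]
  have e : (Real.exp (-t) : ℂ) = ((Real.exp (t / 2) : ℂ) ^ 2)⁻¹ := by
    rw [← Complex.ofReal_pow, ← Real.exp_nat_mul, ← Complex.ofReal_inv, ← Real.exp_neg]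
    push_cast
    ring_nf
  ext i j
  fin_cases i <;> fin_cases j <;> simp [chartJac, diagCoord, -Complex.ofReal_exp, e]
  ring

theorem contDiff_diagCoord : ContDiff ℝ ∞ diagCoord := by
  refine contDiff_pi.2 fun i => ?_
  fin_cases i
  · have : ContDiff ℝ ∞ fun t : ℝ => Real.exp (t / 2) := by fun_prop
    exact Complex.ofRealCLM.contDiff.comp this
  · exact contDiff_const
  · exact contDiff_const

/-- The curve `diagCoord` lies in the chart for all real t, so the coefficients are smooth across t
= 0 as well. -/
theorem RiemMetric.contDiff_coeff (g : RiemMetric) (v w : C3) :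
    ContDiff ℝ ∞ fun t => g.form (diagSL t) (chart.jac (diagCoord t) v)
      (chart.jac (diagCoord t) w) := by
  have h := (g.smooth chart v w).comp_contDiff contDiff_diagCoord diagCoord_mem
  simp only [g.inner_eq_form, Param.coe_push, Function.comp_def, chart_diagCoord] at h
  exact h

theorem RiemMetric.contDiff_coeffP (g : RiemMetric) : ContDiff ℝ ∞ g.coeffP := by
  have h := g.contDiff_coeff ![1, 0, 0] ![1, 0, 0]
  have e : ∀ t, chart.jac (diagCoord t) ![1, 0, 0] = radialVec t := by
    intro t
    rw [chart_jac_diagCoord]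
    simp [radialVec]
  simp only [e] at h
  exact h

theorem RiemMetric.contDiff_coeffQ (g : RiemMetric) : ContDiff ℝ ∞ g.coeffQ := by
  have h := g.contDiff_coeff ![0, 1, 0] ![0, 1, 0]
  have e : ∀ t, chart.jac (diagCoord t) ![0, 1, 0] = upperVec := by
    intro t
    rw [chart_jac_diagCoord]
    simp [upperVec]
  simp only [e] at h
  exact h

theorem RiemMetric.contDiff_coeffR (g : RiemMetric) : ContDiff ℝ ∞ g.coeffR := by
  have h := g.contDiff_coeff ![0, 0, 1] ![0, 0, 1]
  have e : ∀ t, chart.jac (diagCoord t) ![0, 0, 1] = lowerVec := by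
    intro t
    rw [chart_jac_diagCoord]
    simp [lowerVec]
  simp only [e] at h
  exact h

/-! ### The fundamental form along orbits -/

/-- The fundamental form along the diagonal subgroup. -/
def RiemMetric.diagOmega (g : RiemMetric) (t : ℝ) (A B : M2) : ℝ :=
  -(g.coeffP t * (A 0 0 * (starRingEnd ℂ) (B 0 0)).im +
    g.coeffQ t * (A 0 1 * (starRingEnd ℂ) (B 0 1)).im +
    g.coeffR t * (A 1 0 * (starRingEnd ℂ) (B 1 0)).im)

theorem RiemMetric.omegaCoord_eq_form (φ : Param) (v w z : C3) :
    g.omegaCoord φ v w z = g.form (φ.toFun z) (Complex.I • φ.jac z v) (φ.jac z w) := by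
  rw [RiemMetric.omegaCoord, RiemMetric.omega, g.inner_eq_form]
  rfl

theorem RiemMetric.differentiableAt_omegaCoord (g : RiemMetric) (φ : Param) (v w : C3) {z : C3}
    (hz : z ∈ φ.U) : DifferentiableAt ℝ (g.omegaCoord φ v w) z := by
  have h := ((g.smooth φ (Complex.I • v) w).contDiffAt (φ.isOpen.mem_nhds hz)).differentiableAt
    (by simp)
  simp only [φ.push_smul] at h
  exact h

theorem translate_inv_mem {k l u : SL2} {A : M2} (hA : A ∈ tangentSpace (k * u * l⁻¹)) :
    ((k⁻¹ : SL2) : M2) * A * (l : M2) ∈ tangentSpace u := by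
  have h := mem_tangentSpace.1 hA
  rw [show (k * u * l⁻¹)⁻¹ = l * u⁻¹ * k⁻¹ by group, Matrix.SpecialLinearGroup.coe_mul,
    Matrix.SpecialLinearGroup.coe_mul, Matrix.mul_assoc, Matrix.mul_assoc,
    Matrix.trace_mul_comm] at h
  rw [mem_tangentSpace, ← h]
  simp only [Matrix.mul_assoc]

theorem translate_inv_cancel (k l : SL2) (A : M2) :
    (k : M2) * (((k⁻¹ : SL2) : M2) * A * (l : M2)) * ((l⁻¹ : SL2) : M2) = A := by
  simp only [Matrix.mul_assoc, SL2.mul_inv_self, Matrix.mul_one]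
  rw [← Matrix.mul_assoc, SL2.mul_inv_self, Matrix.one_mul]

/-- Invariance moves the value of ω at any chart point back to `diagSL t`, where it is explicit.
Derivatives of ω along an orbit then involve only the translations. -/
theorem RiemMetric.omegaCoord_orbit (hg : g.IsHermitian) (hi : g.IsInvariant) {k l : SL2}
    (hk : k ∈ SU2) (hl : l ∈ SU2) {t : ℝ} {z : C3} (hz : chart.toFun z = k * diagSL t * l⁻¹)
    (v w : C3) :
    g.omegaCoord chart v w z =
      g.diagOmega t (((k⁻¹ : SL2) : M2) * chart.jac z v * (l : M2))
        (((k⁻¹ : SL2) : M2) * chart.jac z w * (l : M2)) := by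
  have hmem : ∀ v, ((k⁻¹ : SL2) : M2) * chart.jac z v * (l : M2) ∈ tangentSpace (diagSL t) :=
    fun v => translate_inv_mem (hz ▸ chart.jac_mem z v)
  have hI : ((k⁻¹ : SL2) : M2) * (Complex.I • chart.jac z v) * (l : M2) =
      Complex.I • (((k⁻¹ : SL2) : M2) * chart.jac z v * (l : M2)) := by
    rw [Matrix.mul_smul, Matrix.smul_mul]
  have h := hi.form_translate hk hl (diagSL t)
    (((k⁻¹ : SL2) : M2) * (Complex.I • chart.jac z v) * (l : M2))
    (((k⁻¹ : SL2) : M2) * chart.jac z w * (l : M2))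
  rw [translate_inv_cancel, translate_inv_cancel, ← hz, hI] at h
  rw [g.omegaCoord_eq_form, h, g.form_diagSL hg hi t (Submodule.smul_mem _ _ (hmem v)) (hmem w),
    RiemMetric.diagOmega]
  simp
  ring

theorem hasDerivAt_im {f : ℝ → ℂ} {f' : ℂ} {s : ℝ} (h : HasDerivAt f f' s) :
    HasDerivAt (fun s => (f s).im) f'.im s :=
  Complex.imCLM.hasFDerivAt.comp_hasDerivAt s h

theorem hasDerivAt_matrix_mul {A B : ℝ → M2} {A' B' : M2} {s : ℝ}
    (hA : ∀ i j, HasDerivAt (fun s => A s i j) (A' i j) s)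
    (hB : ∀ i j, HasDerivAt (fun s => B s i j) (B' i j) s) (i j : Fin 2) :
    HasDerivAt (fun s => (A s * B s) i j) ((A' * B s + A s * B') i j) s := by
  simp only [Matrix.mul_apply, Matrix.add_apply, Fin.sum_univ_two]
  convert! ((hA i 0).mul (hB 0 j)).add ((hA i 1).mul (hB 1 j)) using 1
  ring

/-- In determinant one the inverse is the adjugate, which is linear on 2 × 2 matrices. -/
theorem hasDerivAt_inv {k : ℝ → SL2} {α : M2} {s : ℝ}
    (hk : ∀ i j, HasDerivAt (fun s => (k s : M2) i j) (α i j) s) (i j : Fin 2) :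
    HasDerivAt (fun s => (((k s)⁻¹ : SL2) : M2) i j) (α.adjugate i j) s := by
  simp only [Matrix.SpecialLinearGroup.coe_inv, Matrix.adjugate_fin_two]
  fin_cases i <;> fin_cases j
  · exact hk 1 1
  · exact (hk 0 1).neg
  · exact (hk 1 0).neg
  · exact hk 0 0

theorem RiemMetric.hasDerivAt_diagOmega (g : RiemMetric) (t : ℝ) {A B : ℝ → M2} {A' B' : M2}
    {s : ℝ} (hA : ∀ i j, HasDerivAt (fun s => A s i j) (A' i j) s)
    (hB : ∀ i j, HasDerivAt (fun s => B s i j) (B' i j) s) :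
    HasDerivAt (fun s => g.diagOmega t (A s) (B s))
      (g.diagOmega t A' (B s) + g.diagOmega t (A s) B') s := by
  have h : ∀ i j, HasDerivAt (fun s => (A s i j * (starRingEnd ℂ) (B s i j)).im) _ s := fun i j =>
    hasDerivAt_im ((hA i j).mul (hasDerivAt_conj (hB i j)))
  convert! ((((h 0 0).const_mul (g.coeffP t)).add ((h 0 1).const_mul (g.coeffQ t))).add
    ((h 1 0).const_mul (g.coeffR t))).neg using 1
  simp only [RiemMetric.diagOmega, Complex.add_im]
  ring

/-- The derivative of the fundamental form along an orbit through the diagonal subgroup. -/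
theorem RiemMetric.fderiv_omegaCoord_orbit (hg : g.IsHermitian) (hi : g.IsInvariant)
    {k l : ℝ → SL2} (hk : ∀ s, k s ∈ SU2) (hl : ∀ s, l s ∈ SU2) (hk0 : k 0 = 1) (hl0 : l 0 = 1)
    {α β : M2} (hkd : ∀ i j, HasDerivAt (fun s => (k s : M2) i j) (α i j) 0)
    (hld : ∀ i j, HasDerivAt (fun s => (l s : M2) i j) (β i j) 0) (t : ℝ) (v w : C3) :
    fderiv ℝ (g.omegaCoord chart v w) (diagCoord t)
        (chartCoord (α * (diagSL t : M2) + (diagSL t : M2) * β.adjugate)) =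
      g.diagOmega t (α.adjugate * chart.jac (diagCoord t) v + chart.jac (diagCoord t) v * β)
          (chart.jac (diagCoord t) w) +
        g.diagOmega t (chart.jac (diagCoord t) v)
          (α.adjugate * chart.jac (diagCoord t) w + chart.jac (diagCoord t) w * β) := by
  set c : ℝ → C3 := fun s => chartCoord (k s * diagSL t * (l s)⁻¹ : SL2) with hc
  have hconst : ∀ i j, HasDerivAt (fun _ : ℝ => (diagSL t : M2) i j) ((0 : M2) i j) 0 :=
    fun i j => hasDerivAt_const _ _
  have hmat : ∀ i j, HasDerivAt (fun s => ((k s * diagSL t * (l s)⁻¹ : SL2) : M2) i j)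
      ((α * (diagSL t : M2) + (diagSL t : M2) * β.adjugate) i j) 0 := by
    have h := hasDerivAt_matrix_mul (hasDerivAt_matrix_mul hkd hconst) (hasDerivAt_inv hld)
    intro i j
    convert! h i j using 1
    simp [hk0, hl0]
  have hcd : HasDerivAt c
      (chartCoord (α * (diagSL t : M2) + (diagSL t : M2) * β.adjugate)) 0 := by
    rw [hasDerivAt_pi]
    intro i
    fin_cases i
    · exact hmat 0 0
    · exact hmat 0 1
    · exact hmat 1 0
  have hc0 : c 0 = diagCoord t := by
    have h : k 0 * diagSL t * (l 0)⁻¹ = diagSL t := by simp [hk0, hl0]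
    ext i
    simp only [hc, h]
    fin_cases i <;> simp [chartCoord, diagCoord, diagSL]
  have hne : ∀ᶠ s in 𝓝 (0 : ℝ), c s 0 ≠ 0 := by
    refine ((hasDerivAt_pi.1 hcd 0).continuousAt).eventually_ne ?_
    rw [hc0]
    exact diagCoord_mem t
  have hev : (fun s => g.omegaCoord chart v w (c s)) =ᶠ[𝓝 0] fun s =>
      g.diagOmega t ((((k s)⁻¹ : SL2) : M2) * chart.jac (c s) v * (l s : M2))
        ((((k s)⁻¹ : SL2) : M2) * chart.jac (c s) w * (l s : M2)) := by
    filter_upwards [hne] with s hs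
    exact g.omegaCoord_orbit hg hi (hk s) (hl s) (chart_chartCoord hs) v w
  have hchain : HasDerivAt (fun s => g.omegaCoord chart v w (c s))
      (fderiv ℝ (g.omegaCoord chart v w) (diagCoord t)
        (chartCoord (α * (diagSL t : M2) + (diagSL t : M2) * β.adjugate))) 0 := by
    have h := (g.differentiableAt_omegaCoord chart v w (diagCoord_mem t)).hasFDerivAt
    rw [← hc0] at h ⊢
    exact h.comp_hasDerivAt 0 hcd
  -- In this chart only the lower right entry of the Jacobian varies with the point. `diagOmega`
  -- ignores that entry, so its derivative d need not be computed.
  have hjac : ∀ v, ∃ d : ℂ, ∀ i j,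
      HasDerivAt (fun s => chart.jac (c s) v i j) ((!![0, 0; 0, d] : M2) i j) 0 := by
    intro v
    have hd : DifferentiableAt ℝ (fun s => chart.jac (c s) v 1 1) 0 := by
      have h1 := ((chart.contDiffOn_jac v 1 1).contDiffAt
        (chart.isOpen.mem_nhds (diagCoord_mem t))).differentiableAt (by simp)
      rw [← hc0] at h1
      exact h1.comp 0 hcd.differentiableAt
    have hz : ∀ i j, (∀ z, chartJac z v i j = chartJac 0 v i j) →
        HasDerivAt (fun s => chart.jac (c s) v i j) 0 0 := by
      intro i j hij
      refine (hasDerivAt_const (0 : ℝ) (chartJac 0 v i j)).congr_of_eventuallyEq ?_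
      filter_upwards [hne] with s hs
      rw [chart_jac hs, hij]
    refine ⟨deriv (fun s => chart.jac (c s) v 1 1) 0, fun i j => ?_⟩
    fin_cases i <;> fin_cases j
    · exact hz 0 0 fun z => rfl
    · exact hz 0 1 fun z => rfl
    · exact hz 1 0 fun z => rfl
    · exact hd.hasDerivAt
  obtain ⟨d, hd⟩ := hjac v
  obtain ⟨d', hd'⟩ := hjac w
  have hA : ∀ v d, (∀ i j,
      HasDerivAt (fun s => chart.jac (c s) v i j) ((!![0, 0; 0, d] : M2) i j) 0) → ∀ i j,
      HasDerivAt (fun s => ((((k s)⁻¹ : SL2) : M2) * chart.jac (c s) v * (l s : M2)) i j)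
        ((α.adjugate * chart.jac (diagCoord t) v + !![0, 0; 0, d] +
          chart.jac (diagCoord t) v * β) i j) 0 := by
    intro v d hd i j
    convert! hasDerivAt_matrix_mul (hasDerivAt_matrix_mul (hasDerivAt_inv hkd) hd) hld i j using 1
    simp [hk0, hl0, hc0]
  have hkey := g.hasDerivAt_diagOmega t (hA v d hd) (hA w d' hd')
  have := hchain.unique (hkey.congr_of_eventuallyEq hev)
  rw [this]
  simp only [hk0, hl0, hc0, inv_one, Matrix.SpecialLinearGroup.coe_one, Matrix.one_mul,
    Matrix.mul_one]
  simp [RiemMetric.diagOmega]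

/-! ### The equations of a closed invariant fundamental form -/

theorem ofReal_cos_sq_add_sin_sq (s : ℝ) : (Real.cos s : ℂ) ^ 2 + (Real.sin s : ℂ) ^ 2 = 1 := by
  rw [← Complex.ofReal_pow, ← Complex.ofReal_pow, ← Complex.ofReal_add,
    Real.cos_sq_add_sin_sq, Complex.ofReal_one]

/-- Rotations in `SU(2)`. -/
def rot (s : ℝ) : SL2 :=
  ⟨!![(Real.cos s : ℂ), (Real.sin s : ℂ); -(Real.sin s : ℂ), (Real.cos s : ℂ)], by
    rw [Matrix.det_fin_two]
    simp [-Complex.ofReal_cos, -Complex.ofReal_sin]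
    linear_combination ofReal_cos_sq_add_sin_sq s⟩

/-- Symmetric rotations in `SU(2)`. -/
def rotI (s : ℝ) : SL2 :=
  ⟨!![(Real.cos s : ℂ), Complex.I * (Real.sin s : ℂ); Complex.I * (Real.sin s : ℂ),
      (Real.cos s : ℂ)], by
    rw [Matrix.det_fin_two]
    simp [-Complex.ofReal_cos, -Complex.ofReal_sin]
    linear_combination ofReal_cos_sq_add_sin_sq s - (Real.sin s : ℂ) ^ 2 * Complex.I_mul_I⟩

/-- The diagonal torus of `SU(2)`. -/
def torus (s : ℝ) : SL2 :=
  ⟨!![(Real.cos s : ℂ) + Complex.I * (Real.sin s : ℂ), 0; 0,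
      (Real.cos s : ℂ) - Complex.I * (Real.sin s : ℂ)], by
    rw [Matrix.det_fin_two]
    simp [-Complex.ofReal_cos, -Complex.ofReal_sin]
    linear_combination ofReal_cos_sq_add_sin_sq s - (Real.sin s : ℂ) ^ 2 * Complex.I_mul_I⟩

theorem rot_mem (s : ℝ) : rot s ∈ SU2 := by
  have h := ofReal_cos_sq_add_sin_sq s
  rw [mem_SU2_iff]
  ext i j
  fin_cases i <;> fin_cases j <;>
    simp [rot, Matrix.mul_apply, Fin.sum_univ_two, -Complex.ofReal_cos, -Complex.ofReal_sin,
      Complex.conj_ofReal]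
  · linear_combination h
  · ring
  · ring
  · linear_combination h

theorem rotI_mem (s : ℝ) : rotI s ∈ SU2 := by
  have h := ofReal_cos_sq_add_sin_sq s
  rw [mem_SU2_iff]
  ext i j
  fin_cases i <;> fin_cases j <;>
    simp [rotI, Matrix.mul_apply, Fin.sum_univ_two, -Complex.ofReal_cos, -Complex.ofReal_sin,
      Complex.conj_ofReal]
  · linear_combination h - (Real.sin s : ℂ) ^ 2 * Complex.I_mul_I
  · ring
  · ring
  · linear_combination h - (Real.sin s : ℂ) ^ 2 * Complex.I_mul_I

theorem torus_mem (s : ℝ) : torus s ∈ SU2 := by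
  have h := ofReal_cos_sq_add_sin_sq s
  rw [mem_SU2_iff]
  ext i j
  fin_cases i <;> fin_cases j <;>
    simp [torus, Matrix.mul_apply, Fin.sum_univ_two, -Complex.ofReal_cos, -Complex.ofReal_sin,
      Complex.conj_ofReal]
  · linear_combination h - (Real.sin s : ℂ) ^ 2 * Complex.I_mul_I
  · linear_combination h - (Real.sin s : ℂ) ^ 2 * Complex.I_mul_I

theorem hasDerivAt_ofReal_cos_zero : HasDerivAt (fun s : ℝ => (Real.cos s : ℂ)) 0 0 := by
  simpa using (Real.hasDerivAt_cos 0).ofReal_comp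

theorem hasDerivAt_ofReal_sin_zero : HasDerivAt (fun s : ℝ => (Real.sin s : ℂ)) 1 0 := by
  simpa using (Real.hasDerivAt_sin 0).ofReal_comp

theorem hasDerivAt_rot (i j : Fin 2) :
    HasDerivAt (fun s => (rot s : M2) i j) ((!![0, 1; -1, 0] : M2) i j) 0 := by
  fin_cases i <;> fin_cases j
  · exact hasDerivAt_ofReal_cos_zero
  · exact hasDerivAt_ofReal_sin_zero
  · exact hasDerivAt_ofReal_sin_zero.neg
  · exact hasDerivAt_ofReal_cos_zero

theorem hasDerivAt_rotI (i j : Fin 2) :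
    HasDerivAt (fun s => (rotI s : M2) i j) ((!![0, Complex.I; Complex.I, 0] : M2) i j) 0 := by
  have h : HasDerivAt (fun s : ℝ => Complex.I * (Real.sin s : ℂ)) Complex.I 0 := by
    simpa using hasDerivAt_ofReal_sin_zero.const_mul Complex.I
  fin_cases i <;> fin_cases j
  · exact hasDerivAt_ofReal_cos_zero
  · exact h
  · exact h
  · exact hasDerivAt_ofReal_cos_zero

theorem hasDerivAt_torus (i j : Fin 2) :
    HasDerivAt (fun s => (torus s : M2) i j) ((!![Complex.I, 0; 0, -Complex.I] : M2) i j) 0 := by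
  have h : HasDerivAt (fun s : ℝ => Complex.I * (Real.sin s : ℂ)) Complex.I 0 := by
    simpa using hasDerivAt_ofReal_sin_zero.const_mul Complex.I
  fin_cases i <;> fin_cases j
  · convert! hasDerivAt_ofReal_cos_zero.fun_add h using 1
    simp
  · exact hasDerivAt_const _ _
  · exact hasDerivAt_const _ _
  · convert! hasDerivAt_ofReal_cos_zero.fun_sub h using 1
    simp

theorem rot_zero : rot 0 = 1 := by
  apply Subtype.ext
  ext i j
  fin_cases i <;> fin_cases j <;> simp [rot]

theorem rotI_zero : rotI 0 = 1 := by
  apply Subtype.ext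
  ext i j
  fin_cases i <;> fin_cases j <;> simp [rotI]

theorem torus_zero : torus 0 = 1 := by
  apply Subtype.ext
  ext i j
  fin_cases i <;> fin_cases j <;> simp [torus]

theorem hasDerivAt_one (i j : Fin 2) :
    HasDerivAt (fun _ : ℝ => ((1 : SL2) : M2) i j) ((0 : M2) i j) 0 :=
  hasDerivAt_const _ _

/-- The two off-diagonal coefficients of an invariant Kähler metric agree. -/
theorem RiemMetric.coeffQ_eq_coeffR (hk : g.IsKahler) (hi : g.IsInvariant) (t : ℝ) :
    g.coeffQ t = g.coeffR t := by
  have hg : g.IsHermitian := hk.hermitian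
  have hone : ∀ s : ℝ, (fun _ : ℝ => (1 : SL2)) s ∈ SU2 := fun _ => SU2.one_mem
  have hZ := fun v w => g.fderiv_omegaCoord_orbit hg hi torus_mem hone torus_zero rfl
    hasDerivAt_torus hasDerivAt_one t v w
  have hV := fun v w => g.fderiv_omegaCoord_orbit hg hi rot_mem hone rot_zero rfl
    hasDerivAt_rot hasDerivAt_one t v w
  have hW := fun v w => g.fderiv_omegaCoord_orbit hg hi hone rot_mem rfl rot_zero
    hasDerivAt_one hasDerivAt_rot t v w
  -- dω = 0 on three directions tangent to the orbit: the left torus, a left rotation and the right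
  -- action of the same rotation group.
  have h := hk.closed chart (diagCoord t) (diagCoord_mem t)
    (chartCoord ((!![Complex.I, 0; 0, -Complex.I] : M2) * (diagSL t : M2) +
      (diagSL t : M2) * (0 : M2).adjugate))
    (chartCoord ((!![0, 1; -1, 0] : M2) * (diagSL t : M2) + (diagSL t : M2) * (0 : M2).adjugate))
    (chartCoord ((0 : M2) * (diagSL t : M2) + (diagSL t : M2) * (!![0, 1; -1, 0] : M2).adjugate))
  rw [hZ, hV, hW] at h
  simp only [chart_jac_diagCoord] at h
  have e1 : Real.exp (t / 2) * Real.exp (-(t / 2)) = 1 := by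
    rw [← Real.exp_add, add_neg_cancel, Real.exp_zero]
  simp [RiemMetric.diagOmega, chartCoord, diagSL, Matrix.adjugate_fin_two, -Complex.ofReal_exp] at h
  have e2 : Real.exp (t / 2) ^ 2 * Real.exp (-t) = 1 := by
    rw [← Real.exp_nat_mul, ← Real.exp_add, ← Real.exp_zero]
    congr 1
    push_cast
    ring
  linear_combination -h / 2 + (g.coeffR t - g.coeffQ t) / 2 * (e1 + e2)

theorem hasDerivAt_diagCoord (t : ℝ) :
    HasDerivAt diagCoord ![((Real.exp (t / 2) / 2 : ℝ) : ℂ), 0, 0] t := by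
  rw [hasDerivAt_pi]
  intro i
  fin_cases i
  · have h : HasDerivAt (fun t : ℝ => Real.exp (t / 2)) (Real.exp (t / 2) / 2) t := by
      convert! ((hasDerivAt_id t).div_const 2).exp using 1
      simp [div_eq_mul_inv]
    exact h.ofReal_comp
  · exact hasDerivAt_const _ _
  · exact hasDerivAt_const _ _

/-- The derivative of the fundamental form along the diagonal subgroup. -/
theorem RiemMetric.fderiv_omegaCoord_diag (hg : g.IsHermitian) (hi : g.IsInvariant) (t : ℝ)
    (v w : C3) :
    fderiv ℝ (g.omegaCoord chart v w) (diagCoord t) ![((Real.exp (t / 2) / 2 : ℝ) : ℂ), 0, 0] =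
      -(deriv g.coeffP t * (v 0 * (starRingEnd ℂ) (w 0)).im +
        deriv g.coeffQ t * (v 1 * (starRingEnd ℂ) (w 1)).im +
        deriv g.coeffR t * (v 2 * (starRingEnd ℂ) (w 2)).im) := by
  have h1 := (g.differentiableAt_omegaCoord chart v w (diagCoord_mem t)).hasFDerivAt.comp_hasDerivAt
    t (hasDerivAt_diagCoord t)
  have hd : ∀ {f : ℝ → ℝ}, ContDiff ℝ ∞ f → HasDerivAt f (deriv f t) t := fun hf =>
    (hf.differentiable (by simp) t).hasDerivAt
  have h2 := ((((hd g.contDiff_coeffP).mul_const (v 0 * (starRingEnd ℂ) (w 0)).im).add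
    ((hd g.contDiff_coeffQ).mul_const (v 1 * (starRingEnd ℂ) (w 1)).im)).add
    ((hd g.contDiff_coeffR).mul_const (v 2 * (starRingEnd ℂ) (w 2)).im)).neg
  refine h1.unique (h2.congr_of_eventuallyEq (Filter.Eventually.of_forall fun s => ?_))
  have h3 := g.omegaCoord_orbit hg hi SU2.one_mem SU2.one_mem (t := s) (z := diagCoord s)
    (by simp [chart_diagCoord]) v w
  rw [Function.comp_apply, h3]
  simp [chart_jac_diagCoord, RiemMetric.diagOmega]

/-- The radial coefficient of an invariant Kähler metric. -/
theorem RiemMetric.coeffP_mul_exp (hk : g.IsKahler) (hi : g.IsInvariant) (t : ℝ) :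
    g.coeffP t * Real.exp t =
      2 * (deriv g.coeffQ t * Real.sinh t + g.coeffQ t * Real.cosh t) := by
  have hg : g.IsHermitian := hk.hermitian
  have hone : ∀ s : ℝ, (fun _ : ℝ => (1 : SL2)) s ∈ SU2 := fun _ => SU2.one_mem
  have hQR : g.coeffR = g.coeffQ := funext fun t => (g.coeffQ_eq_coeffR hk hi t).symm
  have hV := fun v w => g.fderiv_omegaCoord_orbit hg hi rot_mem hone rot_zero rfl
    hasDerivAt_rot hasDerivAt_one t v w
  have hW := fun v w => g.fderiv_omegaCoord_orbit hg hi rotI_mem hone rotI_zero rfl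
    hasDerivAt_rotI hasDerivAt_one t v w
  -- dω = 0 on the radial direction and two left rotations. The radial derivative contributes Q',
  -- the other two terms bring in P and Q.
  have h := hk.closed chart (diagCoord t) (diagCoord_mem t)
    ![((Real.exp (t / 2) / 2 : ℝ) : ℂ), 0, 0]
    (chartCoord ((!![0, 1; -1, 0] : M2) * (diagSL t : M2) + (diagSL t : M2) * (0 : M2).adjugate))
    (chartCoord ((!![0, Complex.I; Complex.I, 0] : M2) * (diagSL t : M2) +
      (diagSL t : M2) * (0 : M2).adjugate))
  rw [g.fderiv_omegaCoord_diag hg hi, hV, hW] at h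
  simp only [chart_jac_diagCoord] at h
  simp [RiemMetric.diagOmega, chartCoord, diagSL, Matrix.adjugate_fin_two, -Complex.ofReal_exp,
    hQR] at h
  have e1 : Real.exp (t / 2) * Real.exp (-(t / 2)) = 1 := by
    rw [← Real.exp_add, add_neg_cancel, Real.exp_zero]
  have e2 : Real.exp t = Real.exp (t / 2) ^ 2 := by
    rw [← Real.exp_nat_mul]
    push_cast
    ring_nf
  have e3 : Real.exp (-t) = Real.exp (-(t / 2)) ^ 2 := by
    rw [← Real.exp_nat_mul]
    push_cast
    ring_nf
  rw [Real.sinh_eq, Real.cosh_eq, e2, e3]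
  rw [e3] at h
  generalize Real.exp (t / 2) = x at *
  generalize Real.exp (-(t / 2)) = y at *
  have hre : ((x : ℂ) / (starRingEnd ℂ) 2).re = x / 2 := by
    rw [Complex.conj_ofNat, Complex.div_ofNat_re, Complex.ofReal_re]
  rw [hre] at h
  linear_combination h + g.coeffQ t * y ^ 2 * e1

/-! ### The Ricci-flat equation -/

/-- Along the line the first derivative is s · f'(ρ)/ρ with ρ = √(r² + s²); its derivative at s = 0
is f'(r)/r. A second-order condition on F thus becomes a first-order one on f. -/
theorem realHessian_of_radial {F : C3 → ℝ} {z v : C3} (hF : ContDiffAt ℝ ∞ F z) {f : ℝ → ℝ}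
    (hf : ContDiff ℝ ∞ f) {r c : ℝ} (hr : 0 < r)
    (h : ∀ s : ℝ, F (z + s • v) = f (Real.sqrt (r ^ 2 + s ^ 2)) + c) :
    realHessian F z v v = deriv f r / r := by
  have hline : ∀ s : ℝ, HasDerivAt (fun s : ℝ => z + s • v) v s := by
    intro s
    simpa using ((hasDerivAt_id s).smul_const v).const_add z
  have hpos : ∀ s : ℝ, 0 < r ^ 2 + s ^ 2 := fun s => by positivity
  have hsqrt : ∀ s : ℝ, HasDerivAt (fun s : ℝ => Real.sqrt (r ^ 2 + s ^ 2))
      (s / Real.sqrt (r ^ 2 + s ^ 2)) s := by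
    intro s
    convert! (((hasDerivAt_id s).pow 2).const_add (r ^ 2)).sqrt (hpos s).ne' using 1
    simp
    field_simp
  have hev : ∀ᶠ s : ℝ in 𝓝 0, fderiv ℝ F (z + s • v) v =
      s * (deriv f (Real.sqrt (r ^ 2 + s ^ 2)) / Real.sqrt (r ^ 2 + s ^ 2)) := by
    have hd : ∀ᶠ x in 𝓝 z, DifferentiableAt ℝ F x :=
      ((hF.of_le (m := 1) (by exact_mod_cast le_top)).eventually (by simp)).mono fun x hx =>
        hx.differentiableAt (by simp)
    have hc : Filter.Tendsto (fun s : ℝ => z + s • v) (𝓝 0) (𝓝 z) := by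
      have := (hline 0).continuousAt.tendsto
      simpa using this
    filter_upwards [hc.eventually hd] with s hs
    have h1 := hs.hasFDerivAt.comp_hasDerivAt s (hline s)
    have h2 := (((hf.differentiable (by simp)) _).hasDerivAt.comp s (hsqrt s)).add_const c
    have h3 := h1.unique (h2.congr_of_eventuallyEq (Filter.Eventually.of_forall h))
    rw [h3]
    ring
  have h1 : HasDerivAt (fun s : ℝ => fderiv ℝ F (z + s • v) v) (realHessian F z v v) 0 := by
    have hd : DifferentiableAt ℝ (fun x => fderiv ℝ F x v) z :=
      (differentiableAt_fderiv hF).clm_apply (differentiableAt_const v)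
    have h2 := hd.hasFDerivAt
    rw [show z = z + (0 : ℝ) • v by simp] at h2
    have h3 := h2.comp_hasDerivAt 0 (hline 0)
    rw [show z + (0 : ℝ) • v = z by simp, fderiv_fderiv_apply hF] at h3
    exact h3
  have hρ : DifferentiableAt ℝ
      (fun s => deriv f (Real.sqrt (r ^ 2 + s ^ 2)) / Real.sqrt (r ^ 2 + s ^ 2)) 0 := by
    have h2 : Differentiable ℝ (deriv f) :=
      ((contDiff_infty_iff_deriv.1 hf).2).differentiable (by simp)
    exact ((h2 _).comp 0 (hsqrt 0).differentiableAt).div (hsqrt 0).differentiableAt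
      (Real.sqrt_pos.2 (hpos 0)).ne'
  have h2 := ((hasDerivAt_id (0 : ℝ)).mul hρ.hasDerivAt).congr_of_eventuallyEq hev
  rw [h1.unique h2]
  simp [Real.sqrt_sq hr.le]

theorem frameJac_chart_det {x y : ℂ} (hx : x ≠ 0) :
    (chart.frameJac ![x, y, 0]).det = x⁻¹ := by
  have hz : (![x, y, 0] : C3) 0 ≠ 0 := hx
  rw [Matrix.det_fin_three]
  simp only [Param.frameJac, Matrix.of_apply, frameCoord, Matrix.SpecialLinearGroup.coe_inv,
    chart_toFun hz, chart_jac hz]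
  simp [chartMat, chartJac, Matrix.adjugate_fin_two]
  field_simp

theorem tau_chart {x y : ℂ} (hx : x ≠ 0) :
    tau (chart.toFun ![x, y, 0]) =
      (Complex.normSq x + Complex.normSq y + (Complex.normSq x)⁻¹) / 2 := by
  have hz : (![x, y, 0] : C3) 0 ≠ 0 := hx
  rw [tau, chart_toFun hz]
  simp [chartMat]

/-- τ separates the orbits, since cosh is injective on t ≥ 0. -/
theorem RiemMetric.gramDet_eq_of_tau (hg : g.IsHermitian) (hi : g.IsInvariant) {u : SL2} {t : ℝ}
    (h : tau u = Real.cosh t) : (g.gram u).det = (g.gram (diagSL t)).det := by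
  have key : ∀ v : SL2, ∃ s, 0 ≤ s ∧ tau v = Real.cosh s ∧
      (g.gram v).det = (g.gram (diagSL s)).det := by
    intro v
    obtain ⟨k, hk, l, hl, s, hs, rfl⟩ := exists_kak v
    exact ⟨s, hs, by rw [tau_translate hk hl, tau_diagSL], g.gramDet_translate hg hi hk hl _⟩
  obtain ⟨s, hs, h1, h2⟩ := key u
  obtain ⟨r, hr, h3, h4⟩ := key (diagSL t)
  rw [tau_diagSL, ← h, h1] at h3
  have : s = r := Real.cosh_strictMonoOn.injOn hs hr h3
  rw [h2, h4, this]

theorem RiemMetric.contDiffOn_det_hermMatrix (g : RiemMetric) (φ : Param) :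
    ContDiffOn ℝ ∞ (fun z => (g.hermMatrix φ z).det.re) φ.U := by
  have hentry : ∀ a b, ContDiffOn ℝ ∞ (fun z => g.hermMatrix φ z a b) φ.U := by
    intro a b
    simp only [RiemMetric.hermMatrix, Matrix.of_apply]
    have h1 := Complex.ofRealCLM.contDiff.comp_contDiffOn
      (g.smooth φ (Pi.single a 1) (Pi.single b 1))
    have h2 := Complex.ofRealCLM.contDiff.comp_contDiffOn
      (g.smooth φ (Pi.single a 1) (Pi.single b Complex.I))
    exact (h1.add (contDiffOn_const.mul h2)).div_const 2
  have hdet : ContDiffOn ℝ ∞ (fun z => (g.hermMatrix φ z).det) φ.U := by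
    simp only [Matrix.det_fin_three]
    have := hentry
    fun_prop
  exact Complex.reCLM.contDiff.comp_contDiffOn hdet

/-- The volume density in the coordinates `chart`. -/
theorem RiemMetric.det_chart (hg : g.IsHermitian) (hi : g.IsInvariant) {x y : ℂ} (hx : x ≠ 0)
    {t : ℝ} (h : (Complex.normSq x + Complex.normSq y + (Complex.normSq x)⁻¹) / 2 = Real.cosh t) :
    (g.hermMatrix chart ![x, y, 0]).det.re = (Complex.normSq x)⁻¹ *
      (g.coeffP t * Real.exp t * g.coeffQ t * g.coeffR t / 8) := by
  rw [hg.det_hermMatrix, frameJac_chart_det hx,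
    g.gramDet_eq_of_tau hg hi ((tau_chart hx).trans h), g.gramDet_diagSL hg hi,
    ← Complex.ofReal_mul, Complex.ofReal_re, Complex.normSq_inv]

theorem RiemMetric.density_pos (t : ℝ) :
    0 < g.coeffP t * Real.exp t * g.coeffQ t * g.coeffR t / 8 := by
  have := g.coeffP_pos t
  have := g.coeffQ_pos t
  have := g.coeffR_pos t
  positivity

theorem exists_cosh_eq_tau (u : SL2) : ∃ t, tau u = Real.cosh t := by
  obtain ⟨k, hk, l, hl, t, -, rfl⟩ := exists_kak u
  exact ⟨t, by rw [tau_translate hk hl, tau_diagSL]⟩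

theorem RiemMetric.contDiffAt_log_det (hg : g.IsHermitian) (hi : g.IsInvariant) {x y : ℂ}
    (hx : x ≠ 0) :
    ContDiffAt ℝ ∞ (fun z => Real.log (g.hermMatrix chart z).det.re) ![x, y, 0] := by
  have h := (g.contDiffOn_det_hermMatrix chart).contDiffAt
    (chart.isOpen.mem_nhds (x := ![x, y, 0]) hx)
  refine h.log ?_
  obtain ⟨t, ht⟩ := exists_cosh_eq_tau (chart.toFun ![x, y, 0])
  rw [g.det_chart hg hi hx ((tau_chart hx).symm.trans ht)]
  exact (mul_pos (inv_pos.2 (Complex.normSq_pos.2 hx)) (g.density_pos t)).ne'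

theorem cosh_eq_of_sub_inv (t : ℝ) :
    (1 + (Real.exp (t / 2) - Real.exp (-(t / 2))) ^ 2 + 1) / 2 = Real.cosh t := by
  have e1 : Real.exp (t / 2) * Real.exp (-(t / 2)) = 1 := by
    rw [← Real.exp_add, add_neg_cancel, Real.exp_zero]
  have e2 : Real.exp t = Real.exp (t / 2) ^ 2 := by
    rw [← Real.exp_nat_mul]
    push_cast
    ring_nf
  have e3 : Real.exp (-t) = Real.exp (-(t / 2)) ^ 2 := by
    rw [← Real.exp_nat_mul]
    push_cast
    ring_nf
  rw [Real.cosh_eq, e2, e3]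
  linear_combination -e1

/-- The volume density of an invariant Ricci-flat metric is constant. -/
theorem RiemMetric.density_eq (hg : g.IsHermitian) (hi : g.IsInvariant) (hr : g.IsRicciFlat)
    {s t : ℝ} (hs : 0 < s) (ht : 0 < t) :
    g.coeffP s * Real.exp s * g.coeffQ s * g.coeffR s =
      g.coeffP t * Real.exp t * g.coeffQ t * g.coeffR t := by
  set F : C3 → ℝ := fun z => Real.log (g.hermMatrix chart z).det.re with hF
  -- On the slice x = 1, y = s of the chart, 2τ = 2 + s². Every value τ ≥ 1 is reached, so f carries
  -- the whole density.
  set f : ℝ → ℝ := fun s => F ![1, (s : ℂ), 0] with hfdef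
  have hf : ContDiff ℝ ∞ f := by
    rw [contDiff_iff_contDiffAt]
    intro s
    refine ContDiffAt.comp (f := fun s : ℝ => (![1, (s : ℂ), 0] : C3)) s
      (g.contDiffAt_log_det hg hi one_ne_zero) ?_
    rw [contDiffAt_pi]
    intro i
    fin_cases i
    · exact contDiffAt_const
    · exact Complex.ofRealCLM.contDiff.contDiffAt
    · exact contDiffAt_const
  have hderiv : ∀ r : ℝ, 0 < r → deriv f r = 0 := by
    intro r hr0
    -- Chosen so that e = exp(t/2) satisfies e − 1/e = r. At (e, y, 0) then 2τ = 2 + r² + |y|², so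
    -- there F is f(√(r² + |y|²)) plus a constant.
    set t : ℝ := 2 * Real.arsinh (r / 2) with htdef
    set e : ℝ := Real.exp (t / 2) with he
    have he0 : 0 < e := Real.exp_pos _
    have hre : r = e - e⁻¹ := by
      have h1 : Real.sinh (t / 2) = r / 2 := by
        rw [htdef, mul_div_cancel_left₀ _ two_ne_zero, Real.sinh_arsinh]
      rw [Real.sinh_eq, Real.exp_neg] at h1
      linarith
    have hx : (e : ℂ) ≠ 0 := Complex.ofReal_ne_zero.2 he0.ne'
    have hrad : ∀ (s : ℝ) (y : ℂ), Complex.normSq y = s ^ 2 →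
        F ![(e : ℂ), y, 0] = f (Real.sqrt (r ^ 2 + s ^ 2)) + Real.log (Complex.normSq e)⁻¹ := by
      intro s y hy
      obtain ⟨τ, hτ⟩ := exists_cosh_eq_tau (chart.toFun ![(e : ℂ), y, 0])
      rw [tau_chart hx] at hτ
      have h2 : (Complex.normSq 1 + Complex.normSq (Real.sqrt (r ^ 2 + s ^ 2) : ℂ) +
          (Complex.normSq 1)⁻¹) / 2 = Real.cosh τ := by
        rw [← hτ, hy, Complex.normSq_ofReal, Real.mul_self_sqrt (by positivity), hre,
          Complex.normSq_ofReal, Complex.normSq_one]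
        field_simp
        ring
      simp only [hfdef, hF]
      rw [g.det_chart hg hi hx hτ, g.det_chart hg hi one_ne_zero h2, Complex.normSq_one, inv_one,
        one_mul, Real.log_mul (inv_pos.2 (Complex.normSq_pos.2 hx)).ne' (g.density_pos τ).ne']
      ring
    have hFz := g.contDiffAt_log_det hg hi hx (y := 0)
    have h1 : realHessian F ![(e : ℂ), 0, 0] (Pi.single 1 1) (Pi.single 1 1) = deriv f r / r := by
      refine realHessian_of_radial hFz hf hr0 (c := Real.log (Complex.normSq e)⁻¹) fun s => ?_
      rw [← hrad s s (by rw [Complex.normSq_ofReal, sq])]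
      refine congrArg F ?_
      ext i
      fin_cases i <;> simp
    have h2 : realHessian F ![(e : ℂ), 0, 0] (Pi.single 1 Complex.I) (Pi.single 1 Complex.I) =
        deriv f r / r := by
      refine realHessian_of_radial hFz hf hr0 (c := Real.log (Complex.normSq e)⁻¹) fun s => ?_
      rw [← hrad s (s * Complex.I) (by simp [sq])]
      refine congrArg F ?_
      ext i
      fin_cases i <;> simp
    -- The single component ∂²/∂y∂ȳ of the Ricci form suffices: the Laplacian in y at y = 0 is 2
    -- f'(r)/r.
    have h3 := hr chart ![(e : ℂ), 0, 0] hx 1 1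
    rw [complexHessian_eq hFz, h1, h2, realHessian_symm hFz (Pi.single 1 1), sub_self,
      Complex.ofReal_zero, mul_zero, add_zero] at h3
    have h4 : deriv f r / r + deriv f r / r = 0 := by
      exact_mod_cast (div_eq_zero_iff.1 h3).resolve_right (by norm_num)
    have h5 : deriv f r / r = 0 := by linarith
    exact (div_eq_zero_iff.1 h5).resolve_right hr0.ne'
  have hval : ∀ t : ℝ, f (Real.exp (t / 2) - Real.exp (-(t / 2))) =
      Real.log (g.coeffP t * Real.exp t * g.coeffQ t * g.coeffR t / 8) := by
    intro t
    simp only [hfdef, hF]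
    rw [g.det_chart hg hi one_ne_zero (t := t), Complex.normSq_one, inv_one, one_mul]
    rw [Complex.normSq_one, Complex.normSq_ofReal, inv_one, ← cosh_eq_of_sub_inv t]
    ring
  have hpos : ∀ t : ℝ, 0 < t → Real.exp (t / 2) - Real.exp (-(t / 2)) ∈ Set.Ioi (0 : ℝ) := by
    intro t ht
    exact sub_pos.2 (Real.exp_lt_exp.2 (by linarith))
  have hconst := isOpen_Ioi.is_const_of_deriv_eq_zero isPreconnected_Ioi
    (hf.differentiable (by simp)).differentiableOn (fun r hr => hderiv r hr) (hpos s hs) (hpos t ht)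
  rw [hval, hval] at hconst
  have := Real.log_injOn_pos (g.density_pos s) (g.density_pos t) hconst
  linarith

/-! ### Uniqueness -/

theorem RiemMetric.hasDerivAt_coeffQ_mul_sinh (hk : g.IsKahler) (hi : g.IsInvariant) (t : ℝ) :
    HasDerivAt (fun t => g.coeffQ t * Real.sinh t) (g.coeffP t * Real.exp t / 2) t := by
  have h := ((g.contDiff_coeffQ.differentiable (by simp)) t).hasDerivAt.mul
    (Real.hasDerivAt_sinh t)
  convert! h using 1
  rw [g.coeffP_mul_exp hk hi]
  ring

/-- By the chain rule the derivative is (3/2) (P eᵗ Q²) sinh² t, and the bracket is the constant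
density because Q = R. -/
theorem RiemMetric.hasDerivAt_cube (hk : g.IsKahler) (hi : g.IsInvariant) (hr : g.IsRicciFlat)
    {t : ℝ} (ht : 0 ≤ t) :
    HasDerivAt (fun t => (g.coeffQ t * Real.sinh t) ^ 3)
      (3 / 2 * (g.coeffP 1 * Real.exp 1 * g.coeffQ 1 * g.coeffR 1) * Real.sinh t ^ 2) t := by
  convert! (g.hasDerivAt_coeffQ_mul_sinh hk hi t).pow 3 using 1
  -- Constancy of the density is known only for t > 0; at t = 0 both derivatives carry a factor
  -- sinh² t = 0.
  rcases ht.eq_or_lt with rfl | ht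
  · simp
  · rw [← g.density_eq hk.hermitian hi hr ht one_pos, ← g.coeffQ_eq_coeffR hk hi t]
    push_cast
    ring

theorem RiemMetric.coeff_eq {g₀ : RiemMetric} (hk : g.IsKahler) (hi : g.IsInvariant)
    (hr : g.IsRicciFlat) (hk₀ : g₀.IsKahler) (hi₀ : g₀.IsInvariant) (hr₀ : g₀.IsRicciFlat) :
    ∃ c : ℝ, 0 < c ∧ ∀ t, 0 ≤ t → g.coeffP t = c * g₀.coeffP t ∧ g.coeffQ t = c * g₀.coeffQ t := by
  set C := g.coeffP 1 * Real.exp 1 * g.coeffQ 1 * g.coeffR 1 with hC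
  set C₀ := g₀.coeffP 1 * Real.exp 1 * g₀.coeffQ 1 * g₀.coeffR 1 with hC₀
  have hCpos : 0 < C := by linarith [g.density_pos 1]
  have hC₀pos : 0 < C₀ := by linarith [g₀.density_pos 1]
  -- Scaling a metric by c scales its density P eᵗ Q R by c³, so c must be the cube root of the
  -- ratio of densities.
  obtain ⟨c, hc, hc3⟩ : ∃ c : ℝ, 0 < c ∧ c ^ 3 = C / C₀ :=
    ⟨(C / C₀) ^ (1 / 3 : ℝ), by positivity, by
      rw [← Real.rpow_natCast, ← Real.rpow_mul (by positivity)]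
      norm_num⟩
  have hC' : C = c ^ 3 * C₀ := by
    rw [hc3, div_mul_cancel₀ _ hC₀pos.ne']
  have hcube : ∀ t, 0 ≤ t → (g.coeffQ t * Real.sinh t) ^ 3 =
      c ^ 3 * (g₀.coeffQ t * Real.sinh t) ^ 3 := by
    intro t ht
    have hd : ∀ x, 0 ≤ x → HasDerivAt (fun t => (g.coeffQ t * Real.sinh t) ^ 3 -
        c ^ 3 * (g₀.coeffQ t * Real.sinh t) ^ 3) 0 x := by
      intro x hx
      convert! (g.hasDerivAt_cube hk hi hr hx).sub
        ((g₀.hasDerivAt_cube hk₀ hi₀ hr₀ hx).const_mul (c ^ 3)) using 1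
      rw [← hC, ← hC₀, hC']
      ring
    have h := constant_of_has_deriv_right_zero (a := 0) (b := t)
      (fun x hx => (hd x hx.1).continuousAt.continuousWithinAt)
      (fun x hx => (hd x hx.1).hasDerivWithinAt) t ⟨ht, le_rfl⟩
    simp only [Real.sinh_zero, mul_zero] at h
    linarith
  have hQ : ∀ t, 0 < t → g.coeffQ t = c * g₀.coeffQ t := by
    intro t ht
    have hs : 0 < Real.sinh t := Real.sinh_pos_iff.2 ht
    have h1 := hcube t ht.le
    have h2 : g.coeffQ t ^ 3 = (c * g₀.coeffQ t) ^ 3 := by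
      have : Real.sinh t ^ 3 ≠ 0 := by positivity
      apply mul_right_cancel₀ this
      linear_combination h1
    exact (pow_left_inj₀ (g.coeffQ_pos t).le (mul_pos hc (g₀.coeffQ_pos t)).le three_ne_zero).1 h2
  have hP : ∀ t, 0 < t → g.coeffP t = c * g₀.coeffP t := by
    intro t ht
    have h1 := g.density_eq hk.hermitian hi hr ht one_pos
    have h2 := g₀.density_eq hk₀.hermitian hi₀ hr₀ ht one_pos
    rw [← hC, ← g.coeffQ_eq_coeffR hk hi, hQ t ht, hC'] at h1
    rw [← hC₀, ← g₀.coeffQ_eq_coeffR hk₀ hi₀] at h2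
    have h3 : c ^ 2 * Real.exp t * g₀.coeffQ t ^ 2 ≠ 0 := by
      have := g₀.coeffQ_pos t
      positivity
    apply mul_right_cancel₀ h3
    linear_combination h1 - c ^ 3 * h2
  -- Division by sinh t excludes t = 0; continuity of the coefficients recovers it.
  have hext : ∀ {f f₀ : ℝ → ℝ}, Continuous f → Continuous f₀ → (∀ t, 0 < t → f t = c * f₀ t) →
      ∀ t, 0 ≤ t → f t = c * f₀ t := by
    intro f f₀ hf hf₀ h t ht
    have h1 : Set.EqOn f (fun t => c * f₀ t) (Set.Ioi 0) := fun t ht => h t ht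
    have h2 := h1.closure hf (hf₀.const_mul c)
    rw [closure_Ioi] at h2
    exact h2 ht
  exact ⟨c, hc, fun t ht =>
    ⟨hext g.contDiff_coeffP.continuous g₀.contDiff_coeffP.continuous hP t ht,
      hext g.contDiff_coeffQ.continuous g₀.contDiff_coeffQ.continuous hQ t ht⟩⟩

/-- Invariant Ricci-flat Kähler metrics are unique up to homothety. -/
theorem RiemMetric.eq_smul {g₀ : RiemMetric} (hk : g.IsKahler) (hi : g.IsInvariant)
    (hr : g.IsRicciFlat) (hk₀ : g₀.IsKahler) (hi₀ : g₀.IsInvariant) (hr₀ : g₀.IsRicciFlat) :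
    ∃ c : ℝ, 0 < c ∧ ∀ (u : SL2) (X Y : tangentSpace u), g.inner u X Y = c * g₀.inner u X Y := by
  obtain ⟨c, hc, h⟩ := g.coeff_eq hk hi hr hk₀ hi₀ hr₀
  have hdiag : ∀ t, 0 ≤ t → ∀ A ∈ tangentSpace (diagSL t), ∀ B ∈ tangentSpace (diagSL t),
      g.form (diagSL t) A B = c * g₀.form (diagSL t) A B := by
    intro t ht A hA B hB
    rw [g.form_diagSL hk.hermitian hi t hA hB, g₀.form_diagSL hk₀.hermitian hi₀ t hA hB,
      ← g.coeffQ_eq_coeffR hk hi, ← g₀.coeffQ_eq_coeffR hk₀ hi₀, (h t ht).1, (h t ht).2]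
    ring
  refine ⟨c, hc, fun u X Y => ?_⟩
  rw [g.inner_eq_form, g₀.inner_eq_form]
  obtain ⟨k, hk', l, hl, t, ht, hu⟩ := exists_kak u
  have hmem : ∀ X : tangentSpace u,
      ((k⁻¹ : SL2) : M2) * (X : M2) * (l : M2) ∈ tangentSpace (diagSL t) := fun X =>
    translate_inv_mem (hu ▸ X.2)
  have h1 := hi.form_translate hk' hl (diagSL t) (((k⁻¹ : SL2) : M2) * (X : M2) * (l : M2))
    (((k⁻¹ : SL2) : M2) * (Y : M2) * (l : M2))
  have h2 := hi₀.form_translate hk' hl (diagSL t) (((k⁻¹ : SL2) : M2) * (X : M2) * (l : M2))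
    (((k⁻¹ : SL2) : M2) * (Y : M2) * (l : M2))
  rw [translate_inv_cancel, translate_inv_cancel, ← hu] at h1 h2
  rw [h1, h2, hdiag t ht _ (hmem X) _ (hmem Y)]

/-! ### The polar decomposition -/

theorem exp_conj_diagonal {V : M2} (hV : V.conjTranspose * V = 1) (d : Fin 2 → ℂ) :
    NormedSpace.exp (V * Matrix.diagonal d * V.conjTranspose) =
      V * Matrix.diagonal (fun i => Complex.exp (d i)) * V.conjTranspose := by
  have hinv : V⁻¹ = V.conjTranspose := Matrix.inv_eq_left_inv hV
  have hunit : IsUnit V := IsUnit.of_mul_eq_one _ (mul_eq_one_comm.1 hV)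
  rw [← hinv, Matrix.exp_conj V _ hunit, Matrix.exp_diagonal]
  congr 3
  ext i
  rw [Pi.coe_exp, Complex.exp_eq_exp_ℂ]

theorem trace_conj_diagonal {V : M2} (hV : V.conjTranspose * V = 1) (d : Fin 2 → ℂ) :
    (V * Matrix.diagonal d * V.conjTranspose).trace = d 0 + d 1 := by
  rw [Matrix.trace_mul_comm, ← Matrix.mul_assoc, hV, Matrix.one_mul, Matrix.trace_diagonal,
    Fin.sum_univ_two]

theorem conj_diagonal_mul {V : M2} (hV : V.conjTranspose * V = 1) (d : Fin 2 → ℂ) :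
    V * Matrix.diagonal d * V.conjTranspose * (V * Matrix.diagonal d * V.conjTranspose) =
      V * Matrix.diagonal (fun i => d i * d i) * V.conjTranspose := by
  rw [← Matrix.diagonal_mul_diagonal]
  calc _ = V * Matrix.diagonal d * (V.conjTranspose * V) * Matrix.diagonal d *
        V.conjTranspose := by simp only [Matrix.mul_assoc]
    _ = _ := by rw [hV, Matrix.mul_one]; simp only [Matrix.mul_assoc]

/-- The invariant `tau` in terms of the polar decomposition. -/
theorem IsPolar.tau_eq {u a : SL2} {h : M2} (hu : IsPolar u a h) :
    tau u = Real.cosh (su2Norm h) := by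
  obtain ⟨ha, ⟨hh, htr⟩, hpol⟩ := hu
  set B : M2 := Complex.I • h with hB
  have hBh : B.IsHermitian := by
    rw [Matrix.IsHermitian, hB, Matrix.conjTranspose_smul, hh]
    simp
  obtain ⟨V, hV, x, hx⟩ : ∃ V : M2, V.conjTranspose * V = 1 ∧ ∃ x : Fin 2 → ℝ,
      B = V * Matrix.diagonal (fun i => (x i : ℂ)) * V.conjTranspose :=
    ⟨hBh.eigenvectorUnitary, Matrix.mem_unitaryGroup_iff'.1 hBh.eigenvectorUnitary.2,
      hBh.eigenvalues, by
        conv_lhs => rw [hBh.spectral_theorem, Unitary.conjStarAlgAut_apply]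
        rfl⟩
  have htrB : (x 0 : ℂ) + x 1 = 0 := by
    rw [← trace_conj_diagonal hV fun i => (x i : ℂ), ← hx, hB, Matrix.trace_smul, htr, smul_zero]
  have hx1 : x 1 = -x 0 := by
    have : x 0 + x 1 = 0 := by exact_mod_cast htrB
    linarith
  -- The eigenvalues of ih are ±x₀, so |h|² = 2 · 2x₀². The normalization of the norm makes |h|
  -- twice the eigenvalue.
  have hnorm : su2Norm h = |2 * x 0| := by
    have e : h.conjTranspose * h = B * B := by
      rw [hB, Matrix.smul_mul, Matrix.mul_smul, smul_smul, Complex.I_mul_I, hh]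
      simp
    rw [su2Norm, e, hx, conj_diagonal_mul hV, trace_conj_diagonal hV, ← Real.sqrt_sq_eq_abs]
    congr 1
    simp [hx1]
    ring
  have hexp := exp_conj_diagonal hV fun i => (x i : ℂ)
  rw [← hx] at hexp
  -- The unitary factor cancels, leaving u*u = exp(ih)² with eigenvalues e^{±2x₀}; half its trace is
  -- cosh |h|.
  have huu : (u : M2).conjTranspose * (u : M2) = NormedSpace.exp B * NormedSpace.exp B := by
    rw [hpol, Matrix.conjTranspose_mul, hBh.exp.eq, Matrix.mul_assoc, ← Matrix.mul_assoc _ (a : M2),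
      mem_SU2_iff.1 ha, Matrix.one_mul]
  have htau := tau_eq_trace u
  rw [huu, hexp, conj_diagonal_mul hV, trace_conj_diagonal hV, hx1, ← Complex.ofReal_exp,
    ← Complex.ofReal_exp, ← Complex.ofReal_mul, ← Complex.ofReal_mul, ← Complex.ofReal_add] at htau
  have htau' := Complex.ofReal_injective htau
  rw [hnorm, Real.cosh_abs, Real.cosh_eq, two_mul, neg_add, Real.exp_add, Real.exp_add]
  linarith

/-- Existence of the polar decomposition. -/
theorem exists_isPolar (u : SL2) : ∃ (a : SL2) (h : M2), IsPolar u a h := by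
  obtain ⟨k, hk, l, hl, t, -, rfl⟩ := exists_kak u
  have hV := mem_SU2_iff.1 hl
  set d : Fin 2 → ℂ := ![((t / 2 : ℝ) : ℂ), ((-(t / 2) : ℝ) : ℂ)] with hd
  have hI : Complex.I • (-Complex.I • ((l : M2) * Matrix.diagonal d * (l : M2).conjTranspose)) =
      (l : M2) * Matrix.diagonal d * (l : M2).conjTranspose := by
    rw [smul_smul]
    simp
  -- From u = k D l⁻¹ = (k l⁻¹)(l D l⁻¹): the second factor is the exponential of the Hermitian
  -- matrix l diag(t/2, −t/2) l*, which is ih for the chosen h.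
  refine ⟨k * l⁻¹, -Complex.I • ((l : M2) * Matrix.diagonal d * (l : M2).conjTranspose),
    SU2.mul_mem hk (SU2.inv_mem hl), ⟨?_, ?_⟩, ?_⟩
  · have hdd : (Matrix.diagonal d).conjTranspose = Matrix.diagonal d := by
      rw [Matrix.diagonal_conjTranspose]
      congr 1
      ext i
      fin_cases i <;> simp [hd]
    rw [Matrix.conjTranspose_smul, Matrix.conjTranspose_mul, Matrix.conjTranspose_mul,
      Matrix.conjTranspose_conjTranspose, hdd, Matrix.mul_assoc]
    simp
  · rw [Matrix.trace_smul, trace_conj_diagonal hV]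
    simp [hd]
  · have hD : (Matrix.diagonal fun i => Complex.exp (d i)) = (diagSL t : M2) := by
      ext i j
      fin_cases i <;> fin_cases j <;> simp [hd, diagSL]
    have hu : k * diagSL t * l⁻¹ = k * l⁻¹ * (l * diagSL t * l⁻¹) := by group
    rw [hI, exp_conj_diagonal hV, hD, ← SU2.coe_inv hl, ← Matrix.SpecialLinearGroup.coe_mul,
      ← Matrix.SpecialLinearGroup.coe_mul, ← Matrix.SpecialLinearGroup.coe_mul, hu]

end SL2Kahler

end

theorem theoremC :
    -- the polar decomposition exists and determines the potential as a function on `SL(2, ℂ)`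
    (∀ u : SL2, ∃ (a : SL2) (h : M2), IsPolar u a h) ∧
    ∃ K : SL2 → ℝ,
      (∀ (u a : SL2) (h : M2), IsPolar u a h →
        K u = ∫ t in (0 : ℝ)..su2Norm h, (Real.sinh (2 * t) - 2 * t) ^ (1 / 3 : ℝ)) ∧
      ∃ g₀ : RiemMetric,
        g₀.HasPotential K ∧
        g₀.IsCompleteInvariantRicciFlatKahler ∧
        ∀ g : RiemMetric, g.IsCompleteInvariantRicciFlatKahler →
          ∃ c : ℝ, 0 < c ∧ ∀ (u : SL2) (X Y : tangentSpace u),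
            g.inner u X Y = c * g₀.inner u X Y := by
  refine ⟨exists_isPolar, potential, fun u a h hu => ?_, stenzel, stenzel_hasPotential,
    ⟨stenzel_isKahler, stenzel_isInvariant, stenzel_isRicciFlat, stenzel_isComplete⟩,
    fun g hg => RiemMetric.eq_smul hg.isKahler hg.isInvariant hg.isRicciFlat stenzel_isKahler
      stenzel_isInvariant stenzel_isRicciFlat⟩
  rw [potential, hu.tau_eq, radialPotential_cosh (t := su2Norm h) (Real.sqrt_nonneg _)]
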